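/- Let $N\ge 3$ be odd, $m=(N-1)/2$, $\zeta=e^{2\pi i/N}$; write $a\equiv_N b$ if $a=\zeta^n b$ for some integer $n$ (for tensors: one $n$ for all entries). **Tensors.** Let $\Delta$ be an oriented tetrahedron with ordered vertices $v_0,\dots,v_3$ (a branching $b$), with sign $*_b=\pm1$ comparing the given orientation with that of the ordering; $F_a$ is the face opposite to $v_a$. Edges $[v_0,v_1],[v_2,v_3]$ have index $0$, $[v_1,v_2],[v_0,v_3]$ index $1$, $[v_0,v_2],[v_1,v_3]$ (the diagonal edges) index $2$. A decoration $(w,f,c)$ consists of $w\in(\mathbb C\setminus\{0,1\})^3$ with $w_{k+1}(1-w_k)=1$ ($k$ mod $3$), $f\in\mathbb Z^3$ with $l_0+l_1+l_2=0$ where $l_k=\log w_k+i\pi f_k$ (principal logarithm, imaginary part in $(-\pi,\pi]$), and $c\in\mathbb Z^3$ with $c_0+c_1+c_2=1$. Put $u_k=\exp\big(\frac1N(\log w_k+i\pi(N+1)(f_k-*_bc_k))\big)$. With $x^{1/N}$ the principal root, $g(x)=\prod_{j=1}^{N-1}(1-x\zeta^{-j})^{j/N}$, $h(x)=g(x)/g(1)$,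 $\omega(u,v|n)=\prod_{j=1}^{[n]_N}v(1-u\zeta^j)^{-1}$ where $[n]_N\in\{0,\dots,N-1\}$ is the residue of $n$, and $\delta_N$ the indicator of $N\mathbb Z$, let $$\mathcal L_N(u,v)^{i,j}_{k,l}=h(u)\,\zeta^{kj+(m+1)k^2}\,\omega(u,v|i-k)\,\delta_N(i+j-l),\qquad 0\le i,j,k,l\le N-1 .$$ The matrix dilogarithm of $(\Delta,b,w,f,c)$ is $(u_0^{-c_1}u_1^{c_0})^{m}\,\mathcal L_N(u_0,u_1^{-1})^{\pm1}$ with $\pm1=*_b$; the indices $i,j,k,l$ are labels of $F_2,F_0,F_3,F_1$ respectively. **Local transits.** For an edge $e$ of a complex of decorated tetrahedra put $W(e)=\prod w(E)^{*}$, $L(e)=\sum *\,l(E)$, $C(e)=\sum c(E)$, the product and the sums being over the tetrahedron edges $E$ glued to $e$, where $*$ is the sign of the tetrahedron containing $E$. *$2\leftrightarrow3$:* on vertices $0<\dots<4$ let $\Delta^i$ be the tetrahedron omitting $i$. For a two-element set $P\subset\{0,\dots,4\}$ and $s=\pm1$, one side consists of the $\Delta^i$, $i\in P$, with signs $s(-1)^i$,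 the other of the $\Delta^i$, $i\notin P$, with signs $-s(-1)^i$. The decorations are required to give the same $W,L,C$ on both sides at each of the nine common edges. *Bubble:* two tetrahedra with the same ordered vertices and opposite signs are glued along the three faces containing a vertex $v_k$ (the new vertex), and replace the face $F_k$. At the three edges of $F_k$ their contribution to $W$ is $1$, to $L$ is $0$, and to $C$ is $2$ at one marked edge and $0$ at the two others. **Triangulations.** Let $\hat V$ be obtained from a compact connected oriented 3-manifold $V$ with possibly empty toric boundary by coning each boundary component. A weakly branched triangulation $(T,\tilde b)$ of $\hat V$ is a gluing of oriented branched tetrahedra, by orientation reversing pairings of faces, such that outgoing faces are paired with ingoing ones; $F_a$ is outgoing if $*_b(-1)^a=1$. Each pairing, from an outgoing face to an ingoing one, sends the $k$-th vertex to the $(k+r)$-th vertex (mod $3$), where $r\in\mathbb Z/3$ is its colour. A weakly branched QH triangulation is such a $(T,\tilde b)$ with a decoration of every tetrahedron such that, for every edge $e$ of $T$, $W(e)=1$, $L(e)=0$, and $C(e)=0$ if $e\in H$, $C(e)=2$ if $e\notin H$. Here $H$ is a set of edges forming a link through every vertex of $T$ that is a manifold point of $\hat V$ (once each) and through no other vertex;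 so $H=\emptyset$ if $T$ is ideal. Let $S_{ij}=N^{-1/2}\zeta^{ij}$, $T_{ij}=\zeta^{i^2(m+1)}\delta_N(i+j)$, $\mathcal Q_N=T^{-1}S$, $\epsilon_N=(-1)^m$, and let $\phi_N$ be the Jacobi symbol $\left(\frac{m+1}{N}\right)$ times $1$ if $N\equiv1$, times $i$ if $N\equiv3$ mod $4$. The state sum $\mathcal H_N(T,\tilde b,w,f,c)$ is $a_N(T,\tilde b)$ times the contraction of the network of all matrix dilogarithms and of the maps $\mathcal Q_N^{r}$ on the face pairings (from the outgoing to the ingoing face), where $$a_N(T,\tilde b)=N^{-v}\phi_N^{-q}\,\epsilon_N^{\,v+l-\frac12\sum_e(n_+(e)-n_-(e))},$$ $v$ is the number of vertices that are manifold points, $l$ the number of edges of $T$, $q$ the number of pairings of colour $2$, and $n_\pm(e)$ the number of diagonal edges glued to $e$ whose orientation by $\tilde b$ agrees/disagrees with an auxiliary orientation of $e$. **QH transits** are the following moves and their inverses. (1) Two distinct tetrahedra of $T$ with a common face are replaced by three, all five being, with their branchings, signs, decorations and interior gluings (of colour $0$), as in a local $2\leftrightarrow3$ transit, the conditions on $W,L,C$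 being imposed at the nine edges of the abstract polyhedron; the six boundary faces keep their order of vertices. (2) A common face of tetrahedra of $T$ is replaced by a local bubble, the ordering of the face being the one induced from one of its two sides, so that the colours of the two resulting pairings are $0$ and that of the original one. In both cases the branchings, signs and decorations of the other tetrahedra, and all other gluings, are unchanged. **Theorem.** (a) For every local $2\leftrightarrow3$ transit, the contractions over the interior faces of the matrix dilogarithms of the two sides, as tensors indexed by the labels of the six boundary faces, are equal up to $\equiv_N$. (b) For every local bubble transit, the contraction of the two matrix dilogarithms over the three common faces is $\equiv_N N\cdot\mathrm{Id}$, as a tensor in the labels of the two remaining faces. (c) For every QH transit $(T,\tilde b,w,f,c)\to(T',\tilde b',w',f',c')$ between weakly branched QH triangulations, $$\mathcal H_N(T,\tilde b,w,f,c)\equiv_N\mathcal H_N(T',\tilde b',w',f',c').$$ -/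

import Mathlib

open Complex

noncomputable section

namespace QH

/-! ### Matrix dilogarithms -/

/-- `ζ = exp(2πi/N)`. -/
def zeta (N : ℕ) : ℂ := exp (2 * Real.pi * I / N)

/-- `a ≡_N b`: equality up to multiplication by a power of `exp(2πi/N)`. -/
def EqMod (N : ℕ) (a b : ℂ) : Prop := ∃ n : ℕ, a = zeta N ^ n * b

/-- The residue `[n]_N ∈ {0, …, N-1}`. -/
def res (N : ℕ) (n : ℤ) : ℕ := (n % (N : ℤ)).toNat

/-- `δ_N(n)` is `1` if `N` divides `n`, and `0` otherwise. -/
def delta (N : ℕ) (n : ℤ) : ℂ := if (N : ℤ) ∣ n then 1 else 0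

/-- `g(x) = ∏_{j=1}^{N-1} (1 - x ζ^{-j})^{j/N}`, with the principal `N`-th root. -/
def g (N : ℕ) (x : ℂ) : ℂ :=
  ∏ j ∈ Finset.Icc 1 (N - 1), ((1 - x * (zeta N ^ j)⁻¹) ^ ((N : ℂ)⁻¹)) ^ j

/-- `h(x) = g(x) / g(1)`. -/
def h (N : ℕ) (x : ℂ) : ℂ := g N x / g N 1

/-- `ω(u,v|n) = ∏_{j=1}^{[n]_N} v (1 - u ζ^j)^{-1}`. -/
def omega (N : ℕ) (u v : ℂ) (n : ℤ) : ℂ :=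
  ∏ j ∈ Finset.Icc 1 (res N n), v * (1 - u * zeta N ^ j)⁻¹

/-- The basic matrix dilogarithm `L_N(u,v)^{i,j}_{k,l}`; rows are the upper indices `(i,j)` and
columns the lower indices `(k,l)`. -/
def basicL (N : ℕ) (u v : ℂ) : Matrix (Fin N × Fin N) (Fin N × Fin N) ℂ :=
  Matrix.of fun p q =>
    h N u * zeta N ^ ((q.1 : ℕ) * (p.2 : ℕ) + ((N - 1) / 2 + 1) * (q.1 : ℕ) ^ 2) *
      omega N u v ((p.1 : ℤ) - (q.1 : ℤ)) * delta N ((p.1 : ℤ) + (p.2 : ℤ) - (q.2 : ℤ))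

/-- The matrix dilogarithm `R_{(N,*,c)}(u₀,u₁)`. -/
def matrixDilog (N : ℕ) (s : ℤˣ) (c₀ c₁ : ℤ) (u₀ u₁ : ℂ) :
    Matrix (Fin N × Fin N) (Fin N × Fin N) ℂ :=
  (u₀ ^ (-c₁) * u₁ ^ c₀) ^ ((N - 1) / 2) •
    (if s = 1 then basicL N u₀ u₁⁻¹ else (basicL N u₀ u₁⁻¹)⁻¹)

/-! ### Quantum hyperbolic simplices

The vertices of a branched tetrahedron are numbered `0,1,2,3` by the branching, the face `a` is the
one opposite to the vertex `a`.  The sign `*_b : ℤˣ` compares the orientation given by the branching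
with the orientation of the tetrahedron. -/

/-- The index `k` of the edge `[v_a, v_b]`: the edges `[v₀,v₁], [v₂,v₃]` have index `0`, the edges
`[v₁,v₂], [v₀,v₃]` have index `1`, and the edges `[v₀,v₂], [v₁,v₃]` have index `2`.
(The entries for `a = b` play no role.) -/
def edgeIndex (a b : Fin 4) : Fin 3 :=
  (!![0, 0, 2, 1; 0, 0, 1, 2; 2, 1, 0, 0; 1, 2, 0, 0] : Matrix (Fin 4) (Fin 4) (Fin 3)) a b

/-- The decorations `(w,f,c)` of a quantum hyperbolic simplex: cross ratios, flattening, charge. -/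
structure Decoration where
  w : Fin 3 → ℂ
  f : Fin 3 → ℤ
  c : Fin 3 → ℤ
  w_ne_zero : ∀ k, w k ≠ 0
  w_ne_one : ∀ k, w k ≠ 1
  w_succ : ∀ k, w (k + 1) * (1 - w k) = 1
  flattening : ∑ k, (log (w k) + I * f k * Real.pi) = 0
  charge : ∑ k, c k = 1

/-- The classical log-branch `l_k = log w_k + i π f_k`. -/
def Decoration.l (D : Decoration) (k : Fin 3) : ℂ := log (D.w k) + I * D.f k * Real.pi

/-- The distinguished `N`-th root `w_k'` of `w_k`, the exponential of the quantum log-branch. -/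
def Decoration.root (D : Decoration) (N : ℕ) (s : ℤˣ) (k : Fin 3) : ℂ :=
  exp (1 / N * (log (D.w k) + I * Real.pi * (N + 1) * (D.f k - ((s : ℤ) : ℂ) * D.c k)))

/-- The entry of the tetrahedral tensor `R_N(Δ,b,w,f,c)` at the state giving the label `σ a` to the
face `a`.  The upper indices `(i,j)` of `L_N` belong to `V₂ ⊗ V₀`, the lower ones to `V₃ ⊗ V₁`;
for the sign `-1` source and target are exchanged. -/
def Decoration.tensor (D : Decoration) (N : ℕ) (s : ℤˣ) (σ : Fin 4 → Fin N) : ℂ :=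
  let R := matrixDilog N s (D.c 0) (D.c 1) (D.root N s 0) (D.root N s 1)
  if s = 1 then R (σ 2, σ 0) (σ 3, σ 1) else R (σ 3, σ 1) (σ 2, σ 0)

/-! ### The local transits

In a `2 ↔ 3` transit there are five vertices `0 < 1 < 2 < 3 < 4`, ordered by the branching, and
`Δ^i` is the tetrahedron on the vertices other than `i`, for `i : Fin 5`.  The two tetrahedra on
one side of the move are the `Δ^i` with `i ∈ P`, where `P` has two elements (`P` is also the set of
the two vertices which are opposite to the common face of these two tetrahedra), and the three
tetrahedra on the other side are the `Δ^i` with `i ∉ P`. -/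

/-- The position, in the increasing ordering of the vertices of `Δ^i`, of the vertex `a ≠ i`. -/
def pos (i a : Fin 5) : Fin 4 :=
  ⟨if a.val < i.val then a.val else a.val - 1, by split <;> omega⟩

/-- The branching signs of the five tetrahedra (depending on the orientation through `s`). -/
def localSign (P : Finset (Fin 5)) (s : ℤˣ) (i : Fin 5) : ℤˣ :=
  if i ∈ P then s * (-1) ^ (i : ℕ) else -(s * (-1) ^ (i : ℕ))

/-- Total cross ratio at the edge `[a,b]` of the tetrahedra `Δ^i`, `i ∈ A`. -/
def localW (D : Fin 5 → Decoration) (ε : Fin 5 → ℤˣ) (A : Finset (Fin 5)) (a b : Fin 5) : ℂ :=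
  ∏ i ∈ A \ {a, b}, (D i).w (edgeIndex (pos i a) (pos i b)) ^ ((ε i : ℤˣ) : ℤ)

/-- Total log-branch at the edge `[a,b]` of the tetrahedra `Δ^i`, `i ∈ A`. -/
def localL (D : Fin 5 → Decoration) (ε : Fin 5 → ℤˣ) (A : Finset (Fin 5)) (a b : Fin 5) : ℂ :=
  ∑ i ∈ A \ {a, b}, (((ε i : ℤˣ) : ℤ) : ℂ) * (D i).l (edgeIndex (pos i a) (pos i b))

/-- Total charge at the edge `[a,b]` of the tetrahedra `Δ^i`, `i ∈ A`. -/
def localC (D : Fin 5 → Decoration) (A : Finset (Fin 5)) (a b : Fin 5) : ℤ :=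
  ∑ i ∈ A \ {a, b}, (D i).c (edgeIndex (pos i a) (pos i b))

/-- The conditions on the decorations in a `2 ↔ 3` QH transit: at each of the nine edges common to
both sides the total cross ratios, log-branches and charges coincide. -/
def IsLocalMP (P : Finset (Fin 5)) (s : ℤˣ) (D : Fin 5 → Decoration) : Prop :=
  P.card = 2 ∧ ∀ a b : Fin 5, a ≠ b → ({a, b} : Finset (Fin 5)) ≠ P →
    localW D (localSign P s) P a b = localW D (localSign P s) Pᶜ a b ∧
    localL D (localSign P s) P a b = localL D (localSign P s) Pᶜ a b ∧
    localC D P a b = localC D Pᶜ a b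

/-- The contraction of the tensors of the `Δ^i`, `i ∈ A`, along the faces shared by two of them.
The triangle with vertices other than `i, j` is encoded by the unordered pair `s(i, j)`; it is a
face of `Δ^i` and of `Δ^j`.  The boundary labels are those of `τ`. -/
def localContraction (N : ℕ) (D : Fin 5 → Decoration) (ε : Fin 5 → ℤˣ) (A : Finset (Fin 5))
    (τ : Sym2 (Fin 5) → Fin N) : ℂ :=
  open scoped Classical in
  ∑ σ : Sym2 (Fin 5) → Fin N with ∀ z, (z.IsDiag ∨ ∃ i ∈ z, i ∉ A) → σ z = τ z,
    ∏ i ∈ A, (D i).tensor N (ε i) fun a => σ s(i, i.succAbove a)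

/-- The conditions on the decorations `D`, `D'` of the two tetrahedra (with signs `s`, `-s`) which
are created by a bubble move.  They have the same ordered vertices and share the three faces which
contain the new vertex.  At the three edges of the face which is blown up the total cross ratios
and log-branches do not change; the total charge changes by `2` at one of these edges (of index `e`;
it leaves the distinguished link, which is rerouted through the new vertex along the two other
edges of the triangle spanned by this edge and the new vertex), and does not change at
the two others. -/
def IsLocalBubble (s : ℤˣ) (e : Fin 3) (D D' : Decoration) : Prop :=
  ∀ k : Fin 3, D.w k ^ (s : ℤ) * D'.w k ^ ((-s : ℤˣ) : ℤ) = 1 ∧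
    ((s : ℤ) : ℂ) * D.l k + (((-s : ℤˣ) : ℤ) : ℂ) * D'.l k = 0 ∧
    D.c k + D'.c k = if k = e then 2 else 0

/-- The contraction of the tensors of the two tetrahedra of a bubble whose new vertex is the vertex
`k`, along the three faces containing it; the labels of the two remaining faces are `α`, `β`. -/
def bubbleContraction (N : ℕ) (s : ℤˣ) (k : Fin 4) (D D' : Decoration) (α β : Fin N) : ℂ :=
  ∑ σ : Fin 4 → Fin N with σ k = α,
    D.tensor N s σ * D'.tensor N (-s) (Function.update σ k β)

/-! ### Weakly branched triangulations -/

/-- A weakly branched triangulation with set of tetrahedra `ι`, as a gluing of branched tetrahedra.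
`(i, a) : ι × Fin 4` is the abstract face of the tetrahedron `i` opposite to its vertex `a`; its
vertices, ordered by the branching, are the vertices `a.succAbove 0, a.succAbove 1, a.succAbove 2`
of `i`.  The face `x` is glued to the face `glue x` by the map sending the `k`-th vertex of `x` to
the `(k + rot x)`-th vertex of `glue x`, where indices are modulo `3`.  The last axiom says that the
induced pre-branchings match, i.e. that outgoing faces are glued to ingoing ones; as the gluing maps
are even permutations, they reverse the boundary orientations. -/
structure WeaklyBranched (ι : Type) where
  sign : ι → ℤˣ
  glue : ι × Fin 4 → ι × Fin 4
  rot : ι × Fin 4 → Fin 3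
  glue_glue : ∀ x, glue (glue x) = x
  glue_ne : ∀ x, glue x ≠ x
  rot_glue : ∀ x, rot (glue x) = -rot x
  prebranching : ∀ x, sign (glue x).1 * (-1) ^ ((glue x).2 : ℕ) = -(sign x.1 * (-1) ^ (x.2 : ℕ))

/-- Abstract edges, with an orientation: `(i, a, b)` is the edge of `i` from vertex `a` to `b`. -/
abbrev OrAbsEdge (ι : Type) : Type := {E : ι × Fin 4 × Fin 4 // E.2.1 ≠ E.2.2}

/-- Abstract edges, always with the orientation given by the branching. -/
abbrev AbsEdge (ι : Type) : Type := {E : ι × Fin 4 × Fin 4 // E.2.1 < E.2.2}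

/-- The abstract edge with its branching orientation. -/
def AbsEdge.or {ι : Type} (E : AbsEdge ι) : OrAbsEdge ι := ⟨E.1, E.2.ne⟩

/-- The opposite orientation. -/
def OrAbsEdge.rev {ι : Type} (E : OrAbsEdge ι) : OrAbsEdge ι :=
  ⟨(E.1.1, E.1.2.2, E.1.2.1), E.2.symm⟩

namespace WeaklyBranched

variable {ι : Type} (T : WeaklyBranched ι)

/-- The co-orientation of the face `x` is outgoing. -/
def Outgoing (x : ι × Fin 4) : Prop := T.sign x.1 * (-1) ^ (x.2 : ℕ) = 1

instance (x : ι × Fin 4) : Decidable (T.Outgoing x) := by unfold Outgoing; infer_instance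

/-- The vertices `p`, `q` of the tetrahedra are identified by some face pairing. -/
def GluedVertex (p q : ι × Fin 4) : Prop :=
  ∃ x k, p = (x.1, x.2.succAbove k) ∧
    q = ((T.glue x).1, (T.glue x).2.succAbove (k + T.rot x))

/-- The oriented abstract edges `E`, `E'` are identified by some face pairing. -/
def GluedEdge (E E' : OrAbsEdge ι) : Prop :=
  ∃ x k k', E.1 = (x.1, x.2.succAbove k, x.2.succAbove k') ∧
    E'.1 = ((T.glue x).1, (T.glue x).2.succAbove (k + T.rot x),
      (T.glue x).2.succAbove (k' + T.rot x))

/-- The vertices of the triangulation. -/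
def Vertex : Type := Quot T.GluedVertex

/-- The edges of the triangulation with an orientation. -/
def OrEdge : Type := Quot T.GluedEdge

/-- The edges of the triangulation. -/
def Edge : Type := Quot fun E E' => T.GluedEdge E E' ∨ E' = E.rev

def vertexOf (p : ι × Fin 4) : T.Vertex := Quot.mk _ p

def orEdgeOf (E : OrAbsEdge ι) : T.OrEdge := Quot.mk _ E

def edgeOf (E : OrAbsEdge ι) : T.Edge := Quot.mk _ E

/-- The oriented edges starting at `v`, i.e. the vertices of the link of `v`. -/
def star (v : T.Vertex) : Set T.OrEdge :=
  {o | ∃ E : OrAbsEdge ι, T.orEdgeOf E = o ∧ T.vertexOf (E.1.1, E.1.2.1) = v}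

/-- The number of triangles of the link of `v`. -/
def linkTriangles (v : T.Vertex) : ℕ := {p | T.vertexOf p = v}.ncard

/-- The Euler characteristic of the link of `v`, a closed connected triangulated surface; if it has
`F` triangles, then it has `3F/2` edges. -/
def linkEuler (v : T.Vertex) : ℚ :=
  (T.star v).ncard - 3 / 2 * T.linkTriangles v + T.linkTriangles v

/-- `v` is a manifold point: its link is a sphere. -/
def IsManifoldVertex (v : T.Vertex) : Prop := T.linkEuler v = 2

/-- The gluing is a triangulation of `V̂`, the space obtained from a compact connected oriented
3-manifold `V` with (possibly empty) boundary made of tori by coning each boundary component: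
it is connected, no edge is identified with itself with the opposite orientation, and
the links of the vertices, which are closed connected oriented surfaces, are spheres or tori. -/
structure IsTriangulation : Prop where
  nonempty : Nonempty ι
  connected : ∀ i j : ι, Relation.ReflTransGen (fun i j => ∃ a, (T.glue (i, a)).1 = j) i j
  orEdge_rev : ∀ E : OrAbsEdge ι, T.orEdgeOf E.rev ≠ T.orEdgeOf E
  link : ∀ v, T.linkEuler v = 2 ∨ T.linkEuler v = 0

/-- A set of edges realizes a link which passes exactly once through every manifold vertex, and
through no other vertex.  If there is no manifold vertex, i.e. for ideal triangulations, it is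
empty. -/
def IsHamiltonian (H : Set T.Edge) : Prop :=
  ∀ v, (T.IsManifoldVertex v →
      {o | ∃ E : OrAbsEdge ι, T.orEdgeOf E = o ∧ T.vertexOf (E.1.1, E.1.2.1) = v ∧
        T.edgeOf E ∈ H}.ncard = 2) ∧
    (¬ T.IsManifoldVertex v →
      ∀ E : OrAbsEdge ι, T.vertexOf (E.1.1, E.1.2.1) = v → T.edgeOf E ∉ H)

/-- The number `v` of vertices which are manifold points. -/
def numVertices : ℕ := {v | T.IsManifoldVertex v}.ncard

/-- The number `l` of edges. -/
def numEdges : ℕ := Nat.card T.Edge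

variable [Fintype ι]

/-- The number `q` of face pairings of colour `2`. -/
def q : ℕ := (Finset.univ.filter fun x : ι × Fin 4 => T.Outgoing x ∧ T.rot x = 2).card

open scoped Classical in
/-- `∑_e (n₊(e) - n₋(e))`.  Each edge `e` gets the auxiliary orientation of a representative; a
diagonal abstract edge (one of index `2`) over `e` counts `1` or `-1` according as its branching
orientation agrees or not with the orientation of `e`. -/
def diagonalSum : ℤ :=
  ∑ E : AbsEdge ι, if edgeIndex E.1.2.1 E.1.2.2 = 2 then
    (if T.orEdgeOf E.or = T.orEdgeOf (Quot.out (T.edgeOf E.or)) then 1 else -1) else 0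

end WeaklyBranched

/-! ### Rough QH triangulations and their state sums -/

/-- A rough QH triangulation `(T,b̃,w,f,c)`. -/
structure RoughQH (ι : Type) extends WeaklyBranched ι where
  dec : ι → Decoration

/-- `φ_N`. -/
def phi (N : ℕ) : ℂ := (jacobiSym (((N - 1) / 2 + 1 : ℕ) : ℤ) N : ℂ) * if N % 4 = 1 then 1 else I

/-- `ε_N = (-1)^{(N-1)/2}`. -/
def eps (N : ℕ) : ℂ := (-1) ^ ((N - 1) / 2)

def matS (N : ℕ) : Matrix (Fin N) (Fin N) ℂ :=
  Matrix.of fun i j => ((Real.sqrt N : ℝ) : ℂ)⁻¹ * zeta N ^ ((i : ℕ) * (j : ℕ))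

def matT (N : ℕ) : Matrix (Fin N) (Fin N) ℂ :=
  Matrix.of fun i j => zeta N ^ ((i : ℕ) ^ 2 * ((N - 1) / 2 + 1)) * delta N ((i : ℤ) + (j : ℤ))

/-- The face tensor `Q_N = T⁻¹ S`. -/
def matQ (N : ℕ) : Matrix (Fin N) (Fin N) ℂ := (matT N)⁻¹ * matS N

namespace RoughQH

variable {ι : Type} [Fintype ι] (T : RoughQH ι)

/-- The normalization factor `a_N(T,b̃) = N^{-v} φ_N^{-q} ε_N^{v + l - ½ ∑ (n₊ - n₋)}`. -/
def a (N : ℕ) : ℂ :=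
  (N : ℂ) ^ (-(T.numVertices : ℤ)) * phi N ^ (-(T.q : ℤ)) *
    eps N ^ ((T.numVertices : ℤ) + T.numEdges - T.diagonalSum / 2)

/-- The state sum `H_N(T,b̃,w,f,c)`.  A state labels every abstract face; the tensor on a face
pairing is the linear map `Q_N^r` from its initial (outgoing) face to its final (ingoing) face,
where `r` is its colour. -/
def stateSum [DecidableEq ι] (N : ℕ) : ℂ :=
  T.a N * ∑ σ : ι × Fin 4 → Fin N,
    (∏ i, (T.dec i).tensor N (T.sign i) fun a => σ (i, a)) *
      ∏ x : ι × Fin 4 with T.Outgoing x, (matQ N ^ (T.rot x : ℕ)) (σ (T.glue x)) (σ x)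

open scoped Classical in
/-- The total cross ratio `W(e)`. -/
def W (e : T.Edge) : ℂ :=
  ∏ E : AbsEdge ι with T.edgeOf E.or = e,
    (T.dec E.1.1).w (edgeIndex E.1.2.1 E.1.2.2) ^ ((T.sign E.1.1 : ℤˣ) : ℤ)

open scoped Classical in
/-- The total log-branch `L(e)`. -/
def L (e : T.Edge) : ℂ :=
  ∑ E : AbsEdge ι with T.edgeOf E.or = e,
    (((T.sign E.1.1 : ℤˣ) : ℤ) : ℂ) * (T.dec E.1.1).l (edgeIndex E.1.2.1 E.1.2.2)

open scoped Classical in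
/-- The total charge `C(e)`. -/
def C (e : T.Edge) : ℤ :=
  ∑ E : AbsEdge ι with T.edgeOf E.or = e, (T.dec E.1.1).c (edgeIndex E.1.2.1 E.1.2.2)

/-- A weakly branched QH triangulation: a triangulation of some `V̂`, such that `[w;f]` satisfies
`W(e) = 1` and `L(e) = 0` at all edges, and `c` is a global charge, with `C(e) = 0` at the
edges of a link `H` as above and `C(e) = 2` at all other edges. -/
structure IsQHTriangulation : Prop where
  triangulation : T.IsTriangulation
  W_eq : ∀ e, T.W e = 1
  L_eq : ∀ e, T.L e = 0
  charge : ∃ H : Set T.Edge, T.IsHamiltonian H ∧ (∀ e ∈ H, T.C e = 0) ∧ ∀ e ∉ H, T.C e = 2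

end RoughQH

/-! ### QH transits -/

/-- The correspondence of the common abstract faces in a `2 → 3` move: the faces of the
tetrahedra `κ` not involved in the move, and the six boundary faces of the polyhedron. -/
inductive MPFace {ι ι' κ : Type} {P : Finset (Fin 5)} (φ : κ ⊕ {i // i ∈ P} ≃ ι)
    (φ' : κ ⊕ {i // i ∉ P} ≃ ι') : ι × Fin 4 → ι' × Fin 4 → Prop
  | common (k : κ) (a : Fin 4) : MPFace φ φ' (φ (.inl k), a) (φ' (.inl k), a)
  | boundary (i : {i // i ∈ P}) (j : {i // i ∉ P}) :
      MPFace φ φ' (φ (.inr i), pos i j) (φ' (.inr j), pos j i)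

/-- `T → T'` is a `2 → 3` QH transit.  The tetrahedra of `T` (resp. `T'`) are the common ones,
indexed by `κ`, and two (resp. three) tetrahedra `Δ^i`, as above; on these the weak branchings
look like a branching transit. -/
structure IsMPTransit {ι ι' κ : Type} (T : RoughQH ι) (T' : RoughQH ι') (P : Finset (Fin 5))
    (s : ℤˣ) (φ : κ ⊕ {i // i ∈ P} ≃ ι) (φ' : κ ⊕ {i // i ∉ P} ≃ ι') : Prop where
  sign_common : ∀ k, T'.sign (φ' (.inl k)) = T.sign (φ (.inl k))
  dec_common : ∀ k, T'.dec (φ' (.inl k)) = T.dec (φ (.inl k))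
  sign_left : ∀ i, T.sign (φ (.inr i)) = localSign P s i
  sign_right : ∀ i, T'.sign (φ' (.inr i)) = localSign P s i
  inner_left : ∀ i j : {i // i ∈ P}, i ≠ j →
    T.glue (φ (.inr i), pos i j) = (φ (.inr j), pos j i) ∧ T.rot (φ (.inr i), pos i j) = 0
  inner_right : ∀ i j : {i // i ∉ P}, i ≠ j →
    T'.glue (φ' (.inr i), pos i j) = (φ' (.inr j), pos j i) ∧ T'.rot (φ' (.inr i), pos i j) = 0
  outer : ∀ x x', MPFace φ φ' x x' →
    MPFace φ φ' (T.glue x) (T'.glue x') ∧ T'.rot x' = T.rot x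
  dec_local : IsLocalMP P s fun i =>
    if hi : i ∈ P then T.dec (φ (.inr ⟨i, hi⟩)) else T'.dec (φ' (.inr ⟨i, hi⟩))

/-- `T → T'` is a positive bubble QH transit at the face pairing of `x` and `T.glue x`.  Two new
tetrahedra `A = φ (inr false)` and `B = φ (inr true)` are inserted; they are glued to each other
along their faces containing the new vertex `k`, and their remaining faces are glued to `x` and
`T.glue x`.  The branching of the blown up face is the one given by `x` (which is any of
the two sides of the face). -/
structure IsBubbleTransit {ι ι' : Type} (T : RoughQH ι) (T' : RoughQH ι') (x : ι × Fin 4)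
    (k : Fin 4) (e : Fin 3) (φ : ι ⊕ Bool ≃ ι') : Prop where
  sign_common : ∀ i, T'.sign (φ (.inl i)) = T.sign i
  dec_common : ∀ i, T'.dec (φ (.inl i)) = T.dec i
  sign_new : T'.sign (φ (.inr true)) = -T'.sign (φ (.inr false))
  inner : ∀ a, a ≠ k → T'.glue (φ (.inr false), a) = (φ (.inr true), a) ∧
    T'.rot (φ (.inr false), a) = 0
  outer_A : T'.glue (φ (.inl x.1), x.2) = (φ (.inr false), k) ∧
    T'.rot (φ (.inl x.1), x.2) = 0
  outer_B : T'.glue (φ (.inr true), k) = (φ (.inl (T.glue x).1), (T.glue x).2) ∧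
    T'.rot (φ (.inr true), k) = T.rot x
  outer : ∀ y, y ≠ x → y ≠ T.glue x →
    T'.glue (φ (.inl y.1), y.2) = (φ (.inl (T.glue y).1), (T.glue y).2) ∧
      T'.rot (φ (.inl y.1), y.2) = T.rot y
  dec_local : IsLocalBubble (T'.sign (φ (.inr false))) e
    (T'.dec (φ (.inr false))) (T'.dec (φ (.inr true)))

/-- Positive QH transits: `2 → 3` and positive bubble transits. -/
def IsPositiveTransit {ι ι' : Type} (T : RoughQH ι) (T' : RoughQH ι') : Prop :=
  (∃ (κ : Type) (P : Finset (Fin 5)) (s : ℤˣ) (φ : κ ⊕ {i // i ∈ P} ≃ ι)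
    (φ' : κ ⊕ {i // i ∉ P} ≃ ι'), IsMPTransit T T' P s φ φ') ∨
  ∃ (x : ι × Fin 4) (k : Fin 4) (e : Fin 3) (φ : ι ⊕ Bool ≃ ι'), IsBubbleTransit T T' x k e φ

/-- QH transits, positive or negative. -/
def IsQHTransit {ι ι' : Type} (T : RoughQH ι) (T' : RoughQH ι') : Prop :=
  IsPositiveTransit T T' ∨ IsPositiveTransit T' T

end QH

end

noncomputable section

namespace QH

/-! ### Roots of unity -/

/-- The additive character `n ↦ ζ^n` of `ℤ/N`. -/
abbrev ch (N : ℕ) [NeZero N] : AddChar (ZMod N) ℂ := ZMod.stdAddChar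

section Cyclic

variable {N : ℕ} [NeZero N]

theorem zeta_pow (n : ℕ) : zeta N ^ n = ch N n := by
  have h := ZMod.stdAddChar_coe (N := N) (n : ℤ)
  rw [Int.cast_natCast] at h
  rw [ch, h, zeta, ← Complex.exp_nat_mul]
  congr 1
  push_cast
  ring

theorem isPrimitiveRoot_zeta : IsPrimitiveRoot (zeta N) N :=
  Complex.isPrimitiveRoot_exp N (NeZero.ne N)

theorem ch_ne_zero (a : ZMod N) : ch N a ≠ 0 := by
  intro h
  have := AddChar.map_add_eq_mul (ch N) a (-a)
  rw [add_neg_cancel, AddChar.map_zero_eq_one, h, zero_mul] at this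
  exact one_ne_zero this

theorem ch_natCast_mul (n : ℕ) (a : ZMod N) : ch N (n * a) = ch N a ^ n := by
  rw [← nsmul_eq_mul, AddChar.map_nsmul_eq_pow]

theorem ch_pow_card (a : ZMod N) : ch N a ^ N = 1 := by
  rw [← ch_natCast_mul, ZMod.natCast_self, zero_mul, AddChar.map_zero_eq_one]

theorem ch_neg (a : ZMod N) : ch N (-a) = (ch N a)⁻¹ := AddChar.map_neg_eq_inv _ _

theorem sum_ch_mul (b : ZMod N) : ∑ x : ZMod N, ch N (x * b) = if b = 0 then (N : ℂ) else 0 := by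
  rw [AddChar.sum_mulShift b (ZMod.isPrimitive_stdAddChar N), ZMod.card]
  push_cast
  rfl

@[to_additive]
theorem prod_zmod {M : Type*} [CommMonoid M] (f : ZMod N → M) :
    ∏ x, f x = ∏ k ∈ Finset.range N, f (k : ZMod N) := by
  refine Finset.prod_bij' (fun x _ => x.val) (fun k _ => (k : ZMod N)) ?_ ?_ ?_ ?_ ?_
  · intro x _; exact Finset.mem_range.2 x.val_lt
  · intro k _; exact Finset.mem_univ _
  · intro x _; exact ZMod.natCast_zmod_val x
  · intro k hk; exact ZMod.val_cast_of_lt (Finset.mem_range.1 hk)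
  · intro x _; rw [ZMod.natCast_zmod_val]

@[to_additive]
theorem prod_fin {M : Type*} [CommMonoid M] (f : ZMod N → M) :
    ∏ x : Fin N, f ((x : ℕ) : ZMod N) = ∏ x, f x := by
  rw [prod_zmod, Fin.prod_univ_eq_prod_range fun k : ℕ => f (k : ZMod N)]

theorem prod_one_sub (u : ℂ) : ∏ x : ZMod N, (1 - u * ch N x) = 1 - u ^ N := by
  have h1 : (1 : ℂ) ^ N - u ^ N = ∏ z ∈ Polynomial.nthRootsFinset N (1 : ℂ), (1 - z * u) :=
    isPrimitiveRoot_zeta.pow_sub_pow_eq_prod_sub_mul 1 u (NeZero.pos N)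
  have h2 : Polynomial.nthRootsFinset N (1 : ℂ) = Finset.univ.image (ch N) := by
    symm
    apply Finset.eq_of_subset_of_card_le
    · intro z hz
      obtain ⟨x, -, rfl⟩ := Finset.mem_image.1 hz
      rw [Polynomial.mem_nthRootsFinset (NeZero.pos N)]
      exact ch_pow_card x
    · rw [(isPrimitiveRoot_zeta (N := N)).card_nthRootsFinset,
        Finset.card_image_of_injective _ ZMod.injective_stdAddChar, Finset.card_univ, ZMod.card]
  rw [one_pow, h2, Finset.prod_image (fun x _ y _ h => ZMod.injective_stdAddChar h)] at h1
  rw [h1]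
  exact Finset.prod_congr rfl fun x _ => by rw [mul_comm]

theorem exists_zeta_pow_of_pow_eq {a b : ℂ} (hb : b ≠ 0) (h : a ^ N = b ^ N) :
    ∃ n : ℕ, a = zeta N ^ n * b := by
  have h1 : (a / b) ^ N = 1 := by rw [div_pow, h, div_self (pow_ne_zero _ hb)]
  obtain ⟨i, -, hi⟩ := (isPrimitiveRoot_zeta (N := N)).eq_pow_of_pow_eq_one h1
  exact ⟨i, by rw [hi, div_mul_cancel₀ _ hb]⟩

/-! ### The cyclic function `ω(u,v|n)` -/

/-- `ω(u,v|n)` as a function on `ℤ/N`. -/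
def cyc (N : ℕ) [NeZero N] (u v : ℂ) (n : ZMod N) : ℂ :=
  ∏ j ∈ Finset.Icc 1 n.val, v * (1 - u * ch N (j : ZMod N))⁻¹

theorem omega_eq_cyc (u v : ℂ) (n : ℤ) : omega N u v n = cyc N u v (n : ZMod N) := by
  have h : res N n = (n : ZMod N).val := by
    zify
    rw [ZMod.val_intCast, res, Int.toNat_of_nonneg]
    exact Int.emod_nonneg _ (by exact_mod_cast NeZero.ne N)
  rw [omega, cyc, h]
  exact Finset.prod_congr rfl fun j _ => by rw [zeta_pow]

/-- `(u,v)` is a point with `v ≠ 0` of the Fermat curve. -/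
structure Fermat (N : ℕ) (u v : ℂ) : Prop where
  eq : u ^ N + v ^ N = 1
  ne : v ≠ 0

variable {u v : ℂ}

theorem Fermat.one_sub_ne (H : Fermat N u v) (n : ZMod N) : 1 - u * ch N n ≠ 0 := by
  intro h
  have h1 : (u * ch N n) ^ N = 1 := by rw [← sub_eq_zero.1 h, one_pow]
  rw [mul_pow, ch_pow_card, mul_one] at h1
  have h2 := H.eq
  rw [h1] at h2
  exact pow_ne_zero N H.ne (by linear_combination h2)

theorem cyc_zero : cyc N u v 0 = 1 := by simp [cyc]

theorem cyc_natCast {n : ℕ} (hn : n < N) :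
    cyc N u v n = ∏ j ∈ Finset.Icc 1 n, v * (1 - u * ch N (j : ZMod N))⁻¹ := by
  rw [cyc, ZMod.val_cast_of_lt hn]

theorem Fermat.cyc_ne_zero (H : Fermat N u v) (n : ZMod N) : cyc N u v n ≠ 0 :=
  Finset.prod_ne_zero_iff.2 fun _ _ => mul_ne_zero H.ne (inv_ne_zero (H.one_sub_ne _))

theorem Fermat.cyc_mul (H : Fermat N u v) (n : ZMod N) :
    cyc N u v n * (1 - u * ch N n) = v * cyc N u v (n - 1) := by
  obtain ⟨k, hk, rfl⟩ : ∃ k : ℕ, k < N ∧ n = k := ⟨n.val, n.val_lt, (ZMod.natCast_zmod_val n).symm⟩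
  obtain _ | k := k
  · obtain ⟨M, rfl⟩ : ∃ M, N = M + 1 := ⟨N - 1, by have := NeZero.pos N; omega⟩
    have h1 : ((0 : ℕ) : ZMod (M + 1)) - 1 = (M : ℕ) := by
      have := ZMod.natCast_self (M + 1)
      push_cast at this ⊢
      linear_combination -this
    rw [h1, cyc_natCast (Nat.lt_succ_self M), Nat.cast_zero, cyc_zero, AddChar.map_zero_eq_one]
    have h2 := prod_one_sub (N := M + 1) u
    rw [prod_zmod, Finset.prod_range_succ', Nat.cast_zero, AddChar.map_zero_eq_one] at h2
    have h3 : ∏ j ∈ Finset.Icc 1 M, v * (1 - u * ch (M + 1) (j : ZMod (M + 1)))⁻¹ =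
        v ^ M * (∏ k ∈ Finset.range M, (1 - u * ch (M + 1) ((k + 1 : ℕ) : ZMod (M + 1))))⁻¹ := by
      rw [Finset.prod_mul_distrib, Finset.prod_const, Nat.card_Icc, Finset.prod_inv_distrib,
        Nat.add_sub_cancel]
      congr 2
      have : Finset.Icc 1 M = Finset.Ico 1 (M + 1) := by ext; simp
      rw [this, Finset.prod_Ico_eq_prod_range]
      simp only [Nat.add_sub_cancel, add_comm 1]
    have h4 : ∏ k ∈ Finset.range M, (1 - u * ch (M + 1) ((k + 1 : ℕ) : ZMod (M + 1))) ≠ 0 :=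
      Finset.prod_ne_zero_iff.2 fun _ _ => H.one_sub_ne _
    rw [h3]
    field_simp
    have := H.eq
    linear_combination h2 - this
  · have h1 : ((k + 1 : ℕ) : ZMod N) - 1 = (k : ℕ) := by push_cast; ring
    rw [h1, cyc_natCast hk, cyc_natCast (by omega), Finset.prod_Icc_succ_top (by omega)]
    have := H.one_sub_ne ((k + 1 : ℕ) : ZMod N)
    field_simp

theorem g_pow (x : ℂ) : g N x ^ N = ∏ j ∈ Finset.Icc 1 (N - 1), (1 - x * ch N (-(j : ZMod N))) ^ j := by
  rw [g, ← Finset.prod_pow]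
  refine Finset.prod_congr rfl fun j _ => ?_
  rw [← pow_mul, mul_comm j, pow_mul, cpow_nat_inv_pow _ (NeZero.ne N), zeta_pow, ch_neg]

theorem prod_range_Icc {M : Type*} [CommMonoid M] (f : ℕ → M) (n : ℕ) :
    ∏ k ∈ Finset.range n, ∏ j ∈ Finset.Icc 1 k, f j = ∏ j ∈ Finset.Icc 1 (n - 1), f j ^ (n - j) := by
  induction n with
  | zero => simp
  | succ n ih =>
    rw [Finset.prod_range_succ, ih]
    obtain _ | n := n
    · simp
    · simp only [Nat.add_sub_cancel]
      rw [Finset.prod_Icc_succ_top (by omega), Finset.prod_Icc_succ_top (by omega), ← mul_assoc,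
        ← Finset.prod_mul_distrib]
      congr 1
      · refine Finset.prod_congr rfl fun j hj => ?_
        rw [← pow_succ]
        congr 1
        have := (Finset.mem_Icc.1 hj).2
        omega
      · simp

theorem prod_Icc_reflect {M : Type*} [CommMonoid M] (f : ℕ → M) (n : ℕ) :
    ∏ j ∈ Finset.Icc 1 (n - 1), f (n - j) = ∏ j ∈ Finset.Icc 1 (n - 1), f j := by
  refine Finset.prod_nbij' (fun j => n - j) (fun j => n - j) ?_ ?_ ?_ ?_ ?_
  all_goals intro j hj
  all_goals simp only [Finset.mem_Icc] at hj ⊢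
  all_goals try omega

theorem sum_Icc_reflect (n : ℕ) : ∑ j ∈ Finset.Icc 1 (n - 1), (n - j) = n * (n - 1) / 2 := by
  have h : ∀ n : ℕ, (∑ j ∈ Finset.Icc 1 (n - 1), j) * 2 = n * (n - 1) := by
    intro n
    induction n with
    | zero => simp
    | succ n ih =>
      obtain _ | n := n
      · simp
      · simp only [Nat.add_sub_cancel] at ih ⊢
        rw [Finset.sum_Icc_succ_top (by omega), add_mul, ih]
        ring
  have h2 : ∑ j ∈ Finset.Icc 1 (n - 1), (n - j) = ∑ j ∈ Finset.Icc 1 (n - 1), j := by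
    refine Finset.sum_nbij' (fun j => n - j) (fun j => n - j) ?_ ?_ ?_ ?_ ?_
    all_goals intro j hj
    all_goals simp only [Finset.mem_Icc] at hj ⊢
    all_goals try omega
  rw [h2, ← h n]
  omega

/-- `∏_n ω(u,v|n) = v^{N(N-1)/2} g(u)^{-N}`. -/
theorem Fermat.prod_cyc (H : Fermat N u v) :
    (∏ n : ZMod N, cyc N u v n) * g N u ^ N = v ^ (N * (N - 1) / 2) := by
  have h1 : ∏ n : ZMod N, cyc N u v n =
      ∏ k ∈ Finset.range N, ∏ j ∈ Finset.Icc 1 k, v * (1 - u * ch N (j : ZMod N))⁻¹ := by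
    rw [prod_zmod]
    exact Finset.prod_congr rfl fun k hk => cyc_natCast (Finset.mem_range.1 hk)
  rw [h1, prod_range_Icc, g_pow, ← prod_Icc_reflect (fun j => (1 - u * ch N (-(j : ZMod N))) ^ j),
    ← Finset.prod_mul_distrib, ← sum_Icc_reflect, ← Finset.prod_pow_eq_pow_sum]
  refine Finset.prod_congr rfl fun j hj => ?_
  have h2 : -((N - j : ℕ) : ZMod N) = j := by
    rw [Nat.cast_sub (by have := (Finset.mem_Icc.1 hj).2; omega)]
    simp
  rw [h2, ← mul_pow, mul_assoc, inv_mul_cancel₀ (H.one_sub_ne _), mul_one]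

end Cyclic

section Pentagon

variable {N : ℕ} [NeZero N] {u v : ℂ}

theorem Fermat.shift (H : Fermat N u v) : Fermat N (u * ch N 1) v :=
  ⟨by rw [mul_pow, ch_pow_card, mul_one]; exact H.eq, H.ne⟩

theorem Fermat.prod_cyc_ne_zero (H : Fermat N u v) : ∏ n : ZMod N, cyc N u v n ≠ 0 :=
  Finset.prod_ne_zero_iff.2 fun n _ => H.cyc_ne_zero n

theorem Fermat.g_ne_zero (H : Fermat N u v) : g N u ≠ 0 := by
  intro h
  have := H.prod_cyc
  rw [h, zero_pow (NeZero.ne N), mul_zero] at this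
  exact pow_ne_zero _ H.ne this.symm

theorem g_one_pow_ne_zero : g N 1 ^ N ≠ 0 := by
  rw [g_pow, Finset.prod_ne_zero_iff]
  intro j hj
  apply pow_ne_zero
  rw [one_mul, sub_ne_zero]
  intro h
  rw [← AddChar.map_zero_eq_one (ch N)] at h
  have h2 := ZMod.injective_stdAddChar h
  rw [eq_comm, neg_eq_zero, ZMod.natCast_eq_zero_iff] at h2
  have h3 := Finset.mem_Icc.1 hj
  have := Nat.le_of_dvd (by omega) h2
  omega

theorem Fermat.h_ne_zero (H : Fermat N u v) : h N u ≠ 0 :=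
  div_ne_zero H.g_ne_zero fun h => g_one_pow_ne_zero (N := N) (by rw [h, zero_pow (NeZero.ne N)])

/-- Uniqueness of the solution of the first order recursion for `ω`. -/
theorem Fermat.eq_cyc (H : Fermat N u v) {f : ZMod N → ℂ}
    (hf : ∀ n, f (n + 1) * (1 - u * ch N (n + 1)) = v * f n) (n : ZMod N) :
    f n = f 0 * cyc N u v n := by
  obtain ⟨k, rfl⟩ : ∃ k : ℕ, n = k := ⟨n.val, (ZMod.natCast_zmod_val n).symm⟩
  induction k with
  | zero => simp [cyc_zero]
  | succ k ih =>
    have h1 := hf k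
    have h2 := H.cyc_mul (k + 1)
    rw [add_sub_cancel_right] at h2
    push_cast
    apply mul_right_cancel₀ (H.one_sub_ne ((k : ZMod N) + 1))
    rw [h1, mul_assoc, h2, ih]
    ring

theorem Fermat.cyc_shift (H : Fermat N u v) (n : ZMod N) :
    cyc N u v (n + 1) = cyc N u v 1 * cyc N (u * ch N 1) v n := by
  have := H.shift.eq_cyc (f := fun n => cyc N u v (n + 1)) (fun n => by
    have := H.cyc_mul (n + 1 + 1)
    rw [add_sub_cancel_right] at this
    rw [← this, AddChar.map_add_eq_mul (ch N) (n + 1) 1]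
    ring) n
  simpa using this

theorem Fermat.cyc_twist (H : Fermat N u v) (n : ZMod N) :
    cyc N u (v * ch N (-1)) n = ch N (-n) * cyc N u v n := by
  have H' : Fermat N u (v * ch N (-1)) :=
    ⟨by rw [mul_pow, ch_pow_card, mul_one]; exact H.eq, mul_ne_zero H.ne (ch_ne_zero _)⟩
  have := H'.eq_cyc (f := fun n => ch N (-n) * cyc N u v n) (fun n => by
    have := H.cyc_mul (n + 1)
    rw [add_sub_cancel_right] at this
    rw [mul_assoc, this, show -(n + 1) = -n + -1 by ring, AddChar.map_add_eq_mul]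
    ring) n
  simpa [cyc_zero] using this.symm

theorem Fermat.g_shift_pow (H : Fermat N u v) :
    g N (u * ch N 1) ^ N = (g N u * cyc N u v 1) ^ N := by
  have h1 := H.prod_cyc
  have h2 := H.shift.prod_cyc
  have h3 : ∏ n : ZMod N, cyc N u v n =
      cyc N u v 1 ^ N * ∏ n : ZMod N, cyc N (u * ch N 1) v n := by
    rw [← Equiv.prod_comp (Equiv.addRight (1 : ZMod N))]
    simp only [Equiv.coe_addRight]
    rw [Finset.prod_congr rfl fun n _ => H.cyc_shift n, Finset.prod_mul_distrib, Finset.prod_const,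
      Finset.card_univ, ZMod.card]
  apply mul_left_cancel₀ H.shift.prod_cyc_ne_zero
  rw [h2, ← h1, h3]
  ring

/-! ### The five term relation -/

variable {u₀ v₀ u₁ v₁ u₂ v₂ u₃ v₃ u₄ v₄ : ℂ}

/-- The summation over the interior labels in the basic five term relation. -/
def fiveSum (N : ℕ) [NeZero N] (u₀ v₀ u₂ v₂ u₄ v₄ : ℂ) (x y : ZMod N) : ℂ :=
  ∑ s : ZMod N, cyc N u₀ v₀ (x - s) * cyc N u₂ v₂ s * cyc N u₄ v₄ (y - s) * ch N ((x - s) * (y - s))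

theorem fiveSum_symm (x y : ZMod N) :
    fiveSum N u₀ v₀ u₂ v₂ u₄ v₄ x y = fiveSum N u₄ v₄ u₂ v₂ u₀ v₀ y x :=
  Finset.sum_congr rfl fun s _ => by rw [mul_comm (x - s)]; ring

theorem fiveSum_succ (H₀ : Fermat N u₀ v₀) (H₂ : Fermat N u₂ v₂) (H₄ : Fermat N u₄ v₄)
    (h01 : v₀ = v₁ * u₄) (h43 : v₄ = v₃ * u₀) (h2 : v₂ = v₁ * v₃) (h1 : u₁ = u₀ * u₂)
    (x y : ZMod N) :
    fiveSum N u₀ v₀ u₂ v₂ u₄ v₄ (x + 1) y * (1 - u₁ * ch N (x + 1)) =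
      v₁ * fiveSum N u₀ v₀ u₂ v₂ u₄ v₄ x y := by
  let F : ZMod N → ℂ := fun s => cyc N u₀ v₀ (x + 1 - s) * cyc N u₂ v₂ (s - 1) *
    cyc N u₄ v₄ (y - s) * ch N ((x + 1 - s) * (y + 1 - s))
  have hF : ∑ s, F (s + 1) = ∑ s, F s := Equiv.sum_comp (Equiv.addRight (1 : ZMod N)) F
  have key : ∀ s : ZMod N,
      cyc N u₀ v₀ (x + 1 - s) * cyc N u₂ v₂ s * cyc N u₄ v₄ (y - s) * ch N ((x + 1 - s) * (y - s)) *
        (1 - u₁ * ch N (x + 1)) -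
      v₁ * (cyc N u₀ v₀ (x - s) * cyc N u₂ v₂ s * cyc N u₄ v₄ (y - s) * ch N ((x - s) * (y - s))) =
      -(v₁ * v₄) * (F (s + 1) - F s) := by
    intro s
    have hA := H₀.cyc_mul (x + 1 - s)
    have hB := H₂.cyc_mul s
    have hC := H₄.cyc_mul (y - s)
    have e1 : x + 1 - s - 1 = x - s := by ring
    have e2 : ch N (x + 1 - s) = ch N 1 * ch N (x - s) := by
      rw [← AddChar.map_add_eq_mul]; congr 1; ring
    have e3 : ch N ((x + 1 - s) * (y - s)) = ch N ((x - s) * (y - s)) * ch N (y - s) := by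
      rw [← AddChar.map_add_eq_mul]; congr 1; ring
    have e4 : ch N (x + 1) = ch N 1 * ch N (x - s) * ch N s := by
      rw [← AddChar.map_add_eq_mul, ← AddChar.map_add_eq_mul]; congr 1; ring
    have e5 : ch N ((x + 1 - s) * (y + 1 - s)) =
        ch N 1 * ch N (x - s) * ch N (y - s) * ch N ((x - s) * (y - s)) := by
      rw [← AddChar.map_add_eq_mul, ← AddChar.map_add_eq_mul, ← AddChar.map_add_eq_mul]
      congr 1; ring
    have e6 : F (s + 1) = cyc N u₀ v₀ (x - s) * cyc N u₂ v₂ s * cyc N u₄ v₄ (y - s - 1) *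
        ch N ((x - s) * (y - s)) := by
      have i1 : x + 1 - (s + 1) = x - s := by ring
      have i2 : y - (s + 1) = y - s - 1 := by ring
      have i3 : y + 1 - (s + 1) = y - s := by ring
      simp only [F]
      rw [i1, i2, i3, add_sub_cancel_right]
    rw [e1, e2] at hA
    rw [e6]
    simp only [F]
    rw [e3, e4, e5]
    generalize cyc N u₀ v₀ (x + 1 - s) = A at *
    generalize cyc N u₀ v₀ (x - s) = A' at *
    generalize cyc N u₂ v₂ s = B at *
    generalize cyc N u₂ v₂ (s - 1) = B' at *
    generalize cyc N u₄ v₄ (y - s) = C at *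
    generalize cyc N u₄ v₄ (y - s - 1) = C' at *
    have n0 := H₀.ne
    have n2 := H₂.ne
    have n4 := H₄.ne
    generalize ch N 1 = q at *
    generalize ch N (x - s) = X at *
    generalize ch N (y - s) = Y at *
    generalize ch N s = S at *
    generalize ch N ((x - s) * (y - s)) = Z at *
    have hA' : A' = A * (1 - u₀ * (q * X)) / v₀ := by rw [hA]; field_simp
    have hB' : B' = B * (1 - u₂ * S) / v₂ := by rw [hB]; field_simp
    have hC' : C' = C * (1 - u₄ * Y) / v₄ := by rw [hC]; field_simp
    rw [hA', hB', hC']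
    subst h1
    have n1 : v₁ ≠ 0 := by rintro rfl; simp_all
    have n3 : v₃ ≠ 0 := by rintro rfl; simp_all
    have n4' : u₄ ≠ 0 := by rintro rfl; simp_all
    have n0' : u₀ ≠ 0 := by rintro rfl; simp_all
    subst h01 h43 h2
    field_simp
    ring
  have h3 := Finset.sum_congr rfl fun s (_ : s ∈ Finset.univ) => key s
  rw [Finset.sum_sub_distrib, ← Finset.mul_sum, ← Finset.mul_sum, Finset.sum_sub_distrib, hF,
    sub_self, mul_zero, ← Finset.sum_mul] at h3
  exact sub_eq_zero.1 h3

/-- The equations between the parameters of the five tetrahedra of a five term relation. -/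
structure FiveTerm (u v : Fin 5 → ℂ) : Prop where
  h01 : v 0 = v 1 * u 4
  h43 : v 4 = v 3 * u 0
  h2 : v 2 = v 1 * v 3
  h1 : u 1 = u 0 * u 2
  h3 : u 3 = u 4 * u 2

variable {u v : Fin 5 → ℂ}

theorem fiveSum_eq (H : ∀ i, Fermat N (u i) (v i)) (h : FiveTerm u v) (x y : ZMod N) :
    fiveSum N (u 0) (v 0) (u 2) (v 2) (u 4) (v 4) x y =
      fiveSum N (u 0) (v 0) (u 2) (v 2) (u 4) (v 4) 0 0 *
        (cyc N (u 1) (v 1) x * cyc N (u 3) (v 3) y) := by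
  rw [(H 1).eq_cyc (f := fun x => fiveSum N (u 0) (v 0) (u 2) (v 2) (u 4) (v 4) x y) (fun x =>
    fiveSum_succ (H 0) (H 2) (H 4) h.h01 h.h43 h.h2 h.h1 x y) x, fiveSum_symm,
    (H 3).eq_cyc (f := fun y => fiveSum N (u 4) (v 4) (u 2) (v 2) (u 0) (v 0) y 0) (fun y =>
      fiveSum_succ (H 4) (H 2) (H 0) h.h43 h.h01 (by rw [h.h2, mul_comm]) h.h3 y 0) y, fiveSum_symm]
  ring

/-! ### The constant of the five term relation -/

theorem det_cyc {u v : ℂ} (H : Fermat N u v) :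
    Matrix.det (Matrix.of fun x s : Fin N =>
      cyc N u v ((x : ℕ) - (s : ℕ) : ZMod N) * ch N (-((s : ℕ) * (x : ℕ) : ZMod N))) *
        v ^ (N * (N - 1) / 2) = (∏ n : ZMod N, cyc N u v n) *
      Matrix.det (Matrix.vandermonde fun x : Fin N => ch N (-((x : ℕ) : ZMod N))) := by
  have h1 : ∀ (x : ZMod N) (s : ℕ), cyc N u v (x - s) * v ^ s =
      cyc N u v x * ∏ r ∈ Finset.range s, (1 - u * ch N (x - r)) := by
    intro x s
    induction s with
    | zero => simp
    | succ s ih =>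
      rw [Finset.prod_range_succ, ← mul_assoc, ← ih, mul_right_comm, H.cyc_mul, pow_succ]
      push_cast
      rw [sub_sub]
      ring
  let p : Fin N → Polynomial ℂ := fun s =>
    ∏ r ∈ Finset.range s, (Polynomial.X - Polynomial.C (u * ch N (-(r : ZMod N))))
  have hp : ∀ s, (p s).Monic := fun s => Polynomial.monic_prod_of_monic _ _ fun r _ =>
    Polynomial.monic_X_sub_C _
  have hd : ∀ s, (p s).natDegree = s := fun s => by
    rw [Polynomial.natDegree_prod_of_monic _ _ fun r _ => Polynomial.monic_X_sub_C _]
    simp only [Polynomial.natDegree_X_sub_C]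
    simp
  have h2 := Matrix.det_eval_matrixOfPolynomials_eq_det_vandermonde
    (fun x : Fin N => ch N (-((x : ℕ) : ZMod N))) p hd hp
  have h3 : v ^ (N * (N - 1) / 2) = ∏ s : Fin N, v ^ (s : ℕ) := by
    rw [Finset.prod_pow_eq_pow_sum, Fin.sum_univ_eq_sum_range (fun s => s), Finset.sum_range_id]
  rw [h2, h3, ← prod_fin, mul_comm, ← Matrix.det_mul_row, ← Matrix.det_mul_column]
  congr 1
  ext x s
  simp only [Matrix.of_apply, p, Polynomial.eval_prod, Polynomial.eval_sub, Polynomial.eval_X,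
    Polynomial.eval_C]
  rw [mul_left_comm, ← mul_assoc, h1, mul_assoc]
  congr 1
  rw [neg_mul_eq_mul_neg, ch_natCast_mul, ← Finset.card_range (s : ℕ), ← Finset.prod_const,
    Finset.card_range, ← Finset.prod_mul_distrib]
  refine Finset.prod_congr rfl fun r _ => ?_
  rw [sub_eq_add_neg (x.val : ZMod N), AddChar.map_add_eq_mul, sub_mul, one_mul, mul_assoc, mul_right_comm, ← AddChar.map_add_eq_mul,
    add_neg_cancel, AddChar.map_zero_eq_one, one_mul]

theorem det_vandermonde_ch :
    Matrix.det (Matrix.vandermonde fun x : Fin N => ch N (-((x : ℕ) : ZMod N))) *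
      ∏ s : Fin N, ch N ((s : ℕ) * (s : ℕ) : ZMod N) = g N 1 ^ N := by
  rw [Matrix.det_vandermonde, g_pow, ← prod_Icc_reflect,
    Finset.prod_comm' (t' := Finset.univ) (s' := fun j => Finset.Iio j) (by simp),
    ← Finset.prod_mul_distrib]
  have h1 : ∀ j : Fin N, (∏ i ∈ Finset.Iio j,
      (ch N (-((j : ℕ) : ZMod N)) - ch N (-((i : ℕ) : ZMod N)))) * ch N ((j : ℕ) * (j : ℕ) : ZMod N) =
      ∏ d ∈ Finset.Icc 1 (j : ℕ), (1 - 1 * ch N (d : ZMod N)) := by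
    intro j
    rw [ch_natCast_mul]
    have h2 : ch N ((j : ℕ) : ZMod N) ^ (j : ℕ) =
        ∏ i ∈ Finset.Iio j, ch N ((j : ℕ) : ZMod N) := by
      rw [Finset.prod_const, Fin.card_Iio]
    rw [h2, ← Finset.prod_mul_distrib]
    refine Finset.prod_bij (fun i _ => (j : ℕ) - (i : ℕ)) ?_ ?_ ?_ ?_
    · intro i hi
      have := Finset.mem_Iio.1 hi
      rw [Finset.mem_Icc]
      omega
    · intro i hi i' hi' h
      have := Finset.mem_Iio.1 hi
      have := Finset.mem_Iio.1 hi'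
      omega
    · intro d hd
      have := Finset.mem_Icc.1 hd
      exact ⟨⟨(j : ℕ) - d, by omega⟩, Finset.mem_Iio.2 (Fin.lt_def.2 (by change (j : ℕ) - d < j; omega)),
        by change (j : ℕ) - (j - d) = d; omega⟩
    · intro i hi
      have := Finset.mem_Iio.1 hi
      rw [sub_mul, ← AddChar.map_add_eq_mul, ← AddChar.map_add_eq_mul, neg_add_cancel,
        AddChar.map_zero_eq_one, Nat.cast_sub (by omega), one_mul, sub_eq_add_neg _ ((i : ℕ) : ZMod N),
        add_comm]
  rw [Finset.prod_congr rfl fun j _ => h1 j,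
    Fin.prod_univ_eq_prod_range (fun j => ∏ d ∈ Finset.Icc 1 j, (1 - 1 * ch N (d : ZMod N))),
    prod_range_Icc]
  refine Finset.prod_congr rfl fun d hd => ?_
  rw [Nat.cast_sub (by have := (Finset.mem_Icc.1 hd).2; omega)]
  simp

theorem fiveSum_zero_pow (H : ∀ i, Fermat N (u i) (v i)) (hf : FiveTerm u v) :
    (fiveSum N (u 0) (v 0) (u 2) (v 2) (u 4) (v 4) 0 0 * (h N (u 0) * h N (u 2) * h N (u 4))) ^ N =
      (h N (u 1) * h N (u 3)) ^ N := by
  set K := fiveSum N (u 0) (v 0) (u 2) (v 2) (u 4) (v 4) 0 0 with hK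
  let M : ℂ → ℂ → Matrix (Fin N) (Fin N) ℂ := fun u v => Matrix.of fun x s : Fin N =>
      cyc N u v ((x : ℕ) - (s : ℕ) : ZMod N) * ch N (-((s : ℕ) * (x : ℕ) : ZMod N))
  have h1 : M (u 0) (v 0) * (Matrix.of fun s y : Fin N =>
      (cyc N (u 2) (v 2) ((s : ℕ) : ZMod N) * ch N ((s : ℕ) * (s : ℕ) : ZMod N)) *
        (M (u 4) (v 4)).transpose s y) =
      Matrix.of fun x y : Fin N => (K * cyc N (u 1) (v 1) ((x : ℕ) : ZMod N)) *
        (Matrix.of fun x y : Fin N => cyc N (u 3) (v 3) ((y : ℕ) : ZMod N) *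
          (Matrix.vandermonde fun x : Fin N => ch N (-((x : ℕ) : ZMod N))) x y) x y := by
    ext x y
    rw [Matrix.mul_apply]
    simp only [Matrix.of_apply, Matrix.transpose_apply, Matrix.vandermonde_apply, M]
    rw [← ch_natCast_mul]
    have h2 := fiveSum_eq H hf ((x : ℕ) : ZMod N) ((y : ℕ) : ZMod N)
    rw [← hK] at h2
    rw [show ∀ a b c d : ℂ, a * b * (c * d) = a * (b * c) * d by intros; ring, ← h2, fiveSum,
      ← sum_fin, Finset.sum_mul]
    refine Finset.sum_congr rfl fun s _ => ?_
    have h3 : ch N (((x : ℕ) - (s : ℕ)) * ((y : ℕ) - (s : ℕ)) : ZMod N) *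
        ch N ((y : ℕ) * -((x : ℕ) : ZMod N)) = ch N (-((s : ℕ) * (x : ℕ) : ZMod N)) *
        ch N ((s : ℕ) * (s : ℕ) : ZMod N) * ch N (-((s : ℕ) * (y : ℕ) : ZMod N)) := by
      rw [← AddChar.map_add_eq_mul, ← AddChar.map_add_eq_mul, ← AddChar.map_add_eq_mul]
      congr 1
      ring
    rw [mul_assoc _ _ (ch N ((y : ℕ) * -((x : ℕ) : ZMod N))), h3]
    ring
  have h2 := congrArg Matrix.det h1
  rw [Matrix.det_mul, Matrix.det_mul_column, Matrix.det_mul_column, Matrix.det_mul_row,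
    Matrix.det_transpose, Finset.prod_mul_distrib, Finset.prod_mul_distrib, Finset.prod_const,
    Finset.card_univ, Fintype.card_fin, prod_fin, prod_fin, prod_fin] at h2
  have d0 := det_cyc (H 0)
  have d4 := det_cyc (H 4)
  change (M (u 0) (v 0)).det * _ = _ at d0
  change (M (u 4) (v 4)).det * _ = _ at d4
  have hV : (Matrix.vandermonde fun x : Fin N => ch N (-((x : ℕ) : ZMod N))).det *
      ∏ s : Fin N, ch N ((s : ℕ) * (s : ℕ) : ZMod N) = _ := det_vandermonde_ch
  have hV0 : (Matrix.vandermonde fun x : Fin N => ch N (-((x : ℕ) : ZMod N))).det ≠ 0 := by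
    intro h0
    rw [h0, zero_mul] at hV
    exact g_one_pow_ne_zero hV.symm
  have c0 := (H 0).prod_cyc
  have c1 := (H 1).prod_cyc
  have c2 := (H 2).prod_cyc
  have c3 := (H 3).prod_cyc
  have c4 := (H 4).prod_cyc
  have z0 := pow_ne_zero (N * (N - 1) / 2) (H 0).ne
  have z4 := pow_ne_zero (N * (N - 1) / 2) (H 4).ne
  have z1 := pow_ne_zero (N * (N - 1) / 2) (H 1).ne
  have z3 := pow_ne_zero (N * (N - 1) / 2) (H 3).ne
  have p1 := (H 1).prod_cyc_ne_zero
  have p3 := (H 3).prod_cyc_ne_zero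
  have z2 : v 2 ^ (N * (N - 1) / 2) = v 1 ^ (N * (N - 1) / 2) * v 3 ^ (N * (N - 1) / 2) := by
    rw [hf.h2, mul_pow]
  have hg := g_one_pow_ne_zero (N := N)
  rw [z2] at c2
  simp only [h, mul_pow, div_pow]
  generalize (Matrix.vandermonde fun x : Fin N => ch N (-((x : ℕ) : ZMod N))).det = V at *
  generalize (M (u 0) (v 0)).det = M0 at *
  generalize (M (u 4) (v 4)).det = M4 at *
  generalize g N 1 ^ N = G at *
  generalize g N (u 0) ^ N = G0 at *
  generalize g N (u 1) ^ N = G1 at *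
  generalize g N (u 2) ^ N = G2 at *
  generalize g N (u 3) ^ N = G3 at *
  generalize g N (u 4) ^ N = G4 at *
  generalize v 0 ^ (N * (N - 1) / 2) = V0 at *
  generalize v 1 ^ (N * (N - 1) / 2) = V1 at *
  generalize v 3 ^ (N * (N - 1) / 2) = V3 at *
  generalize v 4 ^ (N * (N - 1) / 2) = V4 at *
  generalize ∏ n : ZMod N, cyc N (u 0) (v 0) n = C0 at *
  generalize ∏ n : ZMod N, cyc N (u 1) (v 1) n = C1 at *
  generalize ∏ n : ZMod N, cyc N (u 2) (v 2) n = C2 at *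
  generalize ∏ n : ZMod N, cyc N (u 3) (v 3) n = C3 at *
  generalize ∏ n : ZMod N, cyc N (u 4) (v 4) n = C4 at *
  generalize ∏ s : Fin N, ch N ((s : ℕ) * (s : ℕ) : ZMod N) = Z at *
  generalize K ^ N = k at *
  clear_value K M
  have e1 : V * (k * C1 * C3 * (V0 * V4)) = V * (C0 * C2 * C4 * G) := by
    linear_combination (-V0 * V4) * h2 + C2 * Z * M4 * V4 * d0 + C2 * Z * C0 * V * d4 +
      C0 * C2 * C4 * V * hV
  have e2 := mul_left_cancel₀ hV0 e1
  field_simp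
  apply mul_left_cancel₀ (mul_ne_zero (mul_ne_zero p1 p3) (mul_ne_zero z0 z4))
  have e3 : C1 * C3 * (V0 * V4) * (k * G0 * G2 * G4) = C0 * C2 * C4 * G * (G0 * G2 * G4) := by
    linear_combination (G0 * G2 * G4) * e2
  have e4 : C0 * C2 * C4 * (G0 * G2 * G4) = V0 * (V1 * V3) * V4 := by
    rw [← c0, ← c2, ← c4]; ring
  have e5 : C1 * C3 * (G1 * G3) = V1 * V3 := by rw [← c1, ← c3]; ring
  linear_combination e3 + G * e4 - G * V0 * V4 * e5

end Pentagon

section Lune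

variable {N : ℕ} [NeZero N]

/-! ### Orthogonality relations -/

theorem sum_ch_mul_prod (k : ℕ) (c : ℕ → ℂ) (r : ZMod N) (hr : ∀ i : ℕ, i ≤ k → r + i ≠ 0) :
    ∑ n : ZMod N, ch N (n * r) * ∏ j ∈ Finset.range k, (1 - c j * ch N n) = 0 := by
  induction k generalizing r with
  | zero =>
    have := hr 0 le_rfl
    simp only [Nat.cast_zero, add_zero] at this
    simp [sum_ch_mul, this]
  | succ k ih =>
    have h1 := ih r fun i hi => hr i (by omega)
    have h2 := ih (r + 1) fun i hi => by
      have := hr (i + 1) (by omega)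
      rw [Nat.cast_add, Nat.cast_one] at this
      rwa [add_assoc, add_comm 1]
    have h3 : ∀ n : ZMod N, ch N (n * r) * ∏ j ∈ Finset.range (k + 1), (1 - c j * ch N n) =
        ch N (n * r) * ∏ j ∈ Finset.range k, (1 - c j * ch N n) -
        c k * (ch N (n * (r + 1)) * ∏ j ∈ Finset.range k, (1 - c j * ch N n)) := by
      intro n
      rw [Finset.prod_range_succ, mul_add, mul_one, AddChar.map_add_eq_mul]
      ring
    rw [Finset.sum_congr rfl fun n _ => h3 n, Finset.sum_sub_distrib, ← Finset.mul_sum, h1, h2]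
    simp

variable {u v : ℂ}

theorem Fermat.sum_cyc_div (H : Fermat N u v) {r d : ZMod N} (hd : d ≠ 0)
    (hr : ∀ i : ℕ, i < d.val → r + i ≠ 0) :
    ∑ n : ZMod N, ch N (n * r) * (cyc N u v n / cyc N u v (n + d - 1)) = 0 := by
  obtain ⟨k, hk⟩ : ∃ k, d.val = k + 1 := ⟨d.val - 1, by
    have : d.val ≠ 0 := fun h => hd ((ZMod.val_eq_zero d).1 h)
    omega⟩
  have hd' : d = (k : ZMod N) + 1 := by rw [← ZMod.natCast_zmod_val d, hk]; push_cast; rfl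
  have h1 : ∀ (k : ℕ) (n : ZMod N), cyc N u v n * v ^ k =
      cyc N u v (n + k) * ∏ j ∈ Finset.range k, (1 - u * ch N (j + 1) * ch N n) := by
    intro k n
    induction k with
    | zero => simp
    | succ k ih =>
      have := H.cyc_mul (n + (k + 1))
      rw [show n + ((k : ZMod N) + 1) - 1 = n + k by ring] at this
      rw [Finset.prod_range_succ, pow_succ, ← mul_assoc, ih, mul_right_comm, mul_comm _ v, ← this]
      push_cast
      rw [AddChar.map_add_eq_mul (ch N) n, AddChar.map_add_eq_mul (ch N) (k : ZMod N)]
      ring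
  have h2 := sum_ch_mul_prod k (fun j => u * ch N (j + 1)) r fun i hi => hr i (by omega)
  have h3 : ∀ n : ZMod N, ch N (n * r) * (cyc N u v n / cyc N u v (n + d - 1)) =
      (v ^ k)⁻¹ * (ch N (n * r) * ∏ j ∈ Finset.range k, (1 - u * ch N (j + 1) * ch N n)) := by
    intro n
    have := H.cyc_ne_zero (n + k)
    have := pow_ne_zero k H.ne
    rw [hd', ← add_assoc, add_sub_cancel_right]
    field_simp
    rw [mul_assoc, h1]
    ring
  rw [Finset.sum_congr rfl fun n _ => h3 n, ← Finset.mul_sum, h2, mul_zero]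

theorem Fermat.sum_cyc_div_self (H : Fermat N u v) (k : ℕ) (hk : k < N) :
    ∑ n : ZMod N, ch N (-(n * k)) * (cyc N u v n / cyc N u v (n - 1)) * v ^ (N - 1) = N * u ^ k := by
  have h1 : ∀ n : ZMod N, ch N (-(n * k)) * (cyc N u v n / cyc N u v (n - 1)) * v ^ (N - 1) =
      ∑ j ∈ Finset.range N, u ^ j * ch N (n * (j - k)) := by
    intro n
    have e1 := H.cyc_mul n
    have e2 := H.one_sub_ne n
    have e3 := H.cyc_ne_zero (n - 1)
    have e4 := geom_sum_mul (u * ch N n) N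
    have e5 : cyc N u v n / cyc N u v (n - 1) = v / (1 - u * ch N n) := by
      rw [div_eq_div_iff e3 e2, e1]
    have e6 : v * v ^ (N - 1) = v ^ N := by
      rw [← pow_succ']; congr 1; have := NeZero.pos N; omega
    rw [mul_pow u, ch_pow_card, mul_one] at e4
    have e7 : v ^ N = (∑ j ∈ Finset.range N, (u * ch N n) ^ j) * (1 - u * ch N n) := by
      linear_combination H.eq + e4
    rw [e5, mul_assoc, div_mul_eq_mul_div, e6, e7, mul_div_assoc, div_self e2, mul_one,
      Finset.mul_sum]
    refine Finset.sum_congr rfl fun j _ => ?_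
    rw [mul_pow, ← ch_natCast_mul, mul_left_comm, ← AddChar.map_add_eq_mul]
    congr 2
    ring
  rw [Finset.sum_congr rfl fun n _ => h1 n, Finset.sum_comm]
  simp only [← Finset.mul_sum, sum_ch_mul]
  rw [Finset.sum_eq_single k]
  · simp [mul_comm]
  · intro j hj hjk
    rw [if_neg, mul_zero]
    intro h
    apply hjk
    have h2 := congrArg ZMod.val (sub_eq_zero.1 h)
    rwa [ZMod.val_cast_of_lt (Finset.mem_range.1 hj), ZMod.val_cast_of_lt hk] at h2
  · intro h
    exact absurd (Finset.mem_range.2 hk) h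

/-! ### Elementary forms of the tensors -/

/-- The tensor `ζ^{kj+(m+1)k²} P(i-k) δ(i+j-l)` with labels in `ℤ/N`. -/
def tensorPos (N : ℕ) [NeZero N] (P : ZMod N → ℂ) (i j k l : ZMod N) : ℂ :=
  ch N (k * j + ((N - 1) / 2 + 1 : ℕ) * k ^ 2) * P (i - k) * if i + j = l then 1 else 0

/-- The tensor `ζ^{-kj-(m+1)k²} B(i-k) δ(i+j-l)` with labels in `ℤ/N`. -/
def tensorNeg (N : ℕ) [NeZero N] (B : ZMod N → ℂ) (i j k l : ZMod N) : ℂ :=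
  ch N (-(k * j + ((N - 1) / 2 + 1 : ℕ) * k ^ 2)) * B (i - k) * if i + j = l then 1 else 0

/-- The function in the entries of `L_N(u,v)`. -/
def fnPos (N : ℕ) [NeZero N] (u v : ℂ) (n : ZMod N) : ℂ := h N u * cyc N u v n

/-- The function in the entries of the inverse of `L_N(u,v)`. -/
def fnNeg (N : ℕ) [NeZero N] (u v : ℂ) (n : ZMod N) : ℂ :=
  v ^ (N - 1) / (N * h N u) / cyc N u v (n - 1)

theorem Fermat.sum_fnPos_mul_fnNeg (H : Fermat N u v) (d : ZMod N) :
    ∑ n, ch N (-(n * d)) * (fnPos N u v n * fnNeg N u v (n + d)) = if d = 0 then 1 else 0 := by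
  have hN : (N : ℂ) ≠ 0 := NeZero.ne _
  have hh := H.h_ne_zero
  have e : ∀ n, ch N (-(n * d)) * (fnPos N u v n * fnNeg N u v (n + d)) =
      (v ^ (N - 1) / N) * (ch N (n * -d) * (cyc N u v n / cyc N u v (n + d - 1))) := by
    intro n
    have := H.cyc_ne_zero (n + d - 1)
    rw [fnPos, fnNeg, ← mul_neg]
    field_simp
  rw [Finset.sum_congr rfl fun n _ => e n, ← Finset.mul_sum]
  split_ifs with hd
  · subst hd
    have := H.sum_cyc_div_self 0 (NeZero.pos N)
    rw [← Finset.sum_mul] at this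
    simp only [Nat.cast_zero, mul_zero, neg_zero, AddChar.map_zero_eq_one, one_mul, pow_zero,
      mul_one, add_zero] at this ⊢
    rw [div_mul_eq_mul_div, mul_comm, this, div_self hN]
  · rw [H.sum_cyc_div hd, mul_zero]
    intro i hi h0
    rw [neg_add_eq_zero] at h0
    have h1 := ZMod.val_cast_of_lt (hi.trans d.val_lt)
    rw [← h0] at h1
    omega

theorem Fermat.sum_fnPos_mul_fnNeg_twist (H : Fermat N u v) (d : ZMod N) :
    ∑ n, fnPos N u v n * fnNeg N u (v * ch N (-1)) (n + d) = if d = 0 then u ^ (N - 1) else 0 := by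
  have hN : (N : ℂ) ≠ 0 := NeZero.ne _
  have hh := H.h_ne_zero
  have hN1 : ((N - 1 : ℕ) : ZMod N) = -1 := by
    rw [Nat.cast_sub (NeZero.pos N)]; simp
  have e : ∀ n, fnPos N u v n * fnNeg N u (v * ch N (-1)) (n + d) =
      (v ^ (N - 1) * ch N d / N) * (ch N (n * 1) * (cyc N u v n / cyc N u v (n + d - 1))) := by
    intro n
    have := H.cyc_ne_zero (n + d - 1)
    have e1 : ch N (-1) ^ (N - 1) = ch N d * ch N n * ch N (-(n + d - 1)) := by
      rw [← ch_natCast_mul, hN1, ← AddChar.map_add_eq_mul, ← AddChar.map_add_eq_mul]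
      congr 1
      ring
    have e2 := ch_ne_zero (-(n + d - 1))
    rw [fnPos, fnNeg, H.cyc_twist, mul_one, mul_pow, e1]
    field_simp
  rw [Finset.sum_congr rfl fun n _ => e n, ← Finset.mul_sum]
  split_ifs with hd
  · subst hd
    have := H.sum_cyc_div_self (N - 1) (Nat.sub_lt (NeZero.pos N) one_pos)
    rw [← Finset.sum_mul, hN1] at this
    simp only [mul_neg, mul_one, neg_neg, AddChar.map_zero_eq_one, add_zero] at this ⊢
    rw [div_mul_eq_mul_div, mul_comm, this, mul_div_cancel_left₀ _ hN]
  · rw [H.sum_cyc_div hd, mul_zero]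
    intro i hi h0
    have h1 : ((1 + i : ℕ) : ZMod N) = 0 := by push_cast; exact h0
    rw [ZMod.natCast_eq_zero_iff] at h1
    have := Nat.le_of_dvd (by omega) h1
    have := d.val_lt
    omega

theorem Fermat.fnPos_mul_fnNeg_shift (H : Fermat N u v) :
    ∃ c : ℂ, c ^ N = (v ^ (N - 1)) ^ N ∧ ∀ n, fnPos N u v n * fnNeg N (u * ch N 1) v n = c / N := by
  have hg : g N 1 ≠ 0 := fun h => g_one_pow_ne_zero (N := N) (by rw [h, zero_pow (NeZero.ne N)])
  have hN : (N : ℂ) ≠ 0 := NeZero.ne _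
  have h1 := H.shift.h_ne_zero
  refine ⟨v ^ (N - 1) * (h N u * cyc N u v 1 / h N (u * ch N 1)), ?_, fun n => ?_⟩
  · have h2 := H.g_shift_pow
    have h3 := H.shift.g_ne_zero
    have h5 := H.g_ne_zero
    have h6 := H.cyc_ne_zero 1
    have h4 : (h N u * cyc N u v 1 / h N (u * ch N 1)) ^ N = 1 := by
      rw [h, h, div_pow, div_mul_eq_mul_div, div_pow, div_pow, h2]
      apply div_self
      exact div_ne_zero (pow_ne_zero _ (mul_ne_zero h5 h6)) (pow_ne_zero _ hg)
    rw [mul_pow, h4, mul_one]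
  · have h2 := H.cyc_shift (n - 1)
    rw [sub_add_cancel] at h2
    have h3 := H.shift.cyc_ne_zero (n - 1)
    rw [fnPos, fnNeg, h2]
    field_simp

end Lune

section Lune

variable {N : ℕ} [NeZero N]

/-! ### Contractions of two tensors along two faces -/

variable {P B : ZMod N → ℂ} {c : ℂ}

theorem sum_sub_right (f : ZMod N → ℂ) (k : ZMod N) : ∑ i, f (i - k) = ∑ n, f n :=
  Equiv.sum_comp (Equiv.subRight k) f

theorem sum_sub_left (f : ZMod N → ℂ) (i : ZMod N) : ∑ k, f (i - k) = ∑ n, f n :=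
  Equiv.sum_comp (Equiv.subLeft i) f

theorem sum_tensor_02 (h : ∀ d, ∑ n, ch N (-(n * d)) * (P n * B (n + d)) = if d = 0 then c else 0)
    (k l k' l' : ZMod N) :
    ∑ i, ∑ j, tensorPos N P i j k l * tensorNeg N B i j k' l' =
      if k = k' ∧ l = l' then c else 0 := by
  have h1 : ∀ i, ∑ j, tensorPos N P i j k l * tensorNeg N B i j k' l' =
      if l = l' then ch N ((k - k') * (l - k) + ((N - 1) / 2 + 1 : ℕ) * (k ^ 2 - k' ^ 2)) *
        (ch N (-((i - k) * (k - k'))) * (P (i - k) * B (i - k + (k - k')))) else 0 := by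
    intro i
    rw [Finset.sum_eq_single (l - i)]
    · simp only [tensorPos, tensorNeg, add_sub_cancel, sub_add_sub_cancel, if_true]
      split_ifs with hl
      · subst hl
        have : ch N ((k - k') * (l - k) + ((N - 1) / 2 + 1 : ℕ) * (k ^ 2 - k' ^ 2)) *
          ch N (-((i - k) * (k - k'))) = ch N (k * (l - i) + ((N - 1) / 2 + 1 : ℕ) * k ^ 2) *
            ch N (-(k' * (l - i) + ((N - 1) / 2 + 1 : ℕ) * k' ^ 2)) := by
          rw [← AddChar.map_add_eq_mul, ← AddChar.map_add_eq_mul]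
          congr 1
          ring
        rw [← mul_assoc (ch N _) (ch N _), this]
        ring
      · simp
    · intro j _ hj
      have : i + j ≠ l := fun h => hj (by rw [← h]; ring)
      simp [tensorPos, this]
    · simp
  rw [Finset.sum_congr rfl fun i _ => h1 i]
  by_cases hl : l = l'
  · simp only [hl, if_true, and_true]
    rw [← Finset.mul_sum, sum_sub_right
      (fun n => ch N (-(n * (k - k'))) * (P n * B (n + (k - k')))), h]
    by_cases hk : k = k'
    · subst hk; simp
    · simp [hk, sub_eq_zero]
  · simp [hl]

theorem sum_tensor_13 (h : ∀ d, ∑ n, ch N (-(n * d)) * (P n * B (n + d)) = if d = 0 then c else 0)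
    (i j i' j' : ZMod N) :
    ∑ k, ∑ l, tensorPos N P i j k l * tensorNeg N B i' j' k l =
      if i = i' ∧ j = j' then c else 0 := by
  have h1 : ∀ k, ∑ l, tensorPos N P i j k l * tensorNeg N B i' j' k l =
      if i + j = i' + j' then ch N (i * (i' - i)) *
        (ch N (-((i - k) * (i' - i))) * (P (i - k) * B (i - k + (i' - i)))) else 0 := by
    intro k
    rw [Finset.sum_eq_single (i + j)]
    · simp only [tensorPos, tensorNeg, eq_comm (a := i' + j'), if_true]
      split_ifs with hl
      · have e1 : i - k + (i' - i) = i' - k := by ring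
        have : ch N (i * (i' - i)) * ch N (-((i - k) * (i' - i))) =
            ch N (k * j + ((N - 1) / 2 + 1 : ℕ) * k ^ 2) *
            ch N (-(k * j' + ((N - 1) / 2 + 1 : ℕ) * k ^ 2)) := by
          rw [← AddChar.map_add_eq_mul, ← AddChar.map_add_eq_mul]
          congr 1
          linear_combination -k * hl
        rw [← mul_assoc (ch N _) (ch N _), this, e1]
        ring
      · simp
    · intro l _ hl
      simp [tensorPos, hl.symm]
    · simp
  rw [Finset.sum_congr rfl fun i _ => h1 i]
  by_cases hl : i + j = i' + j'
  · simp only [hl, if_true]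
    rw [← Finset.mul_sum, sum_sub_left
      (fun n => ch N (-(n * (i' - i))) * (P n * B (n + (i' - i)))), h]
    by_cases hk : i = i'
    · subst hk
      simp [add_left_cancel hl]
    · simp [hk, sub_eq_zero, eq_comm (a := i')]
  · have : ¬ (i = i' ∧ j = j') := fun h => hl (by rw [h.1, h.2])
    simp [hl, this]

theorem sum_tensor_01 (h : ∀ n, P n * B n = c / N) (i k i' k' : ZMod N) :
    ∑ j, ∑ l, tensorPos N P i j k l * tensorNeg N B i' j k' l =
      if i = i' ∧ k = k' then c else 0 := by
  have hN : (N : ℂ) ≠ 0 := NeZero.ne _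
  have h1 : ∀ j, ∑ l, tensorPos N P i j k l * tensorNeg N B i' j k' l =
      if i = i' then ch N (((N - 1) / 2 + 1 : ℕ) * (k ^ 2 - k' ^ 2)) * (P (i - k) * B (i - k')) *
        ch N (j * (k - k')) else 0 := by
    intro j
    rw [Finset.sum_eq_single (i + j)]
    · simp only [tensorPos, tensorNeg, add_left_inj, eq_comm (a := i'), if_true]
      split_ifs with hl
      · subst hl
        have : ch N (((N - 1) / 2 + 1 : ℕ) * (k ^ 2 - k' ^ 2)) * ch N (j * (k - k')) =
            ch N (k * j + ((N - 1) / 2 + 1 : ℕ) * k ^ 2) *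
            ch N (-(k' * j + ((N - 1) / 2 + 1 : ℕ) * k' ^ 2)) := by
          rw [← AddChar.map_add_eq_mul, ← AddChar.map_add_eq_mul]
          congr 1
          ring
        linear_combination (-(P (i - k) * B (i - k'))) * this
      · simp
    · intro l _ hl
      simp [tensorPos, hl.symm]
    · simp
  rw [Finset.sum_congr rfl fun i _ => h1 i]
  by_cases hl : i = i'
  · simp only [hl, if_true, true_and]
    rw [← Finset.mul_sum, sum_ch_mul]
    simp only [sub_eq_zero]
    split_ifs with hk
    · subst hk
      rw [h]
      simp [hN]
    · simp
  · simp [hl]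

theorem sum_tensor_23 (h : ∀ n, P n * B n = c / N) (j l j' l' : ZMod N) :
    ∑ i, ∑ k, tensorPos N P i j k l * tensorNeg N B i j' k l' =
      if j = j' ∧ l = l' then c else 0 := by
  have hN : (N : ℂ) ≠ 0 := NeZero.ne _
  rw [Finset.sum_eq_single (l - j)]
  · have h1 : ∀ k, tensorPos N P (l - j) j k l * tensorNeg N B (l - j) j' k l' =
        ch N (k * (j - j')) * if l - j + j' = l' then c / N else 0 := by
      intro k
      rw [← h (l - j - k)]
      simp only [tensorPos, tensorNeg, sub_add_cancel, if_true]
      split_ifs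
      · have : ch N (k * (j - j')) = ch N (k * j + ((N - 1) / 2 + 1 : ℕ) * k ^ 2) *
            ch N (-(k * j' + ((N - 1) / 2 + 1 : ℕ) * k ^ 2)) := by
          rw [← AddChar.map_add_eq_mul]
          congr 1
          ring
        rw [this]
        ring
      · simp
    rw [Finset.sum_congr rfl fun i _ => h1 i, ← Finset.sum_mul, sum_ch_mul]
    simp only [sub_eq_zero]
    by_cases hj : j = j'
    · subst hj
      simp only [if_true, sub_add_cancel, true_and]
      split_ifs
      · field_simp
      · simp
    · simp [hj]
  · intro i _ hi
    have : i + j ≠ l := fun h => hi (by rw [← h]; ring)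
    simp [tensorPos, this]
  · simp

theorem sum_tensor_03 (h : ∀ d, ∑ n, P n * B (n + d) = if d = 0 then c else 0)
    (i l i' l' : ZMod N) :
    ∑ j, ∑ k, tensorPos N P i j k l * tensorNeg N B i' j k l' =
      if i = i' ∧ l = l' then c else 0 := by
  rw [Finset.sum_eq_single (l - i)]
  · have h1 : ∀ k, tensorPos N P i (l - i) k l * tensorNeg N B i' (l - i) k l' =
        P (i - k) * B (i - k + (i' - i)) * if i' + (l - i) = l' then 1 else 0 := by
      intro k
      simp only [tensorPos, tensorNeg, add_sub_cancel, if_true]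
      rw [ch_neg, show i - k + (i' - i) = i' - k by ring]
      have := ch_ne_zero (k * (l - i) + (((N - 1) / 2 + 1 : ℕ) : ZMod N) * k ^ 2)
      field_simp
    rw [Finset.sum_congr rfl fun i _ => h1 i, ← Finset.sum_mul, sum_sub_left
      (fun n => P n * B (n + (i' - i))), h]
    simp only [sub_eq_zero]
    by_cases hj : i = i'
    · subst hj
      simp
    · simp [hj, eq_comm (a := i')]
  · intro j _ hj
    have : i + j ≠ l := fun h => hj (by rw [← h]; ring)
    simp [tensorPos, this]
  · simp

theorem sum_tensor_12 (h : ∀ d, ∑ n, P n * B (n + d) = if d = 0 then c else 0)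
    (j k j' k' : ZMod N) :
    ∑ i, ∑ l, tensorPos N P i j k l * tensorNeg N B i j' k' l =
      if j = j' ∧ k = k' then c else 0 := by
  have h1 : ∀ i, ∑ l, tensorPos N P i j k l * tensorNeg N B i j' k' l =
      if j = j' then ch N (k * j + ((N - 1) / 2 + 1 : ℕ) * k ^ 2) *
        ch N (-(k' * j + ((N - 1) / 2 + 1 : ℕ) * k' ^ 2)) *
        (P (i - k) * B (i - k + (k - k'))) else 0 := by
    intro i
    rw [Finset.sum_eq_single (i + j)]
    · simp only [tensorPos, tensorNeg, add_right_inj, eq_comm (a := j'), sub_add_sub_cancel, if_true]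
      split_ifs with hl
      · subst hl
        ring
      · simp
    · intro l _ hl
      simp [tensorPos, hl.symm]
    · simp
  rw [Finset.sum_congr rfl fun i _ => h1 i]
  by_cases hl : j = j'
  · simp only [hl, if_true, true_and]
    rw [← Finset.mul_sum, sum_sub_right
      (fun n => P n * B (n + (k - k'))), h]
    simp only [sub_eq_zero]
    split_ifs with hk
    · subst hk
      rw [← AddChar.map_add_eq_mul, add_neg_cancel, AddChar.map_zero_eq_one, one_mul]
    · simp
  · simp [hl]

/-! ### The tensors of the decorated tetrahedra -/

theorem basicL_apply (u v : ℂ) (i j k l : Fin N) :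
    basicL N u v (i, j) (k, l) = tensorPos N (fnPos N u v) (i : ℕ) (j : ℕ) (k : ℕ) (l : ℕ) := by
  simp only [basicL, Matrix.of_apply, tensorPos, fnPos, delta]
  rw [zeta_pow, omega_eq_cyc]
  have : (N : ℤ) ∣ (i : ℤ) + (j : ℤ) - (l : ℤ) ↔
      ((i : ℕ) : ZMod N) + ((j : ℕ) : ZMod N) = ((l : ℕ) : ZMod N) := by
    rw [← ZMod.intCast_zmod_eq_zero_iff_dvd, ← sub_eq_zero (b := ((l : ℕ) : ZMod N))]
    push_cast
    rfl
  simp only [this]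
  push_cast
  ring

theorem Fermat.basicL_inv {u v : ℂ} (H : Fermat N u v) (i j k l : Fin N) :
    (basicL N u v)⁻¹ (k, l) (i, j) =
      tensorNeg N (fnNeg N u v) (i : ℕ) (j : ℕ) (k : ℕ) (l : ℕ) := by
  have h : basicL N u v * (Matrix.of fun (p q : Fin N × Fin N) => tensorNeg N (fnNeg N u v)
      (q.1 : ℕ) (q.2 : ℕ) (p.1 : ℕ) (p.2 : ℕ)) = 1 := by
    ext ⟨i, j⟩ ⟨i', j'⟩
    rw [Matrix.mul_apply, Fintype.sum_prod_type]
    simp only [basicL_apply, Matrix.of_apply]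
    have h1 := sum_tensor_13 H.sum_fnPos_mul_fnNeg (i : ℕ) (j : ℕ) (i' : ℕ) (j' : ℕ)
    rw [← sum_fin] at h1
    simp only [← sum_fin] at h1
    rw [h1, Matrix.one_apply]
    have h2 : ∀ a b : Fin N, ((a : ℕ) : ZMod N) = ((b : ℕ) : ZMod N) ↔ a = b := by
      intro a b
      rw [ZMod.natCast_eq_natCast_iff', Nat.mod_eq_of_lt a.2, Nat.mod_eq_of_lt b.2, Fin.val_inj]
    simp only [h2, Prod.mk.injEq]
  rw [Matrix.inv_eq_right_inv h, Matrix.of_apply]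

end Lune

section Lune

variable {N : ℕ} [NeZero N]

namespace Decoration

theorem root_pow (hodd : Odd N) (D : Decoration) (s : ℤˣ) (k : Fin 3) :
    D.root N s k ^ N = D.w k := by
  have hN : (N : ℂ) ≠ 0 := NeZero.ne _
  obtain ⟨t, ht⟩ := hodd.add_one
  have ht' : (N : ℂ) + 1 = t + t := by exact_mod_cast ht
  rw [root, ← Complex.exp_nat_mul, ← mul_assoc, mul_one_div_cancel hN, one_mul, Complex.exp_add,
    Complex.exp_log (D.w_ne_zero k), ht']
  have : I * Real.pi * ((t : ℂ) + t) * (D.f k - ((s : ℤ) : ℂ) * D.c k) =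
      ((t * (D.f k - s * D.c k) : ℤ) : ℂ) * (2 * Real.pi * I) := by
    push_cast
    ring
  rw [this, Complex.exp_int_mul_two_pi_mul_I, mul_one]

theorem root_ne_zero {N : ℕ} (D : Decoration) (s : ℤˣ) (k : Fin 3) : D.root N s k ≠ 0 :=
  Complex.exp_ne_zero _

theorem fermat (hodd : Odd N) (D : Decoration) (s : ℤˣ) :
    Fermat N (D.root N s 0) (D.root N s 1)⁻¹ := by
  refine ⟨?_, inv_ne_zero (D.root_ne_zero s 1)⟩
  rw [inv_pow, root_pow hodd, root_pow hodd]
  have h : D.w 1 * (1 - D.w 0) = 1 := D.w_succ 0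
  have := D.w_ne_zero 1
  field_simp
  linear_combination -h

/-- The scalar factor of the matrix dilogarithm. -/
def factor (D : Decoration) (N : ℕ) (s : ℤˣ) : ℂ :=
  (D.root N s 0 ^ (-D.c 1) * D.root N s 1 ^ D.c 0) ^ ((N - 1) / 2)

theorem tensor_one (D : Decoration) (σ : Fin 4 → Fin N) :
    D.tensor N 1 σ = D.factor N 1 * tensorPos N (fnPos N (D.root N 1 0) (D.root N 1 1)⁻¹)
      (σ 2 : ℕ) (σ 0 : ℕ) (σ 3 : ℕ) (σ 1 : ℕ) := by
  simp only [tensor, matrixDilog, if_true, Matrix.smul_apply, basicL_apply, smul_eq_mul, factor]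

theorem tensor_neg_one (hodd : Odd N) (D : Decoration) (σ : Fin 4 → Fin N) :
    D.tensor N (-1) σ = D.factor N (-1) *
      tensorNeg N (fnNeg N (D.root N (-1) 0) (D.root N (-1) 1)⁻¹)
        (σ 2 : ℕ) (σ 0 : ℕ) (σ 3 : ℕ) (σ 1 : ℕ) := by
  have h : (-1 : ℤˣ) ≠ 1 := by decide
  simp only [tensor, matrixDilog, if_neg h, Matrix.smul_apply, (D.fermat hodd (-1)).basicL_inv,
    smul_eq_mul, factor]

end Decoration

variable {s : ℤˣ} {e : Fin 3} {D D' : Decoration}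

theorem IsLocalBubble.symm (H : IsLocalBubble s e D D') : IsLocalBubble (-s) e D' D := by
  intro k
  obtain ⟨h1, h2, h3⟩ := H k
  refine ⟨?_, ?_, ?_⟩
  · rw [neg_neg, mul_comm]; exact h1
  · rw [neg_neg, add_comm]; exact h2
  · rw [add_comm]; exact h3

theorem IsLocalBubble.w_eq (H : IsLocalBubble s e D D') (k : Fin 3) : D'.w k = D.w k := by
  have h := (H k).1
  have h1 := D.w_ne_zero k
  have h2 := D'.w_ne_zero k
  rcases Int.units_eq_one_or s with rfl | rfl
  · simp at h
    field_simp at h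
    exact h.symm
  · simp at h
    field_simp at h
    exact h

theorem IsLocalBubble.l_eq (H : IsLocalBubble s e D D') (k : Fin 3) : D'.l k = D.l k := by
  have h := (H k).2.1
  rcases Int.units_eq_one_or s with rfl | rfl
  · simp at h
    linear_combination -h
  · simp at h
    linear_combination h

theorem IsLocalBubble.f_eq (H : IsLocalBubble s e D D') (k : Fin 3) : D'.f k = D.f k := by
  have h := H.l_eq k
  rw [Decoration.l, Decoration.l, H.w_eq, add_right_inj] at h
  have hpi : (Real.pi : ℂ) ≠ 0 := by exact_mod_cast Real.pi_ne_zero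
  have h2 := mul_left_cancel₀ I_ne_zero (mul_right_cancel₀ hpi h)
  exact_mod_cast h2

theorem IsLocalBubble.root_eq (H : IsLocalBubble 1 e D D') (k : Fin 3) :
    D'.root N (-1) k = D.root N 1 k * ch N (if k = e then 1 else 0) := by
  have hN : (N : ℂ) ≠ 0 := NeZero.ne _
  have h3 : D'.c k = (if k = e then 2 else 0) - D.c k := by linear_combination (H k).2.2
  rw [Decoration.root, Decoration.root, H.w_eq, H.f_eq, h3]
  split_ifs with hk
  · have h4 := ZMod.stdAddChar_coe (N := N) ((N : ℤ) + 1)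
    push_cast at h4
    rw [ZMod.natCast_self, zero_add] at h4
    rw [ch, h4, ← Complex.exp_add]
    congr 1
    push_cast
    field_simp
    ring
  · rw [AddChar.map_zero_eq_one, mul_one]
    congr 1
    push_cast
    ring

theorem IsLocalBubble.root_eq_self (H : IsLocalBubble 1 e D D') {k : Fin 3} (hk : k ≠ e) :
    D'.root N (-1) k = D.root N 1 k := by
  rw [H.root_eq, if_neg hk, AddChar.map_zero_eq_one, mul_one]

theorem IsLocalBubble.root_eq_shift (H : IsLocalBubble 1 e D D') :
    D'.root N (-1) e = D.root N 1 e * ch N 1 := by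
  rw [H.root_eq, if_pos rfl]

theorem fin_cast_inj {N : ℕ} {a b : Fin N} : ((a : ℕ) : ZMod N) = ((b : ℕ) : ZMod N) ↔ a = b := by
  rw [ZMod.natCast_eq_natCast_iff', Nat.mod_eq_of_lt a.2, Nat.mod_eq_of_lt b.2, Fin.val_inj]

/-- Contraction of two functions of the labels of a tetrahedron over the labels of two faces. -/
def lune (N : ℕ) (T T' : (Fin 4 → Fin N) → ℂ) (a b : Fin 4) (x y : Fin 4 → Fin N) : ℂ :=
  ∑ p, ∑ q, T (Function.update (Function.update x a p) b q) *
    T' (Function.update (Function.update y a p) b q)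

theorem lune_comm {N : ℕ} (T T' : (Fin 4 → Fin N) → ℂ) {a b : Fin 4} (hab : a ≠ b) (x y : Fin 4 → Fin N) :
    lune N T T' a b x y = lune N T T' b a x y := by
  rw [lune, Finset.sum_comm]
  refine Finset.sum_congr rfl fun p _ => Finset.sum_congr rfl fun q _ => ?_
  rw [Function.update_comm hab, Function.update_comm hab]

theorem factor_aux (hodd : Odd N) {X w c : ℂ} (hX : X ^ N = 1) (hw : w ≠ 0) (k : ℤ)
    (hc : c ^ N = (w⁻¹ ^ (N - 1)) ^ N) : ((X ^ k * w ^ 2) ^ ((N - 1) / 2) * c) ^ N = 1 := by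
  have h1 : 2 * ((N - 1) / 2) = N - 1 := by obtain ⟨t, rfl⟩ := hodd; omega
  have h2 : (X ^ k) ^ N = 1 := by
    rw [← zpow_natCast, ← zpow_mul, mul_comm, zpow_mul, zpow_natCast, hX, one_zpow]
  rw [mul_pow, mul_pow, ← pow_mul w, h1, mul_pow, hc, ← pow_mul (X ^ k), mul_comm _ N, pow_mul (X ^ k), h2,
    one_pow, one_mul, ← mul_pow, ← mul_pow, mul_inv_cancel₀ hw, one_pow, one_pow]

/-- The contraction of the elementary tensors of two decorated tetrahedra of opposite signs. -/
def elementaryLune (N : ℕ) [NeZero N] (D D' : Decoration) (a b : Fin 4) (x y : Fin 4 → Fin N) : ℂ :=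
  lune N (fun σ => tensorPos N (fnPos N (D.root N 1 0) (D.root N 1 1)⁻¹)
      (σ 2 : ℕ) (σ 0 : ℕ) (σ 3 : ℕ) (σ 1 : ℕ))
    (fun σ => tensorNeg N (fnNeg N (D'.root N (-1) 0) (D'.root N (-1) 1)⁻¹)
      (σ 2 : ℕ) (σ 0 : ℕ) (σ 3 : ℕ) (σ 1 : ℕ)) a b x y

theorem lune_tensor_eq (hodd : Odd N) (D D' : Decoration) (a b : Fin 4) (x y : Fin 4 → Fin N) :
    lune N (D.tensor N 1) (D'.tensor N (-1)) a b x y =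
      D.factor N 1 * D'.factor N (-1) * elementaryLune N D D' a b x y := by
  simp only [lune, elementaryLune, Finset.mul_sum, D.tensor_one, D'.tensor_neg_one hodd]
  exact Finset.sum_congr rfl fun p _ => Finset.sum_congr rfl fun q _ => by ring

theorem exists_lune_zero (hodd : Odd N) (H : IsLocalBubble 1 0 D D') :
    ∃ c : ℂ, (D.factor N 1 * D'.factor N (-1) * c) ^ N = 1 ∧
      ∀ a b : Fin 4, a < b → edgeIndex a b = 0 → ∀ x y, elementaryLune N D D' a b x y =
        if ∀ f, f ≠ a → f ≠ b → x f = y f then c else 0 := by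
  obtain ⟨c, hc, h⟩ := (D.fermat hodd 1).fnPos_mul_fnNeg_shift
  have e0 : D'.root N (-1) 0 = D.root N 1 0 * ch N 1 := H.root_eq_shift
  have e1 : D'.root N (-1) 1 = D.root N 1 1 := H.root_eq_self (by decide)
  refine ⟨c, ?_, fun a b hab he x y => ?_⟩
  · have c0 : D'.c 0 = 2 - D.c 0 := by have := (H 0).2.2; simp at this; omega
    have c1 : D'.c 1 = - D.c 1 := by have := (H 1).2.2; simp at this; omega
    rw [Decoration.factor, Decoration.factor, e0, e1, c0, c1, ← mul_pow]
    have r0 := D.root_ne_zero (N := N) 1 0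
    have r1 := D.root_ne_zero (N := N) 1 1
    have hX := ch_ne_zero (1 : ZMod N)
    have hXN := ch_pow_card (1 : ZMod N)
    generalize D.root N 1 0 = u at *
    generalize D.root N 1 1 = w at *
    generalize ch N (1 : ZMod N) = X at *
    have : u ^ (-D.c 1) * w ^ D.c 0 * ((u * X) ^ (- -D.c 1) * w ^ (2 - D.c 0)) =
        X ^ D.c 1 * w ^ 2 := by
      rw [neg_neg, mul_zpow, zpow_neg, zpow_sub₀ r1]
      have := zpow_ne_zero (D.c 1) r0
      have := zpow_ne_zero (D.c 0) r1
      field_simp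
    rw [this]
    exact factor_aux hodd hXN r1 _ hc
  · rw [elementaryLune, e0, e1]
    fin_cases a <;> fin_cases b <;> simp [edgeIndex] at hab he
    · simp only [lune]
      have h1 := sum_tensor_01 h (x 2 : ℕ) (x 3 : ℕ) (y 2 : ℕ) (y 3 : ℕ)
      rw [← sum_fin] at h1
      simp only [← sum_fin] at h1
      simpa [Fin.forall_fin_succ, fin_cast_inj] using h1
    · simp only [lune]
      have h1 := sum_tensor_23 h (x 0 : ℕ) (x 1 : ℕ) (y 0 : ℕ) (y 1 : ℕ)
      rw [← sum_fin] at h1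
      simp only [← sum_fin] at h1
      simpa [Fin.forall_fin_succ, fin_cast_inj] using h1

theorem exists_lune_one (hodd : Odd N) (H : IsLocalBubble 1 1 D D') :
    ∃ c : ℂ, (D.factor N 1 * D'.factor N (-1) * c) ^ N = 1 ∧
      ∀ a b : Fin 4, a < b → edgeIndex a b = 1 → ∀ x y, elementaryLune N D D' a b x y =
        if ∀ f, f ≠ a → f ≠ b → x f = y f then c else 0 := by
  have h := (D.fermat hodd 1).sum_fnPos_mul_fnNeg_twist
  have e0 : D'.root N (-1) 0 = D.root N 1 0 := H.root_eq_self (by decide)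
  have e1 : D'.root N (-1) 1 = D.root N 1 1 * ch N 1 := H.root_eq_shift
  refine ⟨D.root N 1 0 ^ (N - 1), ?_, fun a b hab he x y => ?_⟩
  · have c0 : D'.c 0 = - D.c 0 := by have := (H 0).2.2; simp at this; omega
    have c1 : D'.c 1 = 2 - D.c 1 := by have := (H 1).2.2; simp at this; omega
    rw [Decoration.factor, Decoration.factor, e0, e1, c0, c1, ← mul_pow]
    have r0 := D.root_ne_zero (N := N) 1 0
    have r1 := D.root_ne_zero (N := N) 1 1
    have hX := ch_ne_zero (1 : ZMod N)
    have hXN := ch_pow_card (1 : ZMod N)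
    generalize D.root N 1 0 = u at *
    generalize D.root N 1 1 = w at *
    generalize ch N (1 : ZMod N) = X at *
    have : u ^ (-D.c 1) * w ^ D.c 0 * (u ^ (-(2 - D.c 1)) * (w * X) ^ (-D.c 0)) =
        X ^ (-D.c 0) * u⁻¹ ^ 2 := by
      rw [neg_sub, mul_zpow, zpow_neg, zpow_neg, zpow_sub₀ r0]
      have := zpow_ne_zero (D.c 1) r0
      have := zpow_ne_zero (D.c 0) r1
      field_simp
    rw [this]
    exact factor_aux hodd hXN (inv_ne_zero r0) _ (by rw [inv_inv])
  · rw [elementaryLune, e0, e1, mul_inv, ← ch_neg]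
    fin_cases a <;> fin_cases b <;> simp [edgeIndex] at hab he
    · simp only [lune]
      have h1 := sum_tensor_03 h (x 2 : ℕ) (x 1 : ℕ) (y 2 : ℕ) (y 1 : ℕ)
      rw [← sum_fin] at h1
      simp only [← sum_fin] at h1
      rw [if_congr and_comm rfl rfl] at h1
      simpa [Fin.forall_fin_succ, fin_cast_inj] using h1
    · simp only [lune]
      have h1 := sum_tensor_12 h (x 0 : ℕ) (x 3 : ℕ) (y 0 : ℕ) (y 3 : ℕ)
      rw [Finset.sum_comm, ← sum_fin] at h1
      simp only [← sum_fin] at h1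
      simpa [Fin.forall_fin_succ, fin_cast_inj] using h1

theorem exists_lune_two (hodd : Odd N) (H : IsLocalBubble 1 2 D D') :
    ∃ c : ℂ, (D.factor N 1 * D'.factor N (-1) * c) ^ N = 1 ∧
      ∀ a b : Fin 4, a < b → edgeIndex a b = 2 → ∀ x y, elementaryLune N D D' a b x y =
        if ∀ f, f ≠ a → f ≠ b → x f = y f then c else 0 := by
  have h := (D.fermat hodd 1).sum_fnPos_mul_fnNeg
  have e0 : D'.root N (-1) 0 = D.root N 1 0 := H.root_eq_self (by decide)
  have e1 : D'.root N (-1) 1 = D.root N 1 1 := H.root_eq_self (by decide)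
  refine ⟨1, ?_, fun a b hab he x y => ?_⟩
  · have c0 : D'.c 0 = - D.c 0 := by have := (H 0).2.2; simp at this; omega
    have c1 : D'.c 1 = - D.c 1 := by have := (H 1).2.2; simp at this; omega
    rw [Decoration.factor, Decoration.factor, e0, e1, c0, c1, ← mul_pow, mul_mul_mul_comm,
      ← zpow_add₀ (D.root_ne_zero 1 0), ← zpow_add₀ (D.root_ne_zero 1 1)]
    simp
  · rw [elementaryLune, e0, e1]
    fin_cases a <;> fin_cases b <;> simp [edgeIndex] at hab he
    · simp only [lune]
      have h1 := sum_tensor_02 h (x 3 : ℕ) (x 1 : ℕ) (y 3 : ℕ) (y 1 : ℕ)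
      rw [Finset.sum_comm, ← sum_fin] at h1
      simp only [← sum_fin] at h1
      simpa [Fin.forall_fin_succ, fin_cast_inj, and_comm] using h1
    · simp only [lune]
      have h1 := sum_tensor_13 h (x 2 : ℕ) (x 0 : ℕ) (y 2 : ℕ) (y 0 : ℕ)
      rw [Finset.sum_comm, ← sum_fin] at h1
      simp only [← sum_fin] at h1
      rw [if_congr and_comm rfl rfl] at h1
      simpa [Fin.forall_fin_succ, fin_cast_inj] using h1

theorem exists_lune_pos (hodd : Odd N) (H : IsLocalBubble 1 e D D') :
    ∃ n : ℕ, ∀ a b : Fin 4, a < b → edgeIndex a b = e → ∀ x y,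
      lune N (D.tensor N 1) (D'.tensor N (-1)) a b x y =
        zeta N ^ n * if ∀ f, f ≠ a → f ≠ b → x f = y f then 1 else 0 := by
  obtain ⟨c, hc, h⟩ : ∃ c : ℂ, (D.factor N 1 * D'.factor N (-1) * c) ^ N = 1 ∧
      ∀ a b : Fin 4, a < b → edgeIndex a b = e → ∀ x y, elementaryLune N D D' a b x y =
        if ∀ f, f ≠ a → f ≠ b → x f = y f then c else 0 := by
    fin_cases e
    · exact exists_lune_zero hodd H
    · exact exists_lune_one hodd H
    · exact exists_lune_two hodd H
  obtain ⟨n, hn⟩ := exists_zeta_pow_of_pow_eq one_ne_zero (hc.trans (one_pow N).symm)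
  refine ⟨n, fun a b hab he x y => ?_⟩
  rw [lune_tensor_eq hodd, h a b hab he]
  split_ifs
  · rw [hn]
  · simp

/-- The tensors of two tetrahedra related as in a bubble are inverse to each other with respect to
the contraction along two faces whose common edge carries the charge `2`. -/
theorem exists_lune (hodd : Odd N) (H : IsLocalBubble s e D D') :
    ∃ n : ℕ, ∀ a b : Fin 4, a ≠ b → edgeIndex a b = e → ∀ x y,
      lune N (D.tensor N s) (D'.tensor N (-s)) a b x y =
        zeta N ^ n * if ∀ f, f ≠ a → f ≠ b → x f = y f then 1 else 0 := by
  have hlt : ∃ n : ℕ, ∀ a b : Fin 4, a < b → edgeIndex a b = e → ∀ x y,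
      lune N (D.tensor N s) (D'.tensor N (-s)) a b x y =
        zeta N ^ n * if ∀ f, f ≠ a → f ≠ b → x f = y f then 1 else 0 := by
    rcases Int.units_eq_one_or s with rfl | rfl
    · exact exists_lune_pos hodd H
    · obtain ⟨n, hn⟩ := exists_lune_pos hodd H.symm
      refine ⟨n, fun a b hab he x y => ?_⟩
      have := hn a b hab he y x
      simp only [lune, eq_comm (a := y _)] at this
      rw [lune, neg_neg, ← this]
      exact Finset.sum_congr rfl fun p _ => Finset.sum_congr rfl fun q _ => mul_comm _ _
  obtain ⟨n, hn⟩ := hlt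
  refine ⟨n, fun a b hab he x y => ?_⟩
  rcases lt_or_gt_of_ne hab with h | h
  · exact hn a b h he x y
  · have h2 : ∀ a b : Fin 4, edgeIndex b a = edgeIndex a b := by decide
    rw [lune_comm _ _ hab, hn b a h ((h2 a b).trans he)]
    simp only [imp.swap]

end Lune

/-! ### The bubble relation -/

theorem sum_functions_fin_four {X : Type*} [Fintype X] [DecidableEq X] {k p q r : Fin 4}
    (hkp : k ≠ p) (hkq : k ≠ q) (hkr : k ≠ r) (hpq : p ≠ q) (hpr : p ≠ r) (hqr : q ≠ r) (α : X)
    (F : (Fin 4 → X) → ℂ) :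
    ∑ σ : Fin 4 → X with σ k = α, F σ = ∑ z, ∑ x, ∑ y,
      F (Function.update (Function.update (Function.update (fun _ => α) r z) p x) q y) := by
  have hall : ∀ f : Fin 4, f = k ∨ f = p ∨ f = q ∨ f = r := by
    revert k p q r; decide
  simp only [← Fintype.sum_prod_type']
  symm
  refine Finset.sum_bij' (fun t _ => Function.update (Function.update
    (Function.update (fun _ => α) r t.1) p t.2.1) q t.2.2) (fun σ _ => (σ r, σ p, σ q)) ?_ ?_ ?_ ?_ ?_
  · intro t _
    simp [hkp, hkq, hkr]
  · simp
  · intro t _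
    simp [hpq, hpr.symm, hqr.symm]
  · intro σ hσ
    have hk : σ k = α := (Finset.mem_filter.1 hσ).2
    funext f
    rcases hall f with rfl | rfl | rfl | rfl
    · simp [hkp, hkq, hkr, hk]
    · simp [hpq]
    · simp
    · simp [hpr.symm, hqr.symm]
  · simp

theorem exists_bubbleContraction_eq {N : ℕ} [NeZero N] (hodd : Odd N) {s : ℤˣ} {e : Fin 3}
    {D D' : Decoration} (H : IsLocalBubble s e D D') (k : Fin 4) :
    ∃ n : ℕ, ∀ α β : Fin N, bubbleContraction N s k D D' α β =
      zeta N ^ n * ((N : ℂ) * if α = β then 1 else 0) := by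
  obtain ⟨n, hn⟩ := exists_lune hodd H
  refine ⟨n, fun α β => ?_⟩
  obtain ⟨p, q, r, hkp, hkq, hkr, hpq, hpr, hqr, he⟩ : ∃ p q r : Fin 4, k ≠ p ∧ k ≠ q ∧ k ≠ r ∧
      p ≠ q ∧ p ≠ r ∧ q ≠ r ∧ edgeIndex p q = e := by
    clear hn H
    revert k e
    decide
  rw [bubbleContraction, sum_functions_fin_four hkp hkq hkr hpq hpr hqr]
  have h1 : ∀ z : Fin N, ∑ x, ∑ y, D.tensor N s (Function.update (Function.update
      (Function.update (fun _ => α) r z) p x) q y) * D'.tensor N (-s)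
        (Function.update (Function.update (Function.update
          (Function.update (fun _ => α) r z) p x) q y) k β) =
      zeta N ^ n * if α = β then 1 else 0 := by
    intro z
    have h2 := hn p q hpq he (Function.update (fun _ => α) r z)
      (Function.update (Function.update (fun _ => α) r z) k β)
    have h3 : (∀ f, f ≠ p → f ≠ q → Function.update (fun _ => α) r z f =
        Function.update (Function.update (fun _ => α) r z) k β f) ↔ α = β := by
      constructor
      · intro h
        have := h k hkp hkq
        simpa [hkr] using this
      · rintro rfl f _ _
        by_cases hf : f = k
        · subst hf; simp [hkr]
        · simp [hf]
    simp only [h3] at h2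
    rw [← h2, lune]
    refine Finset.sum_congr rfl fun x _ => Finset.sum_congr rfl fun y _ => ?_
    rw [Function.update_comm hkq.symm, Function.update_comm hkp.symm]
  rw [Finset.sum_congr rfl fun z _ => h1 z, Finset.sum_const, Finset.card_univ, Fintype.card_fin,
    nsmul_eq_mul]
  ring

/-! ### Contractions of the tetrahedra with five vertices -/

section Local

variable {X : Type*} [Fintype X] [DecidableEq X]

theorem sum_agree_insert {Z : Type*} [Fintype Z] [DecidableEq Z] (S : Finset Z) (z₀ : Z)
    (h0 : z₀ ∉ S) (τ : Z → X) (F : (Z → X) → ℂ) :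
    ∑ σ : Z → X with ∀ z, z ∉ insert z₀ S → σ z = τ z, F σ =
      ∑ x, ∑ σ : Z → X with ∀ z, z ∉ S → σ z = Function.update τ z₀ x z, F σ := by
  rw [Finset.sum_sigma']
  symm
  refine Finset.sum_bij' (fun t _ => t.2) (fun σ _ => ⟨σ z₀, σ⟩) ?_ ?_ ?_ ?_ ?_
  · rintro ⟨x, σ⟩ h
    simp only [Finset.mem_sigma, Finset.mem_filter, Finset.mem_univ, true_and] at h ⊢
    intro z hz
    simp only [Finset.mem_insert, not_or] at hz
    rw [h z hz.2, Function.update_of_ne hz.1]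
  · intro σ h
    simp only [Finset.mem_sigma, Finset.mem_filter, Finset.mem_univ, true_and] at h ⊢
    intro z hz
    by_cases hz0 : z = z₀
    · subst hz0; simp
    · rw [Function.update_of_ne hz0, h z (by simp [hz0, hz])]
  · rintro ⟨x, σ⟩ h
    simp only [Finset.mem_sigma, Finset.mem_filter, Finset.mem_univ, true_and] at h
    have := h z₀ h0
    simp only [Function.update_self] at this
    subst this
    rfl
  · intro σ _
    rfl
  · intro _ _
    rfl

theorem sum_agree_empty {Z : Type*} [Fintype Z] [DecidableEq Z] (τ : Z → X) (F : (Z → X) → ℂ) :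
    ∑ σ : Z → X with ∀ z, z ∉ (∅ : Finset Z) → σ z = τ z, F σ = F τ := by
  have : (Finset.univ.filter fun σ : Z → X => ∀ z, z ∉ (∅ : Finset Z) → σ z = τ z) = {τ} := by
    ext σ
    simp [funext_iff]
  rw [this, Finset.sum_singleton]

/-- The tensor of `Δ^i` as a function of the labels of all triangles. -/
def cell (N : ℕ) (D : Decoration) (ε : ℤˣ) (i : Fin 5) (σ : Sym2 (Fin 5) → Fin N) : ℂ :=
  D.tensor N ε fun a => σ s(i, i.succAbove a)

variable {N : ℕ} [NeZero N]

theorem cell_update {N : ℕ} {D : Decoration} {ε : ℤˣ} {i : Fin 5} {z : Sym2 (Fin 5)} (hz : i ∉ z)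
    (σ : Sym2 (Fin 5) → Fin N) (x : Fin N) :
    cell N D ε i (Function.update σ z x) = cell N D ε i σ := by
  rw [cell, cell]
  congr 1
  funext a
  rw [Function.update_of_ne]
  rintro rfl
  exact hz (Sym2.mem_mk_left _ _)

theorem localContraction_pair {N : ℕ} (D : Fin 5 → Decoration) (ε : Fin 5 → ℤˣ) {p q : Fin 5}
    (hpq : p ≠ q) (τ : Sym2 (Fin 5) → Fin N) :
    localContraction N D ε {p, q} τ =
      ∑ x, cell N (D p) (ε p) p (Function.update τ s(p, q) x) *
        cell N (D q) (ε q) q (Function.update τ s(p, q) x) := by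
  have h1 : ∀ z : Sym2 (Fin 5), (z.IsDiag ∨ ∃ i ∈ z, i ∉ ({p, q} : Finset (Fin 5))) ↔
      z ∉ insert s(p, q) (∅ : Finset (Sym2 (Fin 5))) := by
    revert p q; decide
  rw [localContraction]
  simp only [h1]
  have := sum_agree_insert ∅ s(p, q) (Finset.notMem_empty _) τ
    fun σ => cell N (D p) (ε p) p σ * cell N (D q) (ε q) q σ
  simp only [sum_agree_empty] at this
  rw [← this]
  refine Finset.sum_congr (by congr) fun σ _ => ?_
  rw [Finset.prod_pair hpq]
  rfl

theorem localContraction_triple {N : ℕ} (D : Fin 5 → Decoration) (ε : Fin 5 → ℤˣ) {p q r : Fin 5}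
    (hpq : p ≠ q) (hpr : p ≠ r) (hqr : q ≠ r) (τ : Sym2 (Fin 5) → Fin N) :
    localContraction N D ε {p, q, r} τ = ∑ x, ∑ y, ∑ z,
      cell N (D p) (ε p) p (Function.update (Function.update (Function.update τ s(p, r) x) s(q, r) y) s(p, q) z) *
      cell N (D q) (ε q) q (Function.update (Function.update (Function.update τ s(p, r) x) s(q, r) y) s(p, q) z) *
      cell N (D r) (ε r) r (Function.update (Function.update (Function.update τ s(p, r) x) s(q, r) y) s(p, q) z) := by
  have h1 : ∀ z : Sym2 (Fin 5), (z.IsDiag ∨ ∃ i ∈ z, i ∉ ({p, q, r} : Finset (Fin 5))) ↔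
      z ∉ insert s(p, r) (insert s(q, r) (insert s(p, q) (∅ : Finset (Sym2 (Fin 5))))) := by
    revert p q r; decide
  rw [localContraction]
  simp only [h1]
  let F : (Sym2 (Fin 5) → Fin N) → ℂ := fun σ =>
    cell N (D p) (ε p) p σ * cell N (D q) (ε q) q σ * cell N (D r) (ε r) r σ
  have h3 : s(p, r) ∉ insert s(q, r) (insert s(p, q) (∅ : Finset (Sym2 (Fin 5)))) := by
    simp [hpq, hpr, hpr.symm, hqr.symm]
  have h4 : s(q, r) ∉ insert s(p, q) (∅ : Finset (Sym2 (Fin 5))) := by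
    simp [hpq.symm, hpr.symm, hqr.symm]
  have := sum_agree_insert _ s(p, r) h3 τ F
  simp only [sum_agree_insert _ s(q, r) h4, sum_agree_insert _ s(p, q) (Finset.notMem_empty _),
    sum_agree_empty] at this
  rw [← this]
  refine Finset.sum_congr (by congr) fun σ _ => ?_
  rw [Finset.prod_insert (by simp [hpq, hpr]), Finset.prod_pair hqr, ← mul_assoc]
  rfl

theorem pos_succAbove (i : Fin 5) (a : Fin 4) : pos i (i.succAbove a) = a := by
  revert i a; decide

theorem succAbove_pos {i a : Fin 5} (h : a ≠ i) : i.succAbove (pos i a) = a := by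
  revert i a; decide

theorem cell_update_update {N : ℕ} {D : Decoration} {ε : ℤˣ} {p q r : Fin 5} (hpr : p ≠ r) (hqr : q ≠ r)
    (σ : Sym2 (Fin 5) → Fin N) (x y : Fin N) :
    cell N D ε r (Function.update (Function.update σ s(p, r) x) s(q, r) y) =
      D.tensor N ε (Function.update (Function.update (fun a => σ s(r, r.succAbove a)) (pos r p) x)
        (pos r q) y) := by
  have h : ∀ (σ : Sym2 (Fin 5) → Fin N) {p : Fin 5} (_ : p ≠ r) (x : Fin N),
      (fun a => Function.update σ s(p, r) x s(r, r.succAbove a)) =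
        Function.update (fun a => σ s(r, r.succAbove a)) (pos r p) x := by
    intro σ p hp x
    funext a
    by_cases ha : a = pos r p
    · subst ha
      rw [succAbove_pos hp, Sym2.eq_swap, Function.update_self, Function.update_self]
    · rw [Function.update_of_ne ha, Function.update_of_ne]
      intro h
      rw [Sym2.eq_swap, Sym2.congr_left] at h
      exact ha (by rw [← h, pos_succAbove])
  rw [cell, h _ hqr, h _ hpr]

end Local

/-! ### Moving a tetrahedron to the other side of a `2 ↔ 3` transit -/

section Move

/-- The decoration with the same cross ratios and flattening, and the charge `2δ_e - c`. -/
def Decoration.dual (D : Decoration) (e : Fin 3) : Decoration where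
  w := D.w
  f := D.f
  c k := (if k = e then 2 else 0) - D.c k
  w_ne_zero := D.w_ne_zero
  w_ne_one := D.w_ne_one
  w_succ := D.w_succ
  flattening := D.flattening
  charge := by
    rw [Finset.sum_sub_distrib, D.charge, Finset.sum_ite_eq' Finset.univ e]
    simp

theorem Decoration.dual_l (D : Decoration) (e k : Fin 3) : (D.dual e).l k = D.l k := rfl

theorem Decoration.isLocalBubble_dual (D : Decoration) (s : ℤˣ) (e : Fin 3) :
    IsLocalBubble s e D (D.dual e) := by
  intro k
  refine ⟨?_, ?_, ?_⟩
  · change D.w k ^ (s : ℤ) * D.w k ^ ((-s : ℤˣ) : ℤ) = 1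
    rw [Units.val_neg, zpow_neg, mul_inv_cancel₀ (zpow_ne_zero _ (D.w_ne_zero k))]
  · rw [D.dual_l]
    push_cast
    ring
  · exact add_sub_cancel _ _

theorem Decoration.sum_l (D : Decoration) : ∑ k, D.l k = 0 := D.flattening

theorem Decoration.prod_w (D : Decoration) : ∏ k, D.w k = -1 := by
  have h0 : D.w 1 * (1 - D.w 0) = 1 := D.w_succ 0
  have h1 : D.w 2 * (1 - D.w 1) = 1 := D.w_succ 1
  have h2 := D.w_ne_zero 1
  rw [Fin.prod_univ_three]
  have : 1 - D.w 1 ≠ 0 := sub_ne_zero.2 (D.w_ne_one 1).symm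
  have h3 : D.w 2 = 1 / (1 - D.w 1) := by field_simp; exact h1
  rw [h3]
  field_simp
  linear_combination -h0

variable {p p' q q' r : Fin 5}

/-- Distinctness of five vertices. -/
def Distinct (p p' q q' r : Fin 5) : Prop :=
  p ≠ p' ∧ p ≠ q ∧ p ≠ q' ∧ p ≠ r ∧ p' ≠ q ∧ p' ≠ q' ∧ p' ≠ r ∧ q ≠ q' ∧ q ≠ r ∧ q' ≠ r

@[to_additive]
theorem prod_star {M : Type*} [CommMonoid M] (F : Fin 5 → Fin 3 → M) (A : Finset (Fin 5))
    (q : Fin 5) :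
    ∏ b ∈ Finset.univ \ {q}, ∏ i ∈ A \ {q, b}, F i (edgeIndex (pos i q) (pos i b)) =
      ∏ i ∈ A \ {q}, ∏ k, F i k := by
  rw [Finset.prod_comm' (t' := A \ {q}) (s' := fun i => Finset.univ \ {q, i})]
  · refine Finset.prod_congr rfl fun i hi => ?_
    have hiq : i ≠ q := by simpa using (Finset.mem_sdiff.1 hi).2
    have h : ∀ i q : Fin 5, i ≠ q → Finset.univ = (Finset.univ \ {q, i}).image
        (fun b => edgeIndex (pos i q) (pos i b)) ∧ ∀ b ∈ Finset.univ \ {q, i},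
        ∀ b' ∈ Finset.univ \ {q, i}, edgeIndex (pos i q) (pos i b) =
          edgeIndex (pos i q) (pos i b') → b = b' := by decide
    obtain ⟨h1, h2⟩ := h i q hiq
    rw [h1, Finset.prod_image h2]
  · intro b i
    simp only [Finset.mem_sdiff, Finset.mem_univ, true_and, Finset.mem_singleton, Finset.mem_insert,
      not_or]
    constructor
    · rintro ⟨h1, h2, h3, h4⟩
      exact ⟨⟨h1, fun h => h4 h.symm⟩, h2, h3⟩
    · rintro ⟨⟨h1, h2⟩, h3, h4⟩
      exact ⟨h1, h3, h4, fun h => h2 h.symm⟩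

@[to_additive]
theorem prod_star_split {M : Type*} [CommMonoid M] (F : Fin 5 → Fin 3 → M) {A : Finset (Fin 5)}
    {q q' : Fin 5} (hqq : q ≠ q') (hq : q ∉ A)
    (h : ∀ b, b ≠ q → b ≠ q' → ∏ i ∈ {q, q'} \ {q, b}, F i (edgeIndex (pos i q) (pos i b)) =
      ∏ i ∈ A \ {q, b}, F i (edgeIndex (pos i q) (pos i b))) :
    (∏ i ∈ A \ {q, q'}, F i (edgeIndex (pos i q) (pos i q'))) * ∏ k, F q' k =
      ∏ i ∈ A, ∏ k, F i k := by
  have h1 := prod_star F A q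
  have h2 := prod_star F {q, q'} q
  have h3 : ∀ q q' : Fin 5, q ≠ q' → Finset.univ \ {q} = insert q' (Finset.univ \ {q, q'}) ∧
      ({q, q'} : Finset (Fin 5)) \ {q} = {q'} := by decide
  obtain ⟨h3, h4⟩ := h3 q q' hqq
  rw [h3, Finset.prod_insert (by simp)] at h1 h2
  rw [Finset.sdiff_self, Finset.prod_empty, one_mul, h4, Finset.prod_singleton] at h2
  have h5 : A \ {q} = A := by rw [Finset.sdiff_singleton_eq_erase, Finset.erase_eq_of_notMem hq]
  rw [h5] at h1
  rw [← h1, ← h2]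
  congr 1
  refine Finset.prod_congr rfl fun b hb => ?_
  simp only [Finset.mem_sdiff, Finset.mem_univ, true_and, Finset.mem_singleton, Finset.mem_insert,
    not_or] at hb
  exact h b hb.1 hb.2

theorem neg_one_zpow_units (ε : ℤˣ) : (-1 : ℂ) ^ (ε : ℤ) = -1 := by
  rcases Int.units_eq_one_or ε with rfl | rfl
  · simp
  · rw [Units.val_neg, Units.val_one, zpow_neg_one]; norm_num

variable {s : ℤˣ} {D : Fin 5 → Decoration}

theorem Distinct.compl (h : Distinct p p' q q' r) : ({q, q'} : Finset (Fin 5))ᶜ = {p, p', r} := by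
  unfold Distinct at h
  revert p p' q q' r
  decide

theorem Distinct.compl' (h : Distinct p p' q q' r) : ({p, p'} : Finset (Fin 5))ᶜ = {q, q', r} := by
  unfold Distinct at h
  revert p p' q q' r
  decide

theorem pair_ne {a b c d : Fin 5} (h : ¬ (a = c ∧ b = d)) (h' : ¬ (a = d ∧ b = c)) :
    ({a, b} : Finset (Fin 5)) ≠ {c, d} := by
  revert a b c d
  decide

/-- The total cross ratio, log-branch and charge at the interior edge of the three tetrahedra side
of a `2 ↔ 3` transit. -/
theorem IsLocalMP.interior (hd : Distinct p p' q q' r) (H : IsLocalMP {q, q'} s D) :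
    localW D (localSign {q, q'} s) {p, p', r} q q' = 1 ∧
    localL D (localSign {q, q'} s) {p, p', r} q q' = 0 ∧
    localC D {p, p', r} q q' = 2 := by
  have hc := hd.compl
  obtain ⟨hpp, hpq, hpq', hpr, hpq2, hpq2', hpr', hqq, hqr, hqr'⟩ := hd
  have hA : q ∉ ({p, p', r} : Finset (Fin 5)) := by
    simp [hpq.symm, hpq2.symm, hqr]
  have h : ∀ b, b ≠ q → b ≠ q' → _ := fun b hb hb' => H.2 q b hb.symm
    (pair_ne (fun h => hb' h.2) (fun h => hqq h.1))
  rw [hc] at h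
  have hcard : ∀ {M : Type} [CommMonoid M] (f : Fin 5 → M),
      ∏ i ∈ ({p, p', r} : Finset (Fin 5)), f i = f p * (f p' * f r) := fun f => by
    rw [Finset.prod_insert (by simp [hpp, hpr]), Finset.prod_pair hpr']
  have hcard' : ∀ {M : Type} [AddCommMonoid M] (f : Fin 5 → M),
      ∑ i ∈ ({p, p', r} : Finset (Fin 5)), f i = f p + (f p' + f r) := fun f => by
    rw [Finset.sum_insert (by simp [hpp, hpr]), Finset.sum_pair hpr']
  refine ⟨?_, ?_, ?_⟩
  · have h1 := prod_star_split (fun i k => (D i).w k ^ ((localSign {q, q'} s i : ℤˣ) : ℤ)) hqq hA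
      fun b hb hb' => (h b hb hb').1
    simp only [Finset.prod_zpow, Decoration.prod_w, neg_one_zpow_units] at h1
    rw [hcard] at h1
    rw [localW]
    linear_combination -h1
  · have h1 := sum_star_split (fun i k => (((localSign {q, q'} s i : ℤˣ) : ℤ) : ℂ) * (D i).l k) hqq hA
      fun b hb hb' => (h b hb hb').2.1
    simp only [← Finset.mul_sum, Decoration.sum_l, mul_zero, add_zero, Finset.sum_const_zero] at h1
    exact h1
  · have h1 := sum_star_split (fun i k => (D i).c k) hqq hA
      fun b hb hb' => (h b hb hb').2.2
    simp only [Decoration.charge] at h1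
    rw [hcard'] at h1
    rw [localC]
    omega

theorem edgeIndex_opposite (hd : Distinct p p' q q' r) :
    edgeIndex (pos r p) (pos r p') = edgeIndex (pos r q) (pos r q') := by
  unfold Distinct at hd
  revert p p' q q' r
  decide

theorem edgeIndex_ne (hd : Distinct p p' q q' r) {a b : Fin 5} (hab : a ≠ b) (ha : a ≠ r)
    (hb : b ≠ r) (h1 : ({a, b} : Finset (Fin 5)) ≠ {p, p'}) (h2 : ({a, b} : Finset (Fin 5)) ≠ {q, q'}) :
    edgeIndex (pos r a) (pos r b) ≠ edgeIndex (pos r q) (pos r q') := by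
  intro h
  have h3 : ∀ r a b c d : Fin 5, a ≠ b → c ≠ d → a ≠ r → b ≠ r → c ≠ r → d ≠ r →
      edgeIndex (pos r a) (pos r b) = edgeIndex (pos r c) (pos r d) →
      (a = c ∧ b = d) ∨ (a = d ∧ b = c) ∨ (a ≠ c ∧ a ≠ d ∧ b ≠ c ∧ b ≠ d) := by decide
  have h4 : ∀ i, i = p ∨ i = p' ∨ i = q ∨ i = q' ∨ i = r := by
    unfold Distinct at hd
    clear h h1 h2 hab ha hb
    revert p p' q q' r
    decide
  obtain ⟨hpp, hpq, hpq', hpr, hpq2, hpq2', hpr', hqq, hqr, hqr'⟩ := hd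
  rcases h3 r a b q q' hab hqq ha hb hqr hqr' h with ⟨rfl, rfl⟩ | ⟨rfl, rfl⟩ | ⟨n1, n2, n3, n4⟩
  · exact h2 rfl
  · exact h2 (Finset.pair_comm _ _)
  · rcases h4 a with rfl | rfl | rfl | rfl | rfl <;> rcases h4 b with rfl | rfl | rfl | rfl | rfl
    all_goals first
      | exact h1 rfl
      | exact h1 (Finset.pair_comm _ _)
      | exact absurd rfl hab
      | exact absurd rfl n1
      | exact absurd rfl n2
      | exact absurd rfl n3
      | exact absurd rfl n4
      | exact absurd rfl ha
      | exact absurd rfl hb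

theorem localSign_move (hd : Distinct p p' q q' r) (i : Fin 5) :
    localSign {p, p'} s i = if i = r then -localSign {q, q'} (-s) i else localSign {q, q'} (-s) i := by
  unfold localSign
  have h : i = p ∨ i = p' ∨ i = q ∨ i = q' ∨ i = r := by
    unfold Distinct at hd
    revert p p' q q' r i
    decide
  obtain ⟨hpp, hpq, hpq', hpr, hpq2, hpq2', hpr', hqq, hqr, hqr'⟩ := hd
  rcases h with rfl | rfl | rfl | rfl | rfl <;>
    simp [*, Ne.symm, hpp.symm, hpq.symm, hpq'.symm, hpr.symm, hpq2.symm, hpq2'.symm, hpr'.symm,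
      hqq.symm, hqr.symm, hqr'.symm]

theorem IsLocalMP.move (hd : Distinct p p' q q' r) (H : IsLocalMP {q, q'} (-s) D) :
    IsLocalMP {p, p'} s
      (Function.update D r ((D r).dual (edgeIndex (pos r q) (pos r q')))) := by
  have hint := H.interior hd
  have hint' : localW D (localSign {q, q'} (-s)) {p, p', r} q' q = 1 ∧
      localL D (localSign {q, q'} (-s)) {p, p', r} q' q = 0 ∧ localC D {p, p', r} q' q = 2 := by
    have hd' : Distinct p p' q' q r := by
      obtain ⟨hpp, hpq, hpq', hpr, hpq2, hpq2', hpr', hqq, hqr, hqr'⟩ := hd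
      exact ⟨hpp, hpq', hpq, hpr, hpq2', hpq2, hpr', hqq.symm, hqr', hqr⟩
    rw [Finset.pair_comm] at H ⊢
    exact H.interior hd'
  have hc := hd.compl
  have hc' := hd.compl'
  have hsgn := localSign_move (s := s) hd
  have hne := @edgeIndex_ne _ _ _ _ _ hd
  obtain ⟨hpp, hpq, hpq', hpr, hpq2, hpq2', hpr', hqq, hqr, hqr'⟩ := hd
  set ε := localSign {q, q'} (-s)
  set ε' := localSign {p, p'} s
  have hε : ∀ i, i ≠ r → ε' i = ε i := fun i hi => by rw [hsgn, if_neg hi]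
  have hεr : ε' r = -ε r := by rw [hsgn, if_pos rfl]
  set D' := Function.update D r ((D r).dual (edgeIndex (pos r q) (pos r q')))
  have hD : ∀ i, i ≠ r → D' i = D i := fun i hi => Function.update_of_ne hi _ _
  have hDr : D' r = (D r).dual (edgeIndex (pos r q) (pos r q')) := Function.update_self _ _ _
  refine ⟨Finset.card_pair hpp, fun a b hab hP => ?_⟩
  rw [hc']
  have eP : ∀ i ∈ ({p, p'} : Finset (Fin 5)) \ {a, b}, i ≠ r := by
    intro i hi
    simp only [Finset.mem_sdiff, Finset.mem_insert, Finset.mem_singleton] at hi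
    rcases hi.1 with rfl | rfl <;> assumption
  have eQ : ∀ i ∈ ({q, q'} : Finset (Fin 5)) \ {a, b}, i ≠ r := by
    intro i hi
    simp only [Finset.mem_sdiff, Finset.mem_insert, Finset.mem_singleton] at hi
    rcases hi.1 with rfl | rfl <;> assumption
  have wP : localW D' ε' {p, p'} a b = localW D ε {p, p'} a b :=
    Finset.prod_congr rfl fun i hi => by rw [hε i (eP i hi), hD i (eP i hi)]
  have wQ : localW D' ε' {q, q'} a b = localW D ε {q, q'} a b :=
    Finset.prod_congr rfl fun i hi => by rw [hε i (eQ i hi), hD i (eQ i hi)]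
  have lP : localL D' ε' {p, p'} a b = localL D ε {p, p'} a b :=
    Finset.sum_congr rfl fun i hi => by rw [hε i (eP i hi), hD i (eP i hi)]
  have lQ : localL D' ε' {q, q'} a b = localL D ε {q, q'} a b :=
    Finset.sum_congr rfl fun i hi => by rw [hε i (eQ i hi), hD i (eQ i hi)]
  have cP : localC D' {p, p'} a b = localC D {p, p'} a b :=
    Finset.sum_congr rfl fun i hi => by rw [hD i (eP i hi)]
  have cQ : localC D' {q, q'} a b = localC D {q, q'} a b :=
    Finset.sum_congr rfl fun i hi => by rw [hD i (eQ i hi)]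
  rw [wP, lP, cP]
  by_cases hr : r = a ∨ r = b
  · have e1 : ∀ c d : Fin 5, ({c, d, r} : Finset (Fin 5)) \ {a, b} = {c, d} \ {a, b} := by
      intro c d
      ext i
      simp only [Finset.mem_sdiff, Finset.mem_insert, Finset.mem_singleton]
      constructor
      · rintro ⟨h1 | h1 | h1, h2⟩
        · exact ⟨Or.inl h1, h2⟩
        · exact ⟨Or.inr h1, h2⟩
        · subst h1; exact absurd hr h2
      · rintro ⟨h1 | h1, h2⟩
        · exact ⟨Or.inl h1, h2⟩
        · exact ⟨Or.inr (Or.inl h1), h2⟩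
    have hQ : ({a, b} : Finset (Fin 5)) ≠ {q, q'} := by
      intro h
      have : r ∈ ({a, b} : Finset (Fin 5)) := by simpa using hr
      rw [h] at this
      simp [hqr.symm, hqr'.symm] at this
    have h := H.2 a b hab hQ
    rw [hc] at h
    simp only [localW, localL, localC, e1] at h wQ lQ cQ ⊢
    rw [wQ, lQ, cQ]
    exact ⟨h.1.symm, h.2.1.symm, h.2.2.symm⟩
  · have e1 : ∀ c d : Fin 5, ({c, d, r} : Finset (Fin 5)) \ {a, b} = insert r ({c, d} \ {a, b}) := by
      intro c d
      ext i
      simp only [Finset.mem_sdiff, Finset.mem_insert, Finset.mem_singleton]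
      constructor
      · rintro ⟨h1 | h1 | h1, h2⟩
        · exact Or.inr ⟨Or.inl h1, h2⟩
        · exact Or.inr ⟨Or.inr h1, h2⟩
        · exact Or.inl h1
      · rintro (h1 | ⟨h1 | h1, h2⟩)
        · subst h1; exact ⟨Or.inr (Or.inr rfl), hr⟩
        · exact ⟨Or.inl h1, h2⟩
        · exact ⟨Or.inr (Or.inl h1), h2⟩
    have nP : r ∉ ({p, p'} : Finset (Fin 5)) \ {a, b} := fun h => eP r h rfl
    have nQ : r ∉ ({q, q'} : Finset (Fin 5)) \ {a, b} := fun h => eQ r h rfl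
    have wQ' : localW D' ε' {q, q', r} a b * (D r).w (edgeIndex (pos r a) (pos r b)) ^ (ε r : ℤ) =
        localW D ε {q, q'} a b := by
      rw [← wQ, localW, e1, Finset.prod_insert nQ, hDr, hεr, mul_right_comm]
      change (D r).w _ ^ ((-ε r : ℤˣ) : ℤ) * (D r).w _ ^ (ε r : ℤ) * _ = _
      rw [Units.val_neg, zpow_neg, inv_mul_cancel₀ (zpow_ne_zero _ ((D r).w_ne_zero _)), one_mul]
      rfl
    have lQ' : localL D' ε' {q, q', r} a b + ((ε r : ℤ) : ℂ) * (D r).l (edgeIndex (pos r a) (pos r b)) =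
        localL D ε {q, q'} a b := by
      rw [← lQ, localL, e1, Finset.sum_insert nQ, hDr, hεr, Decoration.dual_l, localL]
      push_cast
      ring
    have cQ' : localC D' {q, q', r} a b = localC D {q, q'} a b +
        ((if edgeIndex (pos r a) (pos r b) = edgeIndex (pos r q) (pos r q') then 2 else 0) -
          (D r).c (edgeIndex (pos r a) (pos r b))) := by
      rw [← cQ, localC, e1, Finset.sum_insert nQ, hDr, add_comm]
      rfl
    have wP' : localW D ε {p, p', r} a b =
        (D r).w (edgeIndex (pos r a) (pos r b)) ^ (ε r : ℤ) * localW D ε {p, p'} a b := by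
      rw [localW, e1, Finset.prod_insert nP]
      rfl
    have lP' : localL D ε {p, p', r} a b =
        ((ε r : ℤ) : ℂ) * (D r).l (edgeIndex (pos r a) (pos r b)) + localL D ε {p, p'} a b := by
      rw [localL, e1, Finset.sum_insert nP]
      rfl
    have cP' : localC D {p, p', r} a b =
        (D r).c (edgeIndex (pos r a) (pos r b)) + localC D {p, p'} a b := by
      rw [localC, e1, Finset.sum_insert nP]
      rfl
    have hw := zpow_ne_zero (ε r : ℤ) ((D r).w_ne_zero (edgeIndex (pos r a) (pos r b)))
    have key : localW D ε {q, q'} a b = localW D ε {p, p', r} a b ∧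
        localL D ε {q, q'} a b = localL D ε {p, p', r} a b ∧
        localC D {q, q'} a b + (if edgeIndex (pos r a) (pos r b) =
          edgeIndex (pos r q) (pos r q') then 2 else 0) = localC D {p, p', r} a b := by
      by_cases hQ : ({a, b} : Finset (Fin 5)) = {q, q'}
      · have hE : localW D ε {q, q'} a b = 1 ∧ localL D ε {q, q'} a b = 0 ∧
            localC D {q, q'} a b = 0 := by
          simp only [localW, localL, localC, hQ, Finset.sdiff_self, Finset.prod_empty,
            Finset.sum_empty, and_self]
        have hI : edgeIndex (pos r a) (pos r b) = edgeIndex (pos r q) (pos r q') ∧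
            localW D ε {p, p', r} a b = 1 ∧ localL D ε {p, p', r} a b = 0 ∧
            localC D {p, p', r} a b = 2 := by
          have hab' : (a = q ∧ b = q') ∨ (a = q' ∧ b = q) := by
            by_contra hcon
            rw [not_or] at hcon
            exact pair_ne hcon.1 hcon.2 hQ
          rcases hab' with ⟨rfl, rfl⟩ | ⟨rfl, rfl⟩
          · exact ⟨rfl, hint⟩
          · refine ⟨?_, hint'⟩
            have : ∀ x y : Fin 4, edgeIndex x y = edgeIndex y x := by decide
            exact this _ _
        rw [hE.1, hE.2.1, hE.2.2, hI.2.1, hI.2.2.1, hI.2.2.2, if_pos hI.1]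
        simp
      · have h := H.2 a b hab hQ
        rw [hc] at h
        rw [if_neg (hne hab (fun h => hr (Or.inl h.symm)) (fun h => hr (Or.inr h.symm)) hP hQ), add_zero]
        exact h
    obtain ⟨k1, k2, k3⟩ := key
    refine ⟨?_, ?_, ?_⟩
    · apply mul_right_cancel₀ hw
      rw [wQ', k1, wP', mul_comm]
    · linear_combination -lP' - k2 - lQ'
    · omega

end Move

section Transit

variable {N : ℕ} [NeZero N]

/-! ### The basic `2 ↔ 3` transit -/

theorem sum_tensorPos_pair (P₁ P₃ : ZMod N → ℂ) (x01 x03 x12 x14 x23 x34 : ZMod N) :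
    ∑ x, tensorPos N P₁ x x01 x14 x12 * tensorPos N P₃ x23 x03 x34 x =
      ch N (x14 * x01 + ((N - 1) / 2 + 1 : ℕ) * x14 ^ 2 +
        (x34 * x03 + ((N - 1) / 2 + 1 : ℕ) * x34 ^ 2)) *
        (P₁ (x23 + x03 - x14) * P₃ (x23 - x34)) * if x23 + x03 + x01 = x12 then 1 else 0 := by
  rw [Finset.sum_eq_single (x23 + x03)]
  · simp only [tensorPos, if_true, AddChar.map_add_eq_mul]
    ring
  · intro x _ hx
    simp [tensorPos, hx.symm]
  · simp

theorem sum_tensorPos_triple (hodd : Odd N) (P₀ P₂ P₄ : ZMod N → ℂ)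
    (x01 x03 x12 x14 x23 x34 : ZMod N) :
    ∑ x04, ∑ x24, ∑ x02, tensorPos N P₀ x03 x01 x04 x02 * tensorPos N P₂ x23 x02 x24 x12 *
        tensorPos N P₄ x24 x04 x34 x14 =
      ch N (x14 * x01 + ((N - 1) / 2 + 1 : ℕ) * x14 ^ 2 +
        (x34 * x03 + ((N - 1) / 2 + 1 : ℕ) * x34 ^ 2)) *
        (∑ s, P₀ (x23 + x03 - x14 - s) * P₂ s * P₄ (x23 - x34 - s) *
          ch N ((x23 + x03 - x14 - s) * (x23 - x34 - s))) *
        if x23 + x03 + x01 = x12 then 1 else 0 := by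
  have hη : 2 * (((N - 1) / 2 + 1 : ℕ) : ZMod N) = 1 := by
    have h : 2 * ((N - 1) / 2 + 1) = N + 1 := by obtain ⟨t, rfl⟩ := hodd; omega
    have h2 := congrArg (fun n : ℕ => (n : ZMod N)) h
    push_cast at h2 ⊢
    rw [h2]
    simp
  let F : ZMod N → ℂ := fun s => P₀ (x23 + x03 - x14 - s) * P₂ s * P₄ (x23 - x34 - s) *
    ch N ((x23 + x03 - x14 - s) * (x23 - x34 - s))
  have hF : ∑ t, F (t + (x23 - x14)) = ∑ s, F s := Equiv.sum_comp (Equiv.addRight (x23 - x14)) F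
  change _ = _ * (∑ s, F s) * _
  rw [← hF, Finset.mul_sum, Finset.sum_mul]
  refine Finset.sum_congr rfl fun t _ => ?_
  rw [Finset.sum_eq_single (x14 - t)]
  · rw [Finset.sum_eq_single (x03 + x01)]
    · simp only [tensorPos, F, if_true, sub_add_cancel, ← add_assoc]
      split_ifs with h
      · generalize (((N - 1) / 2 + 1 : ℕ) : ZMod N) = η at hη
        have e1 : x23 + x03 - x14 - (t + x23 - x14) = x03 - t := by ring
        have e2 : x23 - x34 - (t + x23 - x14) = x14 - t - x34 := by ring
        have e3 : t + x23 - x14 = x23 - (x14 - t) := by ring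
        rw [← add_sub_assoc, e1, e2, e3]
        have e4 : ch N (t * x01 + η * t ^ 2) * ch N ((x14 - t) * (x03 + x01) + η * (x14 - t) ^ 2) *
            ch N (x34 * t + η * x34 ^ 2) = ch N (x14 * x01 + η * x14 ^ 2 + x34 * x03 + η * x34 ^ 2) *
            ch N ((x03 - t) * (x14 - t - x34)) := by
          simp only [← AddChar.map_add_eq_mul]
          congr 1
          linear_combination (t ^ 2 - x14 * t) * hη
        linear_combination (P₀ (x03 - t) * P₂ (x23 - (x14 - t)) * P₄ (x14 - t - x34)) * e4
      · simp
    · intro x _ hx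
      simp [tensorPos, hx.symm]
    · simp
  · intro x _ hx
    have : x + t ≠ x14 := fun h => hx (by rw [← h]; ring)
    simp [tensorPos, this]
  · simp

/-! ### Relations between the roots -/

theorem Decoration.root_one_eq (D : Decoration) (k : Fin 3) :
    D.root N 1 k = D.w k * exp (D.l k * (1 / N - 1)) *
      exp (-(I * Real.pi * (N + 1) / N) * D.c k) := by
  have hN : (N : ℂ) ≠ 0 := NeZero.ne _
  have h1 : exp (I * D.f k * Real.pi) = exp (-(I * D.f k * Real.pi)) := by
    have := Complex.exp_int_mul_two_pi_mul_I (D.f k)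
    rw [exp_neg]
    apply eq_inv_of_mul_eq_one_left
    rw [← exp_add, ← this]
    congr 1
    ring
  have h2 : D.w k = exp (log (D.w k)) := (exp_log (D.w_ne_zero k)).symm
  have h3 : exp (log (D.w k)) * exp (D.l k * (1 / N - 1)) =
      exp (D.l k / N) * exp (-(I * D.f k * Real.pi)) := by
    rw [← exp_add, ← exp_add, Decoration.l]
    congr 1
    ring
  nth_rw 1 [h2]
  rw [h3, ← h1, ← exp_add, ← exp_add, Decoration.root, Decoration.l]
  congr 1
  push_cast
  field_simp
  ring

theorem prod_root {D : Fin 5 → Decoration} {ε : Fin 5 → ℤˣ} (hε : ∀ i, ε i = 1)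
    (A : Finset (Fin 5)) (a b : Fin 5) :
    ∏ i ∈ A \ {a, b}, (D i).root N 1 (edgeIndex (pos i a) (pos i b)) =
      localW D ε A a b * exp (localL D ε A a b * (1 / N - 1)) *
        exp (-(I * Real.pi * (N + 1) / N) * localC D A a b) := by
  simp only [localW, localL, localC, hε, Decoration.root_one_eq, Finset.prod_mul_distrib,
    Units.val_one, zpow_one, Int.cast_one, one_mul, Finset.sum_mul, Complex.exp_sum, Int.cast_sum,
    Finset.mul_sum]

theorem localSign_base (i : Fin 5) : localSign {1, 3} (-1) i = 1 := by
  revert i; decide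

theorem IsLocalMP.prod_root {D : Fin 5 → Decoration} (H : IsLocalMP {1, 3} (-1) D) {a b : Fin 5}
    (hab : a ≠ b) (h : ({a, b} : Finset (Fin 5)) ≠ {1, 3}) :
    ∏ i ∈ {1, 3} \ {a, b}, (D i).root N 1 (edgeIndex (pos i a) (pos i b)) =
      ∏ i ∈ {0, 2, 4} \ {a, b}, (D i).root N 1 (edgeIndex (pos i a) (pos i b)) := by
  obtain ⟨h1, h2, h3⟩ := H.2 a b hab h
  have hc : ({1, 3} : Finset (Fin 5))ᶜ = {0, 2, 4} := by decide
  rw [hc] at h1 h2 h3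
  rw [QH.prod_root localSign_base, QH.prod_root localSign_base, h1, h2, h3]

theorem IsLocalMP.root_relations {D : Fin 5 → Decoration} (H : IsLocalMP {1, 3} (-1) D) :
    (D 3).root N 1 0 = (D 2).root N 1 0 * (D 4).root N 1 0 ∧
    (D 1).root N 1 0 = (D 0).root N 1 0 * (D 2).root N 1 0 ∧
    (D 1).root N 1 1 = (D 0).root N 1 1 * (D 4).root N 1 0 ∧
    (D 3).root N 1 1 = (D 0).root N 1 0 * (D 4).root N 1 1 ∧
    (D 1).root N 1 1 * (D 3).root N 1 1 = (D 2).root N 1 1 := by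
  have e : ∀ {A : Finset (Fin 5)} {a b : Fin 5} (B : Finset (Fin 5)), A \ {a, b} = B →
    ∏ i ∈ A \ {a, b}, (D i).root N 1 (edgeIndex (pos i a) (pos i b)) =
      ∏ i ∈ B, (D i).root N 1 (edgeIndex (pos i a) (pos i b)) := by
    rintro A a b B rfl; rfl
  refine ⟨?_, ?_, ?_, ?_, ?_⟩
  · have h := H.prod_root (N := N) (a := 0) (b := 1) (by decide) (by decide)
    rw [e {3} (by decide), e {2, 4} (by decide), Finset.prod_singleton,
      Finset.prod_pair (by decide)] at h
    exact h
  · have h := H.prod_root (N := N) (a := 3) (b := 4) (by decide) (by decide)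
    rw [e {1} (by decide), e {0, 2} (by decide), Finset.prod_singleton,
      Finset.prod_pair (by decide)] at h
    exact h
  · have h := H.prod_root (N := N) (a := 2) (b := 3) (by decide) (by decide)
    rw [e {1} (by decide), e {0, 4} (by decide), Finset.prod_singleton,
      Finset.prod_pair (by decide)] at h
    exact h
  · have h := H.prod_root (N := N) (a := 1) (b := 2) (by decide) (by decide)
    rw [e {3} (by decide), e {0, 4} (by decide), Finset.prod_singleton,
      Finset.prod_pair (by decide)] at h
    exact h
  · have h := H.prod_root (N := N) (a := 0) (b := 4) (by decide) (by decide)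
    rw [e {1, 3} (by decide), e {2} (by decide), Finset.prod_singleton,
      Finset.prod_pair (by decide)] at h
    exact h

theorem IsLocalMP.charge_relations {D : Fin 5 → Decoration} (H : IsLocalMP {1, 3} (-1) D) :
    (D 3).c 0 = (D 2).c 0 + (D 4).c 0 ∧
    (D 1).c 0 = (D 0).c 0 + (D 2).c 0 ∧
    (D 1).c 1 = (D 0).c 1 + (D 4).c 0 ∧
    (D 3).c 1 = (D 0).c 0 + (D 4).c 1 ∧
    (D 1).c 1 + (D 3).c 1 = (D 2).c 1 := by
  have e : ∀ {A : Finset (Fin 5)} {a b : Fin 5} (B : Finset (Fin 5)), A \ {a, b} = B →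
    localC D A a b = ∑ i ∈ B, (D i).c (edgeIndex (pos i a) (pos i b)) := by
    rintro A a b B rfl; rfl
  refine ⟨?_, ?_, ?_, ?_, ?_⟩
  · have h := (H.2 0 1 (by decide) (by decide)).2.2
    rw [e {3} (by decide), e {2, 4} (by decide), Finset.sum_singleton,
      Finset.sum_pair (by decide)] at h
    exact h
  · have h := (H.2 3 4 (by decide) (by decide)).2.2
    rw [e {1} (by decide), e {0, 2} (by decide), Finset.sum_singleton,
      Finset.sum_pair (by decide)] at h
    exact h
  · have h := (H.2 2 3 (by decide) (by decide)).2.2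
    rw [e {1} (by decide), e {0, 4} (by decide), Finset.sum_singleton,
      Finset.sum_pair (by decide)] at h
    exact h
  · have h := (H.2 1 2 (by decide) (by decide)).2.2
    rw [e {3} (by decide), e {0, 4} (by decide), Finset.sum_singleton,
      Finset.sum_pair (by decide)] at h
    exact h
  · have h := (H.2 0 4 (by decide) (by decide)).2.2
    rw [e {1, 3} (by decide), e {2} (by decide), Finset.sum_singleton,
      Finset.sum_pair (by decide)] at h
    exact h

theorem IsLocalMP.fiveTerm {D : Fin 5 → Decoration} (H : IsLocalMP {1, 3} (-1) D) :
    FiveTerm (fun i => (D i).root N 1 0) (fun i => ((D i).root N 1 1)⁻¹) := by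
  obtain ⟨h1, h2, h3, h4, h5⟩ := H.root_relations (N := N)
  have n : ∀ i k, (D i).root N 1 k ≠ 0 := fun i k => (D i).root_ne_zero 1 k
  refine ⟨?_, ?_, ?_, h2, ?_⟩
  · have := n 0 1; have := n 4 0
    simp only [h3]; field_simp
  · have := n 4 1; have := n 0 0
    simp only [h4]; field_simp
  · simp only [← h5, mul_inv]
  · simp only [h1, mul_comm]

theorem IsLocalMP.factor_eq {D : Fin 5 → Decoration} (H : IsLocalMP {1, 3} (-1) D) :
    (D 1).factor N 1 * (D 3).factor N 1 =
      (D 0).factor N 1 * (D 2).factor N 1 * (D 4).factor N 1 := by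
  obtain ⟨h1, h2, h3, h4, h5⟩ := H.root_relations (N := N)
  obtain ⟨k1, k2, k3, k4, k5⟩ := H.charge_relations
  have n : ∀ i k, (D i).root N 1 k ≠ 0 := fun i k => (D i).root_ne_zero 1 k
  have n00 := n 0 0
  have n01 := n 0 1
  have n20 := n 2 0
  have n40 := n 4 0
  have n41 := n 4 1
  simp only [Decoration.factor, ← mul_pow]
  congr 1
  rw [← h5, ← k5, h1, h2, h3, h4, k1, k2, k3, k4]
  generalize (D 0).root N 1 0 = A0 at *
  generalize (D 0).root N 1 1 = B0 at *
  generalize (D 2).root N 1 0 = A2 at *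
  generalize (D 4).root N 1 0 = A4 at *
  generalize (D 4).root N 1 1 = B4 at *
  simp only [mul_zpow, zpow_neg, zpow_add₀ n00, zpow_add₀ n01, zpow_add₀ n20, zpow_add₀ n40,
    zpow_add₀ n41]
  have z : ∀ {a : ℂ} (_ : a ≠ 0) (k : ℤ), a ^ k ≠ 0 := fun h k => zpow_ne_zero k h
  have := z n00 ((D 0).c 1)
  have := z n00 ((D 0).c 0)
  field_simp

/-- The `2 ↔ 3` transits with `P` and `s` given satisfy the five term relation. -/
def Claim (N : ℕ) (P : Finset (Fin 5)) (s : ℤˣ) : Prop :=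
  ∀ D : Fin 5 → Decoration, IsLocalMP P s D → ∃ n : ℕ, ∀ τ : Sym2 (Fin 5) → Fin N,
    localContraction N D (localSign P s) P τ =
      zeta N ^ n * localContraction N D (localSign P s) Pᶜ τ

theorem cell_one (D : Decoration) (i : Fin 5) (σ : Sym2 (Fin 5) → Fin N) :
    cell N D 1 i σ = D.factor N 1 * tensorPos N (fnPos N (D.root N 1 0) (D.root N 1 1)⁻¹)
      (σ s(i, i.succAbove 2) : ℕ) (σ s(i, i.succAbove 0) : ℕ) (σ s(i, i.succAbove 3) : ℕ)
      (σ s(i, i.succAbove 1) : ℕ) := by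
  rw [cell, D.tensor_one]

theorem claim_base (hodd : Odd N) : Claim N {1, 3} (-1) := by
  intro D H
  have hf := H.fiveTerm (N := N)
  have hF : ∀ i, Fermat N ((D i).root N 1 0) ((D i).root N 1 1)⁻¹ := fun i => (D i).fermat hodd 1
  have hK := fiveSum_zero_pow hF hf
  have hS := fiveSum_eq hF hf
  have hne : ∀ i, h N ((D i).root N 1 0) ≠ 0 := fun i => (hF i).h_ne_zero
  have hfac := H.factor_eq (N := N)
  beta_reduce at hK hS
  set K := fiveSum N ((D 0).root N 1 0) ((D 0).root N 1 1)⁻¹ ((D 2).root N 1 0)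
    ((D 2).root N 1 1)⁻¹ ((D 4).root N 1 0) ((D 4).root N 1 1)⁻¹ 0 0 with hKdef
  have hK0 : K * (h N ((D 0).root N 1 0) * h N ((D 2).root N 1 0) * h N ((D 4).root N 1 0)) ≠ 0 := by
    intro h0
    rw [h0, zero_pow (NeZero.ne N)] at hK
    exact pow_ne_zero N (mul_ne_zero (hne 1) (hne 3)) hK.symm
  obtain ⟨n, hn⟩ := exists_zeta_pow_of_pow_eq hK0 hK.symm
  refine ⟨n, fun τ => ?_⟩
  have hc : ({1, 3} : Finset (Fin 5))ᶜ = {0, 2, 4} := by decide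
  rw [hc, localContraction_pair _ _ (by decide),
    localContraction_triple _ _ (by decide) (by decide) (by decide)]
  simp only [localSign_base, cell_one]
  simp +decide only [Function.update_apply, if_true, if_false]
  rw [show s((1 : Fin 5), (1 : Fin 5).succAbove 0) = s(0, 1) by decide,
    show s((1 : Fin 5), (1 : Fin 5).succAbove 3) = s(1, 4) by decide,
    show s((1 : Fin 5), (1 : Fin 5).succAbove 1) = s(1, 2) by decide,
    show s((3 : Fin 5), (3 : Fin 5).succAbove 2) = s(2, 3) by decide,
    show s((3 : Fin 5), (3 : Fin 5).succAbove 0) = s(0, 3) by decide,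
    show s((3 : Fin 5), (3 : Fin 5).succAbove 3) = s(3, 4) by decide,
    show s((0 : Fin 5), (0 : Fin 5).succAbove 2) = s(0, 3) by decide,
    show s((0 : Fin 5), (0 : Fin 5).succAbove 0) = s(0, 1) by decide,
    show s((2 : Fin 5), (2 : Fin 5).succAbove 2) = s(2, 3) by decide,
    show s((2 : Fin 5), (2 : Fin 5).succAbove 1) = s(1, 2) by decide,
    show s((4 : Fin 5), (4 : Fin 5).succAbove 3) = s(3, 4) by decide,
    show s((4 : Fin 5), (4 : Fin 5).succAbove 1) = s(1, 4) by decide]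
  have p1 := sum_tensorPos_pair (fnPos N ((D 1).root N 1 0) ((D 1).root N 1 1)⁻¹)
    (fnPos N ((D 3).root N 1 0) ((D 3).root N 1 1)⁻¹) (τ s(0, 1) : ℕ) (τ s(0, 3) : ℕ)
    (τ s(1, 2) : ℕ) (τ s(1, 4) : ℕ) (τ s(2, 3) : ℕ) (τ s(3, 4) : ℕ)
  have p2 := sum_tensorPos_triple hodd (fnPos N ((D 0).root N 1 0) ((D 0).root N 1 1)⁻¹)
    (fnPos N ((D 2).root N 1 0) ((D 2).root N 1 1)⁻¹)
    (fnPos N ((D 4).root N 1 0) ((D 4).root N 1 1)⁻¹) (τ s(0, 1) : ℕ) (τ s(0, 3) : ℕ)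
    (τ s(1, 2) : ℕ) (τ s(1, 4) : ℕ) (τ s(2, 3) : ℕ) (τ s(3, 4) : ℕ)
  have p3 : ∀ x y : ZMod N, ∑ s, fnPos N ((D 0).root N 1 0) ((D 0).root N 1 1)⁻¹ (x - s) *
      fnPos N ((D 2).root N 1 0) ((D 2).root N 1 1)⁻¹ s *
      fnPos N ((D 4).root N 1 0) ((D 4).root N 1 1)⁻¹ (y - s) * ch N ((x - s) * (y - s)) =
      h N ((D 0).root N 1 0) * h N ((D 2).root N 1 0) * h N ((D 4).root N 1 0) *
        (K * (cyc N ((D 1).root N 1 0) ((D 1).root N 1 1)⁻¹ x *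
          cyc N ((D 3).root N 1 0) ((D 3).root N 1 1)⁻¹ y)) := by
    intro x y
    rw [← hS, fiveSum, Finset.mul_sum]
    refine Finset.sum_congr rfl fun s _ => ?_
    simp only [fnPos]
    ring
  rw [p3] at p2
  simp only [← sum_fin] at p1 p2
  have q1 : ∀ T T' : Fin N → ℂ, ∑ x, (D 1).factor N 1 * T x * ((D 3).factor N 1 * T' x) =
      (D 1).factor N 1 * (D 3).factor N 1 * ∑ x, T x * T' x := by
    intro T T'
    rw [Finset.mul_sum]
    exact Finset.sum_congr rfl fun x _ => by ring
  have q2 : ∀ T T' T'' : Fin N → Fin N → Fin N → ℂ, ∑ x, ∑ y, ∑ z, (D 0).factor N 1 * T x y z *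
      ((D 2).factor N 1 * T' x y z) * ((D 4).factor N 1 * T'' x y z) =
      (D 0).factor N 1 * (D 2).factor N 1 * (D 4).factor N 1 *
        ∑ x, ∑ y, ∑ z, T x y z * T' x y z * T'' x y z := by
    intro T T' T''
    simp only [Finset.mul_sum]
    exact Finset.sum_congr rfl fun x _ => Finset.sum_congr rfl fun y _ =>
      Finset.sum_congr rfl fun z _ => by ring
  rw [q1, q2 (fun x y z => _) (fun x y z => _) (fun x y z => _), p1, p2, hfac]
  simp only [fnPos]
  rw [mul_mul_mul_comm (h N _), hn]
  ring

/-! ### All `2 ↔ 3` transits -/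

theorem exists_inverse_zeta_pow (n : ℕ) : ∃ n' : ℕ, zeta N ^ n' * zeta N ^ n = 1 := by
  refine ⟨n * (N - 1), ?_⟩
  rw [← pow_add, show n * (N - 1) + n = N * n by
    obtain ⟨M, hM⟩ : ∃ M, N = M + 1 := ⟨N - 1, by have := NeZero.pos N; omega⟩
    rw [hM, Nat.add_sub_cancel]; ring, pow_mul, isPrimitiveRoot_zeta.pow_eq_one, one_pow]

theorem Distinct.eq_or {p p' q q' r : Fin 5} (hd : Distinct p p' q q' r) (i : Fin 5) :
    i = p ∨ i = p' ∨ i = q ∨ i = q' ∨ i = r := by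
  unfold Distinct at hd
  revert p p' q q' r i
  decide

theorem cell_lune (hodd : Odd N) {p p' q q' r : Fin 5} (hd : Distinct p p' q q' r) (D : Decoration)
    (ε : ℤˣ) : ∃ n : ℕ, ∀ σ σ' : Sym2 (Fin 5) → Fin N,
      ∑ x, ∑ y, cell N D ε r (Function.update (Function.update σ s(p, r) x) s(p', r) y) *
        cell N (D.dual (edgeIndex (pos r q) (pos r q'))) (-ε) r
          (Function.update (Function.update σ' s(p, r) x) s(p', r) y) =
        zeta N ^ n * if σ s(q, r) = σ' s(q, r) ∧ σ s(q', r) = σ' s(q', r) then 1 else 0 := by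
  obtain ⟨n, hn⟩ := exists_lune hodd
    (D.isLocalBubble_dual ε (edgeIndex (pos r q) (pos r q')))
  refine ⟨n, fun σ σ' => ?_⟩
  have h1 : ∀ f, f ≠ pos r p → f ≠ pos r p' → f = pos r q ∨ f = pos r q' := by
    intro f f1 f2
    rw [← pos_succAbove r f] at f1 f2 ⊢
    rcases hd.eq_or (r.succAbove f) with h | h | h | h | h
    · exact absurd (congrArg (pos r) h) f1
    · exact absurd (congrArg (pos r) h) f2
    · exact Or.inl (congrArg (pos r) h)
    · exact Or.inr (congrArg (pos r) h)
    · exact absurd h (Fin.succAbove_ne r f)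
  have he := edgeIndex_opposite hd
  obtain ⟨hpp, hpq, hpq', hpr, hpq2, hpq2', hpr', hqq, hqr, hqr'⟩ := hd
  have h2 : ∀ {a b : Fin 5}, a ≠ r → b ≠ r → a ≠ b → pos r a ≠ pos r b := by
    intro a b ha hb hab h
    apply hab
    rw [← succAbove_pos ha, h, succAbove_pos hb]
  have h3 := hn (pos r p) (pos r p') (h2 hpr hpr' hpp) he (fun a => σ s(r, r.succAbove a))
    (fun a => σ' s(r, r.succAbove a))
  have h4 : (∀ f, f ≠ pos r p → f ≠ pos r p' → σ s(r, r.succAbove f) = σ' s(r, r.succAbove f)) ↔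
      σ s(q, r) = σ' s(q, r) ∧ σ s(q', r) = σ' s(q', r) := by
    rw [Sym2.eq_swap (a := q), Sym2.eq_swap (a := q')]
    constructor
    · intro h
      have a1 := h (pos r q) (h2 hqr hpr hpq.symm) (h2 hqr hpr' hpq2.symm)
      have a2 := h (pos r q') (h2 hqr' hpr hpq'.symm) (h2 hqr' hpr' hpq2'.symm)
      rw [succAbove_pos hqr] at a1
      rw [succAbove_pos hqr'] at a2
      exact ⟨a1, a2⟩
    · rintro ⟨a1, a2⟩ f f1 f2
      rcases h1 f f1 f2 with rfl | rfl
      · rw [succAbove_pos hqr]; exact a1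
      · rw [succAbove_pos hqr']; exact a2
  simp only [h4] at h3
  rw [← h3, lune]
  refine Finset.sum_congr rfl fun x _ => Finset.sum_congr rfl fun y _ => ?_
  rw [cell_update_update hpr hpr', cell_update_update hpr hpr']

theorem sum_rotate {X : Type*} [Fintype X] (G : X → X → X → ℂ) :
    ∑ x, ∑ y, ∑ a, G x y a = ∑ a, ∑ x, ∑ y, G x y a :=
  (Finset.sum_congr rfl fun _ _ => Finset.sum_comm).trans Finset.sum_comm

theorem Claim.move (hodd : Odd N) {p p' q q' r : Fin 5} (hd : Distinct p p' q q' r) {s : ℤˣ}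
    (h : Claim N {p, p'} s) : Claim N {q, q'} (-s) := by
  intro D H
  obtain ⟨n, hn⟩ := h _ (H.move hd)
  obtain ⟨n', hn'⟩ := cell_lune hodd hd (D r) (localSign {q, q'} (-s) r)
  obtain ⟨k, hk⟩ := exists_inverse_zeta_pow (N := N) (n + n')
  have hc := hd.compl
  have hc' := hd.compl'
  have hsgn := localSign_move (s := s) hd
  obtain ⟨hpp, hpq, hpq', hpr, hpq2, hpq2', hpr', hqq, hqr, hqr'⟩ := hd
  refine ⟨k, fun τ => ?_⟩
  rw [hc'] at hn
  rw [hc]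
  set ε := localSign {q, q'} (-s)
  set ε' := localSign {p, p'} s
  have hε : ∀ i, i ≠ r → ε' i = ε i := fun i hi => by rw [hsgn, if_neg hi]
  have hεr : ε' r = -ε r := by rw [hsgn, if_pos rfl]
  set D' := Function.update D r ((D r).dual (edgeIndex (pos r q) (pos r q')))
  have hD : ∀ i, i ≠ r → D' i = D i := fun i hi => Function.update_of_ne hi _ _
  have hDr : D' r = (D r).dual (edgeIndex (pos r q) (pos r q')) := Function.update_self _ _ _
  have main : localContraction N D ε {p, p', r} τ =
      zeta N ^ (n + n') * localContraction N D ε {q, q'} τ := by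
    have e1 : localContraction N D ε {p, p', r} τ = ∑ x, ∑ y,
        cell N (D r) (ε r) r (Function.update (Function.update τ s(p, r) x) s(p', r) y) *
          localContraction N D' ε' {p, p'}
            (Function.update (Function.update τ s(p, r) x) s(p', r) y) := by
      rw [localContraction_triple _ _ hpp hpr hpr']
      refine Finset.sum_congr rfl fun x _ => Finset.sum_congr rfl fun y _ => ?_
      rw [localContraction_pair _ _ hpp, Finset.mul_sum, hε p hpr, hε p' hpr', hD p hpr, hD p' hpr']
      refine Finset.sum_congr rfl fun z _ => ?_
      rw [cell_update (i := r) (by simp [hpr.symm, hpr'.symm])]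
      ring
    let υ : Fin N → Fin N → Fin N → Sym2 (Fin 5) → Fin N := fun a b w =>
      Function.update (Function.update (Function.update τ s(q, r) a) s(q', r) b) s(q, q') w
    have e2 : ∀ x y, localContraction N D' ε' {q, q', r}
        (Function.update (Function.update τ s(p, r) x) s(p', r) y) = ∑ a, ∑ b, ∑ w,
          cell N (D q) (ε q) q (υ a b w) * cell N (D q') (ε q') q' (υ a b w) *
          cell N ((D r).dual (edgeIndex (pos r q) (pos r q'))) (-ε r) r
            (Function.update (Function.update (υ a b w) s(p, r) x) s(p', r) y) := by
      intro x y
      rw [localContraction_triple _ _ hqq hqr hqr']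
      refine Finset.sum_congr rfl fun a _ => Finset.sum_congr rfl fun b _ =>
        Finset.sum_congr rfl fun w _ => ?_
      have e3 : Function.update (Function.update (Function.update
          (Function.update (Function.update τ s(p, r) x) s(p', r) y) s(q, r) a) s(q', r) b) s(q, q') w =
          Function.update (Function.update (υ a b w) s(p, r) x) s(p', r) y := by
        have d1 : s(p, r) ≠ s(q, r) := by simp [hpq, hpr]
        have d2 : s(p, r) ≠ s(q', r) := by simp [hpq', hpr]
        have d3 : s(p, r) ≠ s(q, q') := by simp [hpq, hpq']
        have d4 : s(p', r) ≠ s(q, r) := by simp [hpq2, hpr']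
        have d5 : s(p', r) ≠ s(q', r) := by simp [hpq2', hpr']
        have d6 : s(p', r) ≠ s(q, q') := by simp [hpq2, hpq2']
        simp only [υ]
        rw [Function.update_comm d4, Function.update_comm d1, Function.update_comm d5,
          Function.update_comm d2, Function.update_comm d6, Function.update_comm d3]
      rw [e3, hε q hqr, hε q' hqr', hεr, hD q hqr, hD q' hqr', hDr,
        cell_update (i := q) (by simp [hpq2.symm, hqr]),
        cell_update (i := q) (by simp [hpq.symm, hqr]),
        cell_update (i := q') (by simp [hpq2'.symm, hqr']),
        cell_update (i := q') (by simp [hpq'.symm, hqr'])]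
    rw [e1]
    simp only [hn, e2, Finset.mul_sum]
    rw [(sum_rotate _).trans (Finset.sum_congr rfl fun a _ => (sum_rotate _).trans
      (Finset.sum_congr rfl fun b _ => sum_rotate _))]
    have e4 : ∀ a b w, ∑ x, ∑ y,
        cell N (D r) (ε r) r (Function.update (Function.update τ s(p, r) x) s(p', r) y) *
        (zeta N ^ n * (cell N (D q) (ε q) q (υ a b w) * cell N (D q') (ε q') q' (υ a b w) *
          cell N ((D r).dual (edgeIndex (pos r q) (pos r q'))) (-ε r) r
            (Function.update (Function.update (υ a b w) s(p, r) x) s(p', r) y))) =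
        if τ s(q, r) = a ∧ τ s(q', r) = b then zeta N ^ (n + n') *
          (cell N (D q) (ε q) q (υ a b w) * cell N (D q') (ε q') q' (υ a b w)) else 0 := by
      intro a b w
      have e5 := hn' τ (υ a b w)
      have e6 : υ a b w s(q, r) = a := by
        simp only [υ]
        rw [Function.update_of_ne (by simp [hqq, hqr'.symm]),
          Function.update_of_ne (by simp [hqr, hqq]), Function.update_self]
      have e7 : υ a b w s(q', r) = b := by
        simp only [υ]
        rw [Function.update_of_ne (by simp [hqq.symm, hqr.symm]), Function.update_self]
      rw [e6, e7] at e5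
      have e8 : ∀ x y, cell N (D r) (ε r) r
          (Function.update (Function.update τ s(p, r) x) s(p', r) y) *
        (zeta N ^ n * (cell N (D q) (ε q) q (υ a b w) * cell N (D q') (ε q') q' (υ a b w) *
          cell N ((D r).dual (edgeIndex (pos r q) (pos r q'))) (-ε r) r
            (Function.update (Function.update (υ a b w) s(p, r) x) s(p', r) y))) =
          zeta N ^ n * (cell N (D q) (ε q) q (υ a b w) * cell N (D q') (ε q') q' (υ a b w)) *
            (cell N (D r) (ε r) r
          (Function.update (Function.update τ s(p, r) x) s(p', r) y) *
          cell N ((D r).dual (edgeIndex (pos r q) (pos r q'))) (-ε r) r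
            (Function.update (Function.update (υ a b w) s(p, r) x) s(p', r) y)) := by
        intro x y; ring
      simp only [e8, ← Finset.mul_sum]
      rw [e5, pow_add]
      split_ifs
      · ring
      · simp
    simp only [e4]
    rw [localContraction_pair _ _ hqq, Finset.mul_sum, Finset.sum_eq_single (τ s(q, r)),
      Finset.sum_eq_single (τ s(q', r))]
    · simp only [and_self, if_true]
      refine Finset.sum_congr rfl fun w _ => ?_
      simp only [υ, Function.update_eq_self]
    · intro b _ hb
      exact Finset.sum_eq_zero fun w _ => if_neg fun h => hb h.2.symm
    · simp
    · intro a _ ha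
      exact Finset.sum_eq_zero fun b _ => Finset.sum_eq_zero fun w _ => if_neg fun h => ha h.1.symm
    · simp
  rw [main, ← mul_assoc, hk, one_mul]

instance (p p' q q' r : Fin 5) : Decidable (Distinct p p' q q' r) := by
  unfold Distinct
  infer_instance

theorem Claim.exchange (hodd : Odd N) {a b c : Fin 5} (hab : a ≠ b) (hac : a ≠ c) (hbc : b ≠ c)
    {s : ℤˣ} (h : Claim N {a, b} s) : Claim N {a, c} s := by
  have hd : ∀ a b c : Fin 5, a ≠ b → a ≠ c → b ≠ c →
      ∃ q q', Distinct a b q q' c ∧ Distinct q q' a c b := by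
    decide
  obtain ⟨q, q', h1, h2⟩ := hd a b c hab hac hbc
  simpa using (h.move hodd h1).move hodd h2

theorem claim_pair (hodd : Odd N) {a b : Fin 5} (hab : a ≠ b) : Claim N {a, b} (-1) := by
  have hb := claim_base (N := N) hodd
  have h3 : ∀ c, c ≠ 1 → Claim N {1, c} (-1) := by
    intro c hc
    by_cases h : c = 3
    · rwa [h]
    · exact hb.exchange hodd (by decide) hc.symm (Ne.symm h)
  by_cases ha : a = 1
  · exact ha ▸ h3 b (ha ▸ hab.symm)
  · have h4 : Claim N {a, 1} (-1) := by
      rw [Finset.pair_comm]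
      exact h3 a ha
    by_cases h1 : b = 1
    · rwa [h1]
    · exact h4.exchange hodd ha hab (Ne.symm h1)

theorem claim_all (hodd : Odd N) (P : Finset (Fin 5)) (s : ℤˣ) (hP : P.card = 2) : Claim N P s := by
  obtain ⟨a, b, hab, rfl⟩ := Finset.card_eq_two.mp hP
  rcases Int.units_eq_one_or s with rfl | rfl
  · have hd : ∀ a b : Fin 5, a ≠ b → ∃ q q' r, Distinct q q' a b r := by decide
    obtain ⟨q, q', r, h⟩ := hd a b hab
    simpa using (claim_pair hodd h.1).move hodd h
  · exact claim_pair hodd hab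

end Transit

/-! ### Counting edges and vertices -/

instance {ι : Type} [Finite ι] (T : WeaklyBranched ι) : Finite T.OrEdge :=
  inferInstanceAs (Finite (Quot _))

instance {ι : Type} [Finite ι] (T : WeaklyBranched ι) : Finite T.Vertex :=
  inferInstanceAs (Finite (Quot _))

/-- The abstract edge of `i` from the vertex `a` to the vertex `b`. -/
def orAbsEdge {ι : Type} (i : ι) (a b : Fin 4) (hab : a ≠ b) : OrAbsEdge ι := ⟨(i, a, b), hab⟩

namespace WeaklyBranched

variable {ι : Type} (T : WeaklyBranched ι)

theorem GluedEdge.rev {T : WeaklyBranched ι} {E E' : OrAbsEdge ι} (h : T.GluedEdge E E') :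
    T.GluedEdge E.rev E'.rev := by
  obtain ⟨x, k, k', h1, h2⟩ := h
  exact ⟨x, k', k, by simp [OrAbsEdge.rev, h1], by simp [OrAbsEdge.rev, h2]⟩

theorem orEdgeOf_eq {E E' : OrAbsEdge ι} (h : T.GluedEdge E E') : T.orEdgeOf E = T.orEdgeOf E' :=
  Quot.sound h

theorem edgeOf_eq_of_orEdgeOf_eq {E E' : OrAbsEdge ι} (h : T.orEdgeOf E = T.orEdgeOf E') :
    T.edgeOf E = T.edgeOf E' :=
  congrArg (Quot.map id fun _ _ h => Or.inl h : T.OrEdge → T.Edge) h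

theorem edgeOf_rev (E : OrAbsEdge ι) : T.edgeOf E.rev = T.edgeOf E :=
  (Quot.sound (r := fun E E' => T.GluedEdge E E' ∨ E' = E.rev) (Or.inr rfl)).symm

theorem edgeOf_eq_iff {E E' : OrAbsEdge ι} : T.edgeOf E = T.edgeOf E' ↔
    T.orEdgeOf E = T.orEdgeOf E' ∨ T.orEdgeOf E = T.orEdgeOf E'.rev := by
  constructor
  · intro h
    have h2 : s(T.orEdgeOf E, T.orEdgeOf E.rev) = s(T.orEdgeOf E', T.orEdgeOf E'.rev) := by
      refine congrArg (Quot.lift (fun E => s(T.orEdgeOf E, T.orEdgeOf E.rev)) ?_ :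
        T.Edge → Sym2 T.OrEdge) h
      rintro E E' (h | rfl)
      · rw [T.orEdgeOf_eq h, T.orEdgeOf_eq h.rev]
      · exact Sym2.eq_swap
    rcases Sym2.eq_iff.mp h2 with h | h
    · exact Or.inl h.1
    · exact Or.inr h.1
  · rintro (h | h)
    · exact T.edgeOf_eq_of_orEdgeOf_eq h
    · rw [T.edgeOf_eq_of_orEdgeOf_eq h, T.edgeOf_rev]

theorem card_orEdge [Finite ι] (h : ∀ E : OrAbsEdge ι, T.orEdgeOf E.rev ≠ T.orEdgeOf E) :
    Nat.card T.OrEdge = 2 * T.numEdges := by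
  let f : T.Edge × Bool → T.OrEdge := fun p =>
    T.orEdgeOf (if p.2 then (Quot.out p.1) else (Quot.out p.1).rev)
  have hout : ∀ e : T.Edge, T.edgeOf (Quot.out e) = e := fun e => Quot.out_eq e
  have hf : Function.Bijective f := by
    constructor
    · rintro ⟨e, b⟩ ⟨e', b'⟩ heq
      have he : e = e' := by
        have := T.edgeOf_eq_of_orEdgeOf_eq heq
        rw [← hout e, ← hout e']
        cases b <;> cases b' <;> simpa [edgeOf_rev] using this
      subst he
      cases b <;> cases b'
      · rfl
      · exact absurd heq (by simpa [f] using h _)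
      · exact absurd heq (by simpa [f] using (h _).symm)
      · rfl
    · intro o
      obtain ⟨E, rfl⟩ := Quot.exists_rep o
      rcases T.edgeOf_eq_iff.mp (hout (T.edgeOf E)).symm with h | h
      · exact ⟨(T.edgeOf E, true), h.symm⟩
      · exact ⟨(T.edgeOf E, false), h.symm⟩
  rw [← Nat.card_eq_of_bijective f hf, Nat.card_prod, numEdges, mul_comm]
  simp

/-- The starting point of an oriented edge. -/
def start : T.OrEdge → T.Vertex :=
  Quot.lift (fun E => T.vertexOf (E.1.1, E.1.2.1)) fun E E' h => by
    obtain ⟨x, k, k', h1, h2⟩ := h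
    exact Quot.sound ⟨x, k, by simp [h1], by simp [h2]⟩

theorem star_eq (v : T.Vertex) : T.star v = {o | T.start o = v} := by
  ext o
  constructor
  · rintro ⟨E, rfl, h⟩
    exact h
  · intro h
    obtain ⟨E, rfl⟩ := Quot.exists_rep o
    exact ⟨E, rfl, h⟩

theorem sum_ncard_fiber {X Y : Type} [Finite X] [Fintype Y] (f : X → Y) :
    ∑ y, {x | f x = y}.ncard = Nat.card X := by
  classical
  have := Fintype.ofFinite X
  rw [Nat.card_eq_fintype_card, ← Finset.card_univ,
    Finset.card_eq_sum_card_fiberwise (f := f) (t := Finset.univ) (by simp)]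
  refine Finset.sum_congr rfl fun y _ => ?_
  rw [← Set.ncard_coe_finset]
  simp

theorem numVertices_add_card [Fintype ι] (hT : T.IsTriangulation) :
    T.numVertices + Fintype.card ι = T.numEdges := by
  classical
  have := Fintype.ofFinite T.Vertex
  have h1 : ∑ v, T.linkEuler v = 2 * T.numVertices := by
    have h2 : ∀ v, T.linkEuler v = if T.IsManifoldVertex v then 2 else 0 := by
      intro v
      unfold IsManifoldVertex
      rcases hT.link v with h | h <;> simp [h]
    simp only [h2, Finset.sum_ite, Finset.sum_const, numVertices]
    rw [← Set.ncard_coe_finset]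
    simp [mul_comm]
  have h3 : ∑ v, T.linkEuler v = Nat.card T.OrEdge - 1 / 2 * (4 * Fintype.card ι : ℕ) := by
    have h4 : (∑ v, (T.star v).ncard) = Nat.card T.OrEdge := by
      simp only [star_eq]
      exact sum_ncard_fiber _
    have h5 : (∑ v, T.linkTriangles v) = 4 * Fintype.card ι := by
      unfold linkTriangles
      rw [sum_ncard_fiber]
      simp [mul_comm]
    rw [← h4, ← h5]
    push_cast
    rw [Finset.mul_sum, ← Finset.sum_sub_distrib]
    refine Finset.sum_congr rfl fun v _ => ?_
    unfold linkEuler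
    ring
  rw [h1, T.card_orEdge hT.orEdge_rev] at h3
  push_cast at h3
  have h6 : (T.numVertices : ℚ) + Fintype.card ι = T.numEdges := by linarith
  exact_mod_cast h6

/-! ### Diagonal edges -/

theorem sum_signed_faces [Fintype ι] (F : ι × Fin 4 → ℤ) (hF : ∀ x, F (T.glue x) = F x) :
    ∑ x, ((T.sign x.1 * (-1) ^ (x.2 : ℕ) : ℤˣ) : ℤ) * F x = 0 := by
  have h := Equiv.sum_comp (⟨T.glue, T.glue, T.glue_glue, T.glue_glue⟩ : Equiv.Perm (ι × Fin 4))
    fun x => ((T.sign x.1 * (-1) ^ (x.2 : ℕ) : ℤˣ) : ℤ) * F x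
  simp only [Equiv.coe_fn_mk, T.prebranching, hF, Units.val_neg, neg_mul,
    Finset.sum_neg_distrib] at h
  linarith

theorem sum_signed_diagonals [Fintype ι] (c : ι → Fin 4 → Fin 4 → ℤ)
    (hc : ∀ x k k', k ≠ k' → c (T.glue x).1 ((T.glue x).2.succAbove (k + T.rot x))
      ((T.glue x).2.succAbove (k' + T.rot x)) = c x.1 (x.2.succAbove k) (x.2.succAbove k'))
    (hsymm : ∀ i a b, c i a b = c i b a) :
    ∑ i, ((T.sign i : ℤˣ) : ℤ) * (c i 1 3 - c i 0 2) = 0 := by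
  have h := T.sum_signed_faces
    (fun x => ∑ k : Fin 3, c x.1 (x.2.succAbove k) (x.2.succAbove (k + 1))) (by
    intro x
    rw [← Equiv.sum_comp (Equiv.addRight (T.rot x))]
    refine Finset.sum_congr rfl fun k _ => ?_
    rw [← hc x k (k + 1) (by revert k; decide)]
    simp only [Equiv.coe_addRight]
    rw [add_right_comm])
  rw [Fintype.sum_prod_type] at h
  have h2 : 2 * ∑ i, ((T.sign i : ℤˣ) : ℤ) * (c i 1 3 - c i 0 2) = 0 := by
    rw [← h, Finset.mul_sum]
    refine Finset.sum_congr rfl fun i _ => ?_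
    simp only [Fin.sum_univ_four, Fin.sum_univ_three]
    change _ = ((T.sign i * (-1) ^ 0 : ℤˣ) : ℤ) * (c i 1 2 + c i 2 3 + c i 3 1) +
      ((T.sign i * (-1) ^ 1 : ℤˣ) : ℤ) * (c i 0 2 + c i 2 3 + c i 3 0) +
      ((T.sign i * (-1) ^ 2 : ℤˣ) : ℤ) * (c i 0 1 + c i 1 3 + c i 3 0) +
      ((T.sign i * (-1) ^ 3 : ℤˣ) : ℤ) * (c i 0 1 + c i 1 2 + c i 2 0)
    rw [hsymm i 3 1, hsymm i 3 0, hsymm i 2 0]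
    push_cast
    simp
    ring
  linarith

/-- An orientation of the edges: its value on an abstract oriented edge is the sign comparing the
two orientations. -/
structure IsOrientation (o : OrAbsEdge ι → ℤ) : Prop where
  glue : ∀ E E', T.GluedEdge E E' → o E' = o E
  rev : ∀ E, o E.rev = -o E
  unit : ∀ E, o E = 1 ∨ o E = -1

/-- The sum of the signs of the diagonal edges. -/
def signedDiagonals [Fintype ι] (o : OrAbsEdge ι → ℤ) : ℤ :=
  ∑ i, (o (orAbsEdge i 0 2 (by decide)) + o (orAbsEdge i 1 3 (by decide)))

theorem four_dvd_signedDiagonals_sub [Fintype ι] {o o' : OrAbsEdge ι → ℤ} (ho : T.IsOrientation o)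
    (ho' : T.IsOrientation o') : 4 ∣ signedDiagonals o - signedDiagonals o' := by
  have h := T.sum_signed_diagonals
    (fun i a b => if h : a ≠ b then o (orAbsEdge i a b h) * o' (orAbsEdge i a b h) else 0) (by
      intro x k k' hk
      have h1 : (T.glue x).2.succAbove (k + T.rot x) ≠ (T.glue x).2.succAbove (k' + T.rot x) :=
        fun h => hk (add_right_cancel (Fin.succAbove_right_injective h))
      have h2 : x.2.succAbove k ≠ x.2.succAbove k' :=
        fun h => hk (Fin.succAbove_right_injective h)
      rw [dif_pos h1, dif_pos h2]
      have h3 : T.GluedEdge (orAbsEdge x.1 _ _ h2) (orAbsEdge (T.glue x).1 _ _ h1) :=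
        ⟨x, k, k', rfl, rfl⟩
      rw [ho.glue _ _ h3, ho'.glue _ _ h3]) (by
      intro i a b
      by_cases hab : a = b
      · simp [hab]
      · rw [dif_pos hab, dif_pos (Ne.symm hab)]
        have h1 := ho.rev (orAbsEdge i a b hab)
        have h2 := ho'.rev (orAbsEdge i a b hab)
        change o (orAbsEdge i b a (Ne.symm hab)) = _ at h1
        change o' (orAbsEdge i b a (Ne.symm hab)) = _ at h2
        rw [h1, h2, neg_mul_neg])
  rw [← sub_zero (signedDiagonals o - signedDiagonals o'), ← h, signedDiagonals, signedDiagonals,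
    ← Finset.sum_sub_distrib, ← Finset.sum_sub_distrib]
  refine Finset.dvd_sum fun i _ => ?_
  rw [dif_pos (by decide), dif_pos (by decide)]
  rcases ho.unit (orAbsEdge i 0 2 (by decide)) with h1 | h1 <;>
  rcases ho.unit (orAbsEdge i 1 3 (by decide)) with h2 | h2 <;>
  rcases ho'.unit (orAbsEdge i 0 2 (by decide)) with h3 | h3 <;>
  rcases ho'.unit (orAbsEdge i 1 3 (by decide)) with h4 | h4 <;>
  rcases Int.units_eq_one_or (T.sign i) with h5 | h5 <;>
  simp +decide [h1, h2, h3, h4, h5]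

open scoped Classical in
/-- The orientation of the edges by the chosen representatives. -/
def outOrientation (E : OrAbsEdge ι) : ℤ :=
  if T.orEdgeOf E = T.orEdgeOf (Quot.out (T.edgeOf E)) then 1 else -1

theorem isOrientation_outOrientation (h : ∀ E : OrAbsEdge ι, T.orEdgeOf E.rev ≠ T.orEdgeOf E) :
    T.IsOrientation T.outOrientation where
  glue E E' hE := by
    unfold outOrientation
    rw [T.edgeOf_eq_of_orEdgeOf_eq (T.orEdgeOf_eq hE), T.orEdgeOf_eq hE]
  rev E := by
    unfold outOrientation
    rw [T.edgeOf_rev]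
    have h1 : T.edgeOf (Quot.out (T.edgeOf E)) = T.edgeOf E := Quot.out_eq _
    rcases T.edgeOf_eq_iff.mp h1 with h2 | h2 <;> rw [h2]
    · rw [if_neg (h E), if_pos rfl]
    · rw [if_pos rfl, if_neg (h E).symm, neg_neg]
  unit E := by
    unfold outOrientation
    split_ifs <;> simp

theorem sum_absEdge [Fintype ι] (F : ι → Fin 4 → Fin 4 → ℤ) :
    ∑ E : AbsEdge ι, (if edgeIndex E.1.2.1 E.1.2.2 = 2 then F E.1.1 E.1.2.1 E.1.2.2 else 0) =
      ∑ i, (F i 0 2 + F i 1 3) := by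
  let e : ι × {p : Fin 4 × Fin 4 // p.1 < p.2} ≃ AbsEdge ι :=
    { toFun := fun x => ⟨(x.1, x.2.1), x.2.2⟩
      invFun := fun E => (E.1.1, ⟨E.1.2, E.2⟩)
      left_inv := fun _ => rfl
      right_inv := fun _ => rfl }
  rw [← e.sum_comp, Fintype.sum_prod_type]
  refine Finset.sum_congr rfl fun i _ => ?_
  have hu : (Finset.univ : Finset {p : Fin 4 × Fin 4 // p.1 < p.2}) =
      {⟨(0, 1), by decide⟩, ⟨(0, 2), by decide⟩, ⟨(0, 3), by decide⟩, ⟨(1, 2), by decide⟩,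
        ⟨(1, 3), by decide⟩, ⟨(2, 3), by decide⟩} := by decide
  rw [hu]
  simp +decide [e, edgeIndex]

theorem diagonalSum_eq [Fintype ι] : T.diagonalSum = signedDiagonals T.outOrientation := by
  classical
  have h := sum_absEdge fun (i : ι) a b =>
    if h : a ≠ b then T.outOrientation (orAbsEdge i a b h) else 0
  refine (Finset.sum_congr rfl fun E _ => ?_).trans
    (h.trans (Finset.sum_congr rfl fun i _ => by rw [dif_pos (by decide), dif_pos (by decide)]))
  rw [dif_pos E.2.ne]
  rfl

end WeaklyBranched

/-! ### Comparison of the edges of two triangulations -/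

section Push

variable {X X' Y : Type}

/-- The image of a relation, made reflexive. -/
def push (π : X → Y) (r : X → X → Prop) (y y' : Y) : Prop :=
  y = y' ∨ ∃ x x', r x x' ∧ π x = y ∧ π x' = y'

theorem card_quot_push [Finite X] [Finite Y] (π : X → Y) (r : X → X → Prop)
    (hπ : ∀ x x', π x = π x' → Quot.mk r x = Quot.mk r x') :
    Nat.card (Quot (push π r)) = Nat.card (Quot r) + (Set.range π)ᶜ.ncard := by
  classical
  let f : Quot (push π r) → Quot r ⊕ {y // y ∈ (Set.range π)ᶜ} :=
    Quot.lift (fun y => if h : y ∈ Set.range π then .inl (Quot.mk r h.choose) else .inr ⟨y, h⟩) (by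
      have key : ∀ x, (if h : π x ∈ Set.range π then (.inl (Quot.mk r h.choose) :
          Quot r ⊕ {y // y ∈ (Set.range π)ᶜ}) else .inr ⟨π x, h⟩) = .inl (Quot.mk r x) := by
        intro x
        have h : π x ∈ Set.range π := ⟨x, rfl⟩
        rw [dif_pos h, hπ _ _ h.choose_spec]
      rintro y y' (rfl | ⟨x, x', h, rfl, rfl⟩)
      · rfl
      · rw [key, key, Quot.sound h])
  let g : Quot r ⊕ {y // y ∈ (Set.range π)ᶜ} → Quot (push π r) :=
    Sum.elim (Quot.lift (fun x => Quot.mk _ (π x)) fun x x' h =>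
      Quot.sound (Or.inr ⟨x, x', h, rfl, rfl⟩)) fun y => Quot.mk _ y.1
  have e : Quot (push π r) ≃ Quot r ⊕ {y // y ∈ (Set.range π)ᶜ} :=
    { toFun := f
      invFun := g
      left_inv := by
        rintro ⟨y⟩
        change g (if h : y ∈ Set.range π then .inl (Quot.mk r h.choose) else .inr ⟨y, h⟩) = _
        split_ifs with h
        · exact congrArg (Quot.mk _) h.choose_spec
        · rfl
      right_inv := by
        rintro (x | ⟨y, hy⟩)
        · induction x using Quot.ind with | mk x => ?_
          change (if h : π x ∈ Set.range π then (.inl (Quot.mk r h.choose) :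
            Quot r ⊕ {y // y ∈ (Set.range π)ᶜ}) else .inr ⟨π x, h⟩) = _
          have h : π x ∈ Set.range π := ⟨x, rfl⟩
          rw [dif_pos h, hπ _ _ h.choose_spec]
        · exact dif_neg hy }
  rw [Nat.card_congr e, Nat.card_sum, Nat.card_coe_set_eq]

theorem exists_factor {Z : Type} {π : X → Y} (hsurj : Function.Surjective π) {r : X → X → Prop}
    (hπ : ∀ x x', π x = π x' → Quot.mk r x = Quot.mk r x') {o : X → Z}
    (ho : ∀ x x', r x x' → o x' = o x) : ∃ ω : Y → Z, ∀ x, ω (π x) = o x := by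
  refine ⟨fun y => o (Function.surjInv hsurj y), fun x => ?_⟩
  exact congrArg (Quot.lift o fun x x' h => (ho x x' h).symm : Quot r → Z)
    (hπ _ _ (Function.surjInv_eq hsurj (π x)))

end Push

/-- `T'` is obtained from `T` by replacing some edges; `π` and `π'` map the abstract edges to a
common set of labels, so that the identifications induced by the gluings are the same. -/
structure EdgeComparison {ι ι' Y : Type} (T : WeaklyBranched ι) (T' : WeaklyBranched ι')
    (π : OrAbsEdge ι → Y) (π' : OrAbsEdge ι' → Y) (ρ : Y → Y) : Prop where
  inj : ∀ E E', π E = π E' → T.orEdgeOf E = T.orEdgeOf E'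
  inj' : ∀ E E', π' E = π' E' → T'.orEdgeOf E = T'.orEdgeOf E'
  rev : ∀ E, π E.rev = ρ (π E)
  rev' : ∀ E, π' E.rev = ρ (π' E)
  glue : ∀ E E', T.GluedEdge E E' → push π' T'.GluedEdge (π E) (π E')
  glue' : ∀ E E', T'.GluedEdge E E' → push π T.GluedEdge (π' E) (π' E')
  surj : Function.Surjective π'

namespace EdgeComparison

variable {ι ι' Y : Type} {T : WeaklyBranched ι} {T' : WeaklyBranched ι'} {π : OrAbsEdge ι → Y}
  {π' : OrAbsEdge ι' → Y} {ρ : Y → Y}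

theorem card_orEdge [Finite ι] [Finite ι'] [Finite Y] (H : EdgeComparison T T' π π' ρ) :
    Nat.card T'.OrEdge = Nat.card T.OrEdge + (Set.range π)ᶜ.ncard := by
  have h1 := card_quot_push π T.GluedEdge H.inj
  have h2 := card_quot_push π' T'.GluedEdge H.inj'
  have h3 : push π T.GluedEdge = push π' T'.GluedEdge := by
    funext y y'
    refine propext ⟨?_, ?_⟩
    · rintro (rfl | ⟨E, E', h, rfl, rfl⟩)
      · exact Or.inl rfl
      · exact H.glue _ _ h
    · rintro (rfl | ⟨E, E', h, rfl, rfl⟩)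
      · exact Or.inl rfl
      · exact H.glue' _ _ h
  rw [H.surj.range_eq, Set.compl_univ, Set.ncard_empty, add_zero, ← h3] at h2
  exact h2.symm.trans h1

theorem exists_orientation (H : EdgeComparison T T' π π' ρ) {o : OrAbsEdge ι' → ℤ}
    (ho : T'.IsOrientation o) : ∃ ω : Y → ℤ, (∀ E, ω (π' E) = o E) ∧
      T.IsOrientation (fun E => ω (π E)) ∧ ∀ y, ω y = 1 ∨ ω y = -1 := by
  obtain ⟨ω, hω⟩ := exists_factor H.surj H.inj' ho.glue
  have hu : ∀ y, ω y = 1 ∨ ω y = -1 := by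
    intro y
    obtain ⟨E, rfl⟩ := H.surj y
    rw [hω]
    exact ho.unit E
  refine ⟨ω, hω, ⟨fun E E' h => ?_, fun E => ?_, fun E => hu _⟩, hu⟩
  · rcases H.glue _ _ h with h | ⟨E₁, E₁', h, h1, h2⟩
    · rw [h]
    · rw [← h1, ← h2, hω, hω, ho.glue _ _ h]
  · obtain ⟨E', hE'⟩ := H.surj (π E)
    rw [H.rev, ← hE', ← H.rev', hω, hω, ho.rev]

end EdgeComparison

/-! ### The exchange of tetrahedra in a `2 ↔ 3` transit -/

theorem succAbove_pos_succAbove {i j : Fin 5} (hij : i ≠ j) (k : Fin 3) :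
    i.succAbove ((pos i j).succAbove k) = j.succAbove ((pos j i).succAbove k) := by
  revert i j k
  decide

section Exchange

variable {ι ι' κ : Type} {A B : Fin 5 → Prop}

/-- The correspondence between outer faces; see `MPFace`. -/
inductive OuterFace (φ : κ ⊕ {i // A i} ≃ ι) (φ' : κ ⊕ {i // B i} ≃ ι') :
    ι × Fin 4 → ι' × Fin 4 → Prop
  | common (k : κ) (a : Fin 4) : OuterFace φ φ' (φ (.inl k), a) (φ' (.inl k), a)
  | boundary (i : {i // A i}) (j : {i // B i}) :
      OuterFace φ φ' (φ (.inr i), pos i j) (φ' (.inr j), pos j i)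

variable {φ : κ ⊕ {i // A i} ≃ ι} {φ' : κ ⊕ {i // B i} ≃ ι'}

theorem OuterFace.symm {x : ι × Fin 4} {x' : ι' × Fin 4} (h : OuterFace φ φ' x x') :
    OuterFace φ' φ x' x := by
  cases h
  · exact .common _ _
  · exact .boundary _ _

/-- The tetrahedra of `T` are those of `κ` and the `Δ^i` with `A i`, the tetrahedra of `T'` are
those of `κ` and the `Δ^i` with `B i`, glued as in a `2 ↔ 3` transit or its inverse. -/
structure Exchange (T : WeaklyBranched ι) (T' : WeaklyBranched ι') (φ : κ ⊕ {i // A i} ≃ ι)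
    (φ' : κ ⊕ {i // B i} ≃ ι') : Prop where
  compl : ∀ i, A i ↔ ¬ B i
  inner : ∀ i j : {i // A i}, i ≠ j →
    T.glue (φ (.inr i), pos i j) = (φ (.inr j), pos j i) ∧ T.rot (φ (.inr i), pos i j) = 0
  inner' : ∀ i j : {i // B i}, i ≠ j →
    T'.glue (φ' (.inr i), pos i j) = (φ' (.inr j), pos j i) ∧ T'.rot (φ' (.inr i), pos i j) = 0
  outer : ∀ x x', OuterFace φ φ' x x' → OuterFace φ φ' (T.glue x) (T'.glue x') ∧
    T'.rot x' = T.rot x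

/-- The labels of the edges. -/
def edgeLabel (φ : κ ⊕ {i // A i} ≃ ι) (E : OrAbsEdge ι) :
    OrAbsEdge κ ⊕ {p : Fin 5 × Fin 5 // p.1 ≠ p.2} :=
  Sum.elim (fun k => .inl ⟨(k, E.1.2), E.2⟩)
    (fun i => .inr ⟨(i.1.succAbove E.1.2.1, i.1.succAbove E.1.2.2),
      fun h => E.2 (Fin.succAbove_right_injective h)⟩) (φ.symm E.1.1)

/-- The reversal of the labels of the edges. -/
def revLabel : OrAbsEdge κ ⊕ {p : Fin 5 × Fin 5 // p.1 ≠ p.2} →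
    OrAbsEdge κ ⊕ {p : Fin 5 × Fin 5 // p.1 ≠ p.2} :=
  Sum.map OrAbsEdge.rev fun p => ⟨p.1.swap, p.2.symm⟩

theorem edgeLabel_inl (k : κ) (a b : Fin 4) (h : a ≠ b) :
    edgeLabel φ ⟨(φ (.inl k), a, b), h⟩ = .inl ⟨(k, a, b), h⟩ := by
  simp [edgeLabel]

theorem edgeLabel_inr (i : {i // A i}) (a b : Fin 4) (h : a ≠ b) :
    edgeLabel φ ⟨(φ (.inr i), a, b), h⟩ = .inr ⟨(i.1.succAbove a, i.1.succAbove b),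
      fun h' => h (Fin.succAbove_right_injective h')⟩ := by
  simp [edgeLabel]

theorem edgeLabel_rev (E : OrAbsEdge ι) : edgeLabel φ E.rev = revLabel (edgeLabel φ E) := by
  unfold edgeLabel revLabel
  change Sum.elim _ _ (φ.symm E.1.1) = _
  rcases φ.symm E.1.1 with k | i <;> rfl

theorem edgeLabel_outerFace {x : ι × Fin 4} {x' : ι' × Fin 4} (h : OuterFace φ φ' x x')
    (hAB : ∀ i, A i ↔ ¬ B i) {E : OrAbsEdge ι} {E' : OrAbsEdge ι'} {k k' : Fin 3}
    (hE : E.1 = (x.1, x.2.succAbove k, x.2.succAbove k'))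
    (hE' : E'.1 = (x'.1, x'.2.succAbove k, x'.2.succAbove k')) :
    edgeLabel φ E = edgeLabel φ' E' := by
  obtain ⟨E, h1⟩ := E
  obtain ⟨E', h1'⟩ := E'
  dsimp only at hE hE'
  subst hE hE'
  cases h with
  | common k a => rw [edgeLabel_inl, edgeLabel_inl]
  | boundary i j =>
    have hij : i.1 ≠ j.1 := fun h => (hAB i.1).mp i.2 (h ▸ j.2)
    rw [edgeLabel_inr, edgeLabel_inr]
    simp only [succAbove_pos_succAbove hij]

theorem edgeLabel_inner {i j : {i // A i}} (hij : i ≠ j) {E E' : OrAbsEdge ι} {k k' : Fin 3}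
    (hE : E.1 = (φ (.inr i), (pos i j).succAbove k, (pos i j).succAbove k'))
    (hE' : E'.1 = (φ (.inr j), (pos j i).succAbove k, (pos j i).succAbove k')) :
    edgeLabel φ E = edgeLabel φ E' := by
  obtain ⟨E, h1⟩ := E
  obtain ⟨E', h1'⟩ := E'
  dsimp only at hE hE'
  subst hE hE'
  rw [edgeLabel_inr, edgeLabel_inr]
  simp only [succAbove_pos_succAbove fun h => hij (Subtype.ext h)]

theorem face_cases (φ : κ ⊕ {i // A i} ≃ ι) (φ' : κ ⊕ {i // B i} ≃ ι') (hAB : ∀ i, A i ↔ ¬ B i)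
    (x : ι × Fin 4) :
    (∃ i j : {i // A i}, i ≠ j ∧ x = (φ (.inr i), pos i j)) ∨ ∃ x', OuterFace φ φ' x x' := by
  obtain ⟨t, a⟩ := x
  obtain ⟨t, rfl⟩ := φ.surjective t
  rcases t with k | i
  · exact Or.inr ⟨_, .common k a⟩
  · have hp : pos i.1 (i.1.succAbove a) = a := pos_succAbove i.1 a
    by_cases hj : A (i.1.succAbove a)
    · exact Or.inl ⟨i, ⟨_, hj⟩, fun h => Fin.succAbove_ne i.1 a (congrArg Subtype.val h).symm,
        by rw [hp]⟩
    · have hj' : B (i.1.succAbove a) := by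
        by_contra h
        exact hj ((hAB _).mpr h)
      refine Or.inr ⟨(φ' (.inr ⟨_, hj'⟩), pos (i.1.succAbove a) i), ?_⟩
      have := OuterFace.boundary (φ := φ) (φ' := φ') i ⟨_, hj'⟩
      rw [hp] at this
      exact this

namespace Exchange

variable {T : WeaklyBranched ι} {T' : WeaklyBranched ι'}

theorem symm (H : Exchange T T' φ φ') : Exchange T' T φ' φ where
  compl i := by rw [H.compl i, not_not]
  inner := H.inner'
  inner' := H.inner
  outer x x' h := by
    have := H.outer _ _ h.symm
    exact ⟨this.1.symm, this.2.symm⟩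

theorem orEdgeOf_eq (H : Exchange T T' φ φ') {E E' : OrAbsEdge ι}
    (h : edgeLabel φ E = edgeLabel φ E') : T.orEdgeOf E = T.orEdgeOf E' := by
  obtain ⟨⟨t, a, b⟩, hab⟩ := E
  obtain ⟨⟨t', a', b'⟩, hab'⟩ := E'
  obtain ⟨t, rfl⟩ := φ.surjective t
  obtain ⟨t', rfl⟩ := φ.surjective t'
  dsimp only at hab hab'
  rcases t with k | i <;> rcases t' with k' | i'
  · rw [edgeLabel_inl, edgeLabel_inl] at h
    simp only [Sum.inl.injEq, Subtype.mk.injEq, Prod.mk.injEq] at h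
    obtain ⟨rfl, rfl, rfl⟩ := h
    rfl
  · rw [edgeLabel_inl, edgeLabel_inr] at h
    cases h
  · rw [edgeLabel_inl, edgeLabel_inr] at h
    cases h
  · rw [edgeLabel_inr, edgeLabel_inr] at h
    simp only [Sum.inr.injEq, Subtype.mk.injEq, Prod.mk.injEq] at h
    obtain ⟨h1, h2⟩ := h
    by_cases hi : i = i'
    · subst hi
      have e1 := Fin.succAbove_right_injective h1
      have e2 := Fin.succAbove_right_injective h2
      subst e1 e2
      rfl
    · have hi' : i'.1 ≠ i.1 := fun h => hi (Subtype.ext h.symm)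
      have key : ∀ {a a' : Fin 4}, i.1.succAbove a = i'.1.succAbove a' →
          ∃ k, a = (pos i i').succAbove k ∧ a' = (pos i' i).succAbove k := by
        intro a a' h
        have ha : a ≠ pos i i' := by
          rintro rfl
          rw [succAbove_pos hi'] at h
          exact Fin.succAbove_ne _ _ h.symm
        obtain ⟨k, rfl⟩ := Fin.exists_succAbove_eq ha
        refine ⟨k, rfl, ?_⟩
        rw [succAbove_pos_succAbove hi'.symm] at h
        exact (Fin.succAbove_right_injective h).symm
      obtain ⟨k, rfl, rfl⟩ := key h1
      obtain ⟨k', rfl, rfl⟩ := key h2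
      refine T.orEdgeOf_eq ⟨(φ (.inr i), pos i i'), k, k', rfl, ?_⟩
      rw [(H.inner i i' hi).1, (H.inner i i' hi).2, add_zero, add_zero]

theorem push_edgeLabel (H : Exchange T T' φ φ') {E E' : OrAbsEdge ι} (h : T.GluedEdge E E') :
    push (edgeLabel φ') T'.GluedEdge (edgeLabel φ E) (edgeLabel φ E') := by
  obtain ⟨x, k, k', h1, h2⟩ := h
  rcases face_cases φ φ' H.compl x with ⟨i, j, hij, rfl⟩ | ⟨x', hx⟩
  · rw [(H.inner i j hij).1, (H.inner i j hij).2, add_zero, add_zero] at h2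
    exact Or.inl (edgeLabel_inner hij h1 h2)
  · obtain ⟨h3, h4⟩ := H.outer _ _ hx
    have hk : k ≠ k' := by
      rintro rfl
      exact E.2 (by rw [h1])
    let E₁ : OrAbsEdge ι' := ⟨(x'.1, x'.2.succAbove k, x'.2.succAbove k'),
      fun h => hk (Fin.succAbove_right_injective h)⟩
    let E₁' : OrAbsEdge ι' := ⟨((T'.glue x').1, (T'.glue x').2.succAbove (k + T'.rot x'),
      (T'.glue x').2.succAbove (k' + T'.rot x')),
      fun h => hk (add_right_cancel (Fin.succAbove_right_injective h))⟩
    refine Or.inr ⟨E₁, E₁', ⟨x', k, k', rfl, rfl⟩, ?_, ?_⟩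
    · exact (edgeLabel_outerFace hx H.compl h1 rfl).symm
    · refine (edgeLabel_outerFace h3 H.compl h2 ?_).symm
      rw [← h4]

theorem edgeComparison (H : Exchange T T' φ φ')
    (hB : ∀ a b : Fin 5, ∃ i, B i ∧ i ≠ a ∧ i ≠ b) :
    EdgeComparison T T' (edgeLabel φ) (edgeLabel φ') revLabel where
  inj _ _ := H.orEdgeOf_eq
  inj' _ _ := H.symm.orEdgeOf_eq
  rev := edgeLabel_rev
  rev' := edgeLabel_rev
  glue _ _ := H.push_edgeLabel
  glue' _ _ := H.symm.push_edgeLabel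
  surj := by
    rintro (⟨⟨k, a, b⟩, h⟩ | ⟨⟨a, b⟩, h⟩)
    · exact ⟨_, edgeLabel_inl k a b h⟩
    · obtain ⟨i, hi, ha, hb⟩ := hB a b
      dsimp only at h
      refine ⟨⟨(φ' (.inr ⟨i, hi⟩), pos i a, pos i b), fun h' => h ?_⟩, ?_⟩
      · rw [← succAbove_pos ha.symm, ← succAbove_pos hb.symm]
        exact congrArg i.succAbove h'
      · rw [edgeLabel_inr]
        simp only [succAbove_pos ha.symm, succAbove_pos hb.symm]

end Exchange

end Exchange

/-! ### Numbers of edges and diagonals in a `2 → 3` transit -/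

section MP

variable {ι ι' κ : Type} {P : Finset (Fin 5)} {s : ℤˣ} {φ : κ ⊕ {i // i ∈ P} ≃ ι}
  {φ' : κ ⊕ {i // i ∉ P} ≃ ι'}

theorem outerFace_iff {x : ι × Fin 4} {x' : ι' × Fin 4} :
    OuterFace φ φ' x x' ↔ MPFace φ φ' x x' := by
  constructor
  · rintro (⟨k, a⟩ | ⟨i, j⟩)
    · exact .common k a
    · exact .boundary i j
  · rintro (⟨k, a⟩ | ⟨i, j⟩)
    · exact .common k a
    · exact .boundary i j

theorem IsMPTransit.exchange {T : RoughQH ι} {T' : RoughQH ι'} (H : IsMPTransit T T' P s φ φ') :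
    Exchange T.toWeaklyBranched T'.toWeaklyBranched φ φ' where
  compl i := by rw [not_not]
  inner := H.inner_left
  inner' := H.inner_right
  outer x x' h := by
    rw [outerFace_iff] at h ⊢
    exact H.outer x x' h

theorem ncard_compl_range_edgeLabel (hP : P.card = 2) : (Set.range (edgeLabel φ))ᶜ.ncard = 2 := by
  obtain ⟨p, p', hpp, rfl⟩ := Finset.card_eq_two.mp hP
  have : (Set.range (edgeLabel φ))ᶜ = {.inr ⟨(p, p'), hpp⟩, .inr ⟨(p', p), hpp.symm⟩} := by
    ext y
    rw [Set.mem_compl_iff, Set.mem_insert_iff, Set.mem_singleton_iff]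
    constructor
    · intro hy
      rcases y with ⟨⟨k, a, b⟩, h⟩ | ⟨⟨a, b⟩, h⟩
      · exact absurd ⟨_, edgeLabel_inl k a b h⟩ hy
      · have h1 : ∀ i ∈ ({p, p'} : Finset (Fin 5)), i = a ∨ i = b := by
          intro i hi
          by_contra hc
          rw [not_or] at hc
          refine hy ⟨⟨(φ (.inr ⟨i, hi⟩), pos i a, pos i b), fun h' => h ?_⟩, ?_⟩
          · rw [← succAbove_pos (Ne.symm hc.1), ← succAbove_pos (Ne.symm hc.2)]
            exact congrArg i.succAbove h'
          · rw [edgeLabel_inr]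
            simp only [succAbove_pos (Ne.symm hc.1), succAbove_pos (Ne.symm hc.2)]
        rcases h1 p (by simp) with rfl | rfl <;> rcases h1 p' (by simp) with h2 | h2
        · exact absurd h2.symm hpp
        · subst h2
          exact Or.inl rfl
        · subst h2
          exact Or.inr rfl
        · exact absurd h2.symm hpp
    · intro hy
      rintro ⟨⟨⟨t, a, b⟩, h⟩, rfl⟩
      obtain ⟨t, rfl⟩ := φ.surjective t
      rcases t with k | ⟨i, hi⟩
      · rw [edgeLabel_inl] at hy
        simp at hy
      · rw [edgeLabel_inr] at hy
        simp only [Sum.inr.injEq, Subtype.mk.injEq, Prod.mk.injEq] at hy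
        rw [Finset.mem_insert, Finset.mem_singleton] at hi
        rcases hi with rfl | rfl <;> rcases hy with hy | hy
        · exact Fin.succAbove_ne _ _ hy.1
        · exact Fin.succAbove_ne _ _ hy.2
        · exact Fin.succAbove_ne _ _ hy.2
        · exact Fin.succAbove_ne _ _ hy.1
  rw [this, Set.ncard_pair]
  simp [hpp]

theorem exists_notMem_ne (hP : P.card = 2) (a b : Fin 5) : ∃ i, i ∉ P ∧ i ≠ a ∧ i ≠ b := by
  obtain ⟨p, p', -, rfl⟩ := Finset.card_eq_two.mp hP
  clear hP
  revert p p' a b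
  decide

theorem card_add_card [Fintype ι] [Fintype ι'] [Fintype κ] (hP : P.card = 2)
    (φ : κ ⊕ {i // i ∈ P} ≃ ι) (φ' : κ ⊕ {i // i ∉ P} ≃ ι') :
    Fintype.card ι' = Fintype.card ι + 1 := by
  rw [← Fintype.card_congr φ, ← Fintype.card_congr φ', Fintype.card_sum, Fintype.card_sum,
    Fintype.card_coe, hP, Fintype.card_subtype_compl, Fintype.card_coe, hP, Fintype.card_fin]

@[to_additive]
theorem prod_exchange {M : Type} [CommMonoid M] {A : Fin 5 → Prop} [DecidablePred A] [Fintype ι]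
    [Fintype κ] (φ : κ ⊕ {i // A i} ≃ ι) (F : ι → M) :
    ∏ t, F t = (∏ k, F (φ (.inl k))) * ∏ i : {i // A i}, F (φ (.inr i)) := by
  rw [← φ.prod_comp, Fintype.prod_sum_type]

/-- The sum of the signs of the diagonal edges of `Δ^i`. -/
def localDiagonals (ω : OrAbsEdge κ ⊕ {p : Fin 5 × Fin 5 // p.1 ≠ p.2} → ℤ) (i : Fin 5) : ℤ :=
  ω (.inr ⟨(i.succAbove 0, i.succAbove 2), fun h => by
    simpa using Fin.succAbove_right_injective h⟩) +
  ω (.inr ⟨(i.succAbove 1, i.succAbove 3), fun h => by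
    simpa using Fin.succAbove_right_injective h⟩)

theorem sum_localDiagonals {ω : OrAbsEdge κ ⊕ {p : Fin 5 × Fin 5 // p.1 ≠ p.2} → ℤ}
    (hω : ∀ y, ω y = 1 ∨ ω y = -1) : 4 ∣ (∑ i, localDiagonals ω i) - 2 := by
  rw [Fin.sum_univ_five]
  change 4 ∣ (ω (.inr ⟨(1, 3), by decide⟩) + ω (.inr ⟨(2, 4), by decide⟩) +
    (ω (.inr ⟨(0, 3), by decide⟩) + ω (.inr ⟨(2, 4), by decide⟩)) +
    (ω (.inr ⟨(0, 3), by decide⟩) + ω (.inr ⟨(1, 4), by decide⟩)) +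
    (ω (.inr ⟨(0, 2), by decide⟩) + ω (.inr ⟨(1, 4), by decide⟩)) +
    (ω (.inr ⟨(0, 2), by decide⟩) + ω (.inr ⟨(1, 3), by decide⟩))) - 2
  have h1 := hω (.inr ⟨(1, 3), by decide⟩)
  have h2 := hω (.inr ⟨(2, 4), by decide⟩)
  have h3 := hω (.inr ⟨(0, 3), by decide⟩)
  have h4 := hω (.inr ⟨(1, 4), by decide⟩)
  have h5 := hω (.inr ⟨(0, 2), by decide⟩)
  omega

theorem two_dvd_localDiagonals {ω : OrAbsEdge κ ⊕ {p : Fin 5 × Fin 5 // p.1 ≠ p.2} → ℤ}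
    (hω : ∀ y, ω y = 1 ∨ ω y = -1) (i : Fin 5) : 2 ∣ localDiagonals ω i := by
  unfold localDiagonals
  rcases hω (.inr ⟨(i.succAbove 0, i.succAbove 2), fun h => by
    simpa using Fin.succAbove_right_injective h⟩) with h1 | h1 <;>
  rcases hω (.inr ⟨(i.succAbove 1, i.succAbove 3), fun h => by
    simpa using Fin.succAbove_right_injective h⟩) with h2 | h2 <;> rw [h1, h2] <;> decide

theorem signedDiagonals_exchange {A : Fin 5 → Prop} [DecidablePred A] [Fintype ι] [Fintype κ]
    (φ : κ ⊕ {i // A i} ≃ ι) (ω : OrAbsEdge κ ⊕ {p : Fin 5 × Fin 5 // p.1 ≠ p.2} → ℤ) :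
    WeaklyBranched.signedDiagonals (fun E => ω (edgeLabel φ E)) =
      (WeaklyBranched.signedDiagonals fun E => ω (.inl E)) +
        ∑ i : {i // A i}, localDiagonals ω i := by
  rw [WeaklyBranched.signedDiagonals, sum_exchange φ]
  congr 1
  · refine Finset.sum_congr rfl fun k _ => ?_
    simp only [orAbsEdge]
    rw [edgeLabel_inl, edgeLabel_inl]
  · refine Finset.sum_congr rfl fun i _ => ?_
    simp only [orAbsEdge]
    rw [edgeLabel_inr, edgeLabel_inr]
    rfl

/-- The exponent of `ε_N` in the normalization factor. -/
def WeaklyBranched.epsExponent [Fintype ι] (T : WeaklyBranched ι) : ℤ :=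
  (T.numVertices : ℤ) + T.numEdges - T.diagonalSum / 2

theorem IsMPTransit.euler [Fintype ι] [Fintype ι'] {T : RoughQH ι} {T' : RoughQH ι'}
    (H : IsMPTransit T T' P s φ φ') (hT : T.IsTriangulation) (hT' : T'.IsTriangulation) :
    T'.numVertices = T.numVertices ∧ 2 ∣ T'.epsExponent - T.epsExponent := by
  have := Fintype.ofInjective (fun k => φ (.inl k)) (φ.injective.comp Sum.inl_injective)
  have hP := H.dec_local.1
  have HE := H.exchange.edgeComparison (exists_notMem_ne hP)
  have h1 := HE.card_orEdge
  rw [ncard_compl_range_edgeLabel hP, T.card_orEdge hT.orEdge_rev,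
    T'.card_orEdge hT'.orEdge_rev] at h1
  have h2 := T.numVertices_add_card hT
  have h3 := T'.numVertices_add_card hT'
  have h4 := card_add_card hP φ φ'
  obtain ⟨ω, h5, h6, h7⟩ :=
    HE.exists_orientation (T'.isOrientation_outOrientation hT'.orEdge_rev)
  have h8 := T.four_dvd_signedDiagonals_sub h6 (T.isOrientation_outOrientation hT.orEdge_rev)
  rw [signedDiagonals_exchange, ← T.diagonalSum_eq,
    ← Finset.sum_subtype P fun _ => Iff.rfl] at h8
  have h9 : T'.diagonalSum = WeaklyBranched.signedDiagonals fun E => ω (edgeLabel φ' E) := by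
    rw [T'.diagonalSum_eq]
    congr 1
    funext E
    exact (h5 E).symm
  rw [signedDiagonals_exchange, ← Finset.sum_subtype Pᶜ (by simp)] at h9
  have h10 := Finset.sum_add_sum_compl P (localDiagonals ω)
  have h11 := sum_localDiagonals h7
  have h12 : 2 ∣ ∑ i ∈ P, localDiagonals ω i :=
    Finset.dvd_sum fun i _ => two_dvd_localDiagonals h7 i
  refine ⟨by omega, ?_⟩
  unfold WeaklyBranched.epsExponent
  omega

end MP

/-! ### Numbers of edges and diagonals in a bubble transit -/

section Bubble

variable {ι ι' : Type} {x : ι × Fin 4} {k : Fin 4} {e : Fin 3} {φ : ι ⊕ Bool ≃ ι'}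

/-- The vertices of the face `k` of a new tetrahedron are identified with the vertices of `x`. -/
def faceEquiv (k c : Fin 4) : Fin 4 ≃ Fin 4 := (finSuccEquiv' k).trans (finSuccEquiv' c).symm

theorem faceEquiv_succAbove (k c : Fin 4) (m : Fin 3) :
    faceEquiv k c (k.succAbove m) = c.succAbove m := by
  simp [faceEquiv]

/-- The edges of a tetrahedron at its vertex `k`. -/
abbrev EdgeAt (k : Fin 4) : Type := {p : Fin 4 × Fin 4 // p.1 ≠ p.2 ∧ (p.1 = k ∨ p.2 = k)}

/-- The labels of the edges of the new tetrahedra. -/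
def newEdgeLabel (x : ι × Fin 4) (k a b : Fin 4) (h : a ≠ b) : OrAbsEdge ι ⊕ EdgeAt k :=
  if hk : a = k ∨ b = k then .inr ⟨(a, b), h, hk⟩ else
    .inl ⟨(x.1, faceEquiv k x.2 a, faceEquiv k x.2 b), fun h' => h ((faceEquiv k x.2).injective h')⟩

theorem newEdgeLabel_succAbove (x : ι × Fin 4) (k : Fin 4) (m m' : Fin 3)
    (h : k.succAbove m ≠ k.succAbove m') (h' : x.2.succAbove m ≠ x.2.succAbove m') :
    newEdgeLabel x k (k.succAbove m) (k.succAbove m') h =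
      .inl ⟨(x.1, x.2.succAbove m, x.2.succAbove m'), h'⟩ := by
  unfold newEdgeLabel
  rw [dif_neg (by simp [Fin.succAbove_ne])]
  simp only [faceEquiv_succAbove]

/-- The labels of the edges after a bubble transit. -/
def bubbleLabel (x : ι × Fin 4) (k : Fin 4) (φ : ι ⊕ Bool ≃ ι') (E : OrAbsEdge ι') :
    OrAbsEdge ι ⊕ EdgeAt k :=
  Sum.elim (fun i => .inl ⟨(i, E.1.2), E.2⟩) (fun _ => newEdgeLabel x k E.1.2.1 E.1.2.2 E.2)
    (φ.symm E.1.1)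

theorem bubbleLabel_inl (i : ι) (a b : Fin 4) (h : a ≠ b) :
    bubbleLabel x k φ ⟨(φ (.inl i), a, b), h⟩ = .inl ⟨(i, a, b), h⟩ := by
  simp [bubbleLabel]

theorem bubbleLabel_inr (β : Bool) (a b : Fin 4) (h : a ≠ b) :
    bubbleLabel x k φ ⟨(φ (.inr β), a, b), h⟩ = newEdgeLabel x k a b h := by
  simp [bubbleLabel]

/-- The reversal of the labels of the edges. -/
def revBubbleLabel (k : Fin 4) : OrAbsEdge ι ⊕ EdgeAt k → OrAbsEdge ι ⊕ EdgeAt k :=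
  Sum.map OrAbsEdge.rev fun p => ⟨p.1.swap, p.2.1.symm, p.2.2.symm⟩

theorem newEdgeLabel_rev (x : ι × Fin 4) (k a b : Fin 4) (h : a ≠ b) :
    newEdgeLabel x k b a h.symm = revBubbleLabel k (newEdgeLabel x k a b h) := by
  unfold newEdgeLabel revBubbleLabel
  by_cases hk : a = k ∨ b = k
  · rw [dif_pos hk, dif_pos hk.symm]
    rfl
  · rw [dif_neg hk, dif_neg fun h => hk h.symm]
    rfl

theorem bubbleLabel_rev (E : OrAbsEdge ι') :
    bubbleLabel x k φ E.rev = revBubbleLabel k (bubbleLabel x k φ E) := by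
  unfold bubbleLabel
  change Sum.elim _ _ (φ.symm E.1.1) = _
  rcases φ.symm E.1.1 with i | β
  · rfl
  · exact newEdgeLabel_rev x k _ _ E.2

namespace IsBubbleTransit

variable {T : RoughQH ι} {T' : RoughQH ι'}

theorem inner_symm (H : IsBubbleTransit T T' x k e φ) {a : Fin 4} (ha : a ≠ k) :
    T'.glue (φ (.inr true), a) = (φ (.inr false), a) ∧ T'.rot (φ (.inr true), a) = 0 := by
  obtain ⟨h1, h2⟩ := H.inner a ha
  rw [← h1, T'.glue_glue, T'.rot_glue, h2]
  exact ⟨rfl, rfl⟩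

theorem outer_A_symm (H : IsBubbleTransit T T' x k e φ) :
    T'.glue (φ (.inr false), k) = (φ (.inl x.1), x.2) ∧ T'.rot (φ (.inr false), k) = 0 := by
  obtain ⟨h1, h2⟩ := H.outer_A
  rw [← h1, T'.glue_glue, T'.rot_glue, h2]
  exact ⟨rfl, rfl⟩

theorem outer_B_symm (H : IsBubbleTransit T T' x k e φ) :
    T'.glue (φ (.inl (T.glue x).1), (T.glue x).2) = (φ (.inr true), k) ∧
      T'.rot (φ (.inl (T.glue x).1), (T.glue x).2) = T.rot (T.glue x) := by
  obtain ⟨h1, h2⟩ := H.outer_B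
  rw [← h1, T'.glue_glue, T'.rot_glue, h2, T.rot_glue]
  exact ⟨rfl, rfl⟩

theorem orEdgeOf_new (H : IsBubbleTransit T T' x k e φ) (β : Bool) {a b : Fin 4} (h : a ≠ b) :
    T'.orEdgeOf (orAbsEdge (φ (.inr β)) a b h) = T'.orEdgeOf (orAbsEdge (φ (.inr false)) a b h) := by
  cases β
  · rfl
  · have hc : ∀ a b k : Fin 4, ∃ c, c ≠ k ∧ a ≠ c ∧ b ≠ c := by decide
    obtain ⟨c, hck, hac, hbc⟩ := hc a b k
    obtain ⟨m, rfl⟩ := Fin.exists_succAbove_eq hac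
    obtain ⟨m', rfl⟩ := Fin.exists_succAbove_eq hbc
    refine (T'.orEdgeOf_eq ⟨(φ (.inr false), c), m, m', rfl, ?_⟩).symm
    rw [(H.inner c hck).1, (H.inner c hck).2, add_zero, add_zero]
    rfl

theorem orEdgeOf_bubbleLabel (H : IsBubbleTransit T T' x k e φ) (E : OrAbsEdge ι') :
    Sum.elim (fun E : OrAbsEdge ι => T'.orEdgeOf ⟨(φ (.inl E.1.1), E.1.2), E.2⟩)
      (fun p : EdgeAt k => T'.orEdgeOf (orAbsEdge (φ (.inr false)) p.1.1 p.1.2 p.2.1))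
      (bubbleLabel x k φ E) = T'.orEdgeOf E := by
  obtain ⟨⟨t, a, b⟩, h⟩ := E
  obtain ⟨t, rfl⟩ := φ.surjective t
  dsimp only at h
  rcases t with i | β
  · rw [bubbleLabel_inl]
    rfl
  · rw [bubbleLabel_inr]
    refine Eq.trans ?_ (H.orEdgeOf_new β h).symm
    by_cases hk : a = k ∨ b = k
    · rw [newEdgeLabel, dif_pos hk]
      rfl
    · rw [not_or] at hk
      obtain ⟨m, rfl⟩ := Fin.exists_succAbove_eq hk.1
      obtain ⟨m', rfl⟩ := Fin.exists_succAbove_eq hk.2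
      have hm : m ≠ m' := fun h' => h (congrArg _ h')
      rw [newEdgeLabel_succAbove x k m m' h fun h' => hm (Fin.succAbove_right_injective h')]
      refine T'.orEdgeOf_eq ⟨(φ (.inl x.1), x.2), m, m', rfl, ?_⟩
      rw [H.outer_A.1, H.outer_A.2, add_zero, add_zero]
      rfl

theorem edgeComparison (H : IsBubbleTransit T T' x k e φ) :
    EdgeComparison T.toWeaklyBranched T'.toWeaklyBranched Sum.inl (bubbleLabel x k φ)
      (revBubbleLabel k) where
  inj E E' h := by rw [Sum.inl_injective h]
  inj' E E' h := by rw [← H.orEdgeOf_bubbleLabel E, ← H.orEdgeOf_bubbleLabel E', h]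
  rev _ := rfl
  rev' := bubbleLabel_rev
  surj := by
    rintro (⟨⟨i, a, b⟩, h⟩ | ⟨⟨a, b⟩, h, hk⟩)
    · exact ⟨_, bubbleLabel_inl i a b h⟩
    · exact ⟨_, (bubbleLabel_inr false a b h).trans (dif_pos hk)⟩
  glue := by
    rintro ⟨E, hE⟩ ⟨E', hE'⟩ ⟨y, m, m', h1, h2⟩
    dsimp only at h1 h2
    subst h1 h2
    have hm : m ≠ m' := fun h => hE (congrArg y.2.succAbove h)
    have hs : ∀ {r : Fin 3} (c : Fin 4), c.succAbove (m + r) ≠ c.succAbove (m' + r) :=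
      fun c h => hm (add_right_cancel (Fin.succAbove_right_injective h))
    have hs0 : ∀ c : Fin 4, c.succAbove m ≠ c.succAbove m' :=
      fun c h => hm (Fin.succAbove_right_injective h)
    by_cases hx : y = x
    · subst hx
      refine Or.inr ⟨orAbsEdge (φ (.inr true)) _ _ (hs0 k), orAbsEdge (φ (.inl (T.glue y).1)) _ _ hE',
        ⟨(φ (.inr true), k), m, m', rfl, ?_⟩, ?_, bubbleLabel_inl _ _ _ _⟩
      · rw [H.outer_B.1, H.outer_B.2]
        rfl
      · exact (bubbleLabel_inr _ _ _ _).trans (newEdgeLabel_succAbove y k m m' _ (hs0 _))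
    · by_cases hx' : y = T.glue x
      · subst hx'
        refine Or.inr ⟨orAbsEdge (φ (.inl (T.glue x).1)) _ _ hE,
          orAbsEdge (φ (.inr true)) (k.succAbove (m + T.rot (T.glue x)))
            (k.succAbove (m' + T.rot (T.glue x))) (hs k),
          ⟨(φ (.inl (T.glue x).1), (T.glue x).2), m, m', rfl, ?_⟩, bubbleLabel_inl _ _ _ _, ?_⟩
        · rw [H.outer_B_symm.1, H.outer_B_symm.2]
          rfl
        · refine (bubbleLabel_inr _ _ _ _).trans
            ((newEdgeLabel_succAbove x k _ _ _ (hs _)).trans ?_)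
          simp only [T.glue_glue]
      · refine Or.inr ⟨orAbsEdge (φ (.inl y.1)) _ _ hE, orAbsEdge (φ (.inl (T.glue y).1)) _ _ hE',
          ⟨(φ (.inl y.1), y.2), m, m', rfl, ?_⟩, bubbleLabel_inl _ _ _ _, bubbleLabel_inl _ _ _ _⟩
        rw [(H.outer y hx hx').1, (H.outer y hx hx').2]
        rfl
  glue' := by
    rintro ⟨E, hE⟩ ⟨E', hE'⟩ ⟨⟨t, c⟩, m, m', h1, h2⟩
    dsimp only at h1 h2
    subst h1
    have hm : m ≠ m' := fun h => hE (congrArg c.succAbove h)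
    have hs : ∀ {r : Fin 3} (c : Fin 4), c.succAbove (m + r) ≠ c.succAbove (m' + r) :=
      fun c h => hm (add_right_cancel (Fin.succAbove_right_injective h))
    have hs0 : ∀ c : Fin 4, c.succAbove m ≠ c.succAbove m' :=
      fun c h => hm (Fin.succAbove_right_injective h)
    obtain ⟨t, rfl⟩ := φ.surjective t
    rcases t with i | β
    · rw [bubbleLabel_inl]
      by_cases hx : (i, c) = x
      · subst hx
        rw [H.outer_A.1, H.outer_A.2, add_zero, add_zero] at h2
        subst h2
        exact Or.inl ((bubbleLabel_inr (φ := φ) false _ _ (hs0 k)).trans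
          (newEdgeLabel_succAbove (i, c) k m m' _ (hs0 c))).symm
      · by_cases hx' : (i, c) = T.glue x
        · have h3 := H.outer_B_symm
          rw [← hx'] at h3
          rw [h3.1, h3.2] at h2
          subst h2
          refine Or.inr ⟨_, ⟨(x.1, x.2.succAbove (m + T.rot (i, c)), x.2.succAbove (m' + T.rot (i, c))),
            hs _⟩, ⟨(i, c), m, m', rfl, ?_⟩, rfl, ?_⟩
          · rw [hx', T.glue_glue]
          · exact ((bubbleLabel_inr _ _ _ _).trans
              (newEdgeLabel_succAbove _ k _ _ _ (hs _))).symm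
        · rw [(H.outer _ hx hx').1, (H.outer _ hx hx').2] at h2
          subst h2
          exact Or.inr ⟨_, ⟨_, hE'⟩, ⟨(i, c), m, m', rfl, rfl⟩, rfl, (bubbleLabel_inl _ _ _ _).symm⟩
    · by_cases hc : c = k
      · subst hc
        have h4 : bubbleLabel x c φ ⟨(φ (.inr β), c.succAbove m, c.succAbove m'), hE⟩ =
            .inl ⟨(x.1, x.2.succAbove m, x.2.succAbove m'), hs0 _⟩ :=
          (bubbleLabel_inr _ _ _ _).trans (newEdgeLabel_succAbove _ _ m m' _ (hs0 _))
        cases β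
        · rw [H.outer_A_symm.1, H.outer_A_symm.2, add_zero, add_zero] at h2
          subst h2
          exact Or.inl (h4.trans (bubbleLabel_inl _ _ _ _).symm)
        · rw [H.outer_B.1, H.outer_B.2] at h2
          subst h2
          exact Or.inr ⟨_, ⟨_, hE'⟩, ⟨x, m, m', rfl, rfl⟩, h4.symm, (bubbleLabel_inl _ _ _ _).symm⟩
      · left
        cases β
        · rw [(H.inner c hc).1, (H.inner c hc).2, add_zero, add_zero] at h2
          subst h2
          exact (bubbleLabel_inr _ _ _ _).trans (bubbleLabel_inr _ _ _ _).symm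
        · rw [(H.inner_symm hc).1, (H.inner_symm hc).2, add_zero, add_zero] at h2
          subst h2
          exact (bubbleLabel_inr _ _ _ _).trans (bubbleLabel_inr _ _ _ _).symm

theorem euler [Fintype ι] [Fintype ι'] (H : IsBubbleTransit T T' x k e φ)
    (hT : T.IsTriangulation) (hT' : T'.IsTriangulation) :
    T'.numVertices = T.numVertices + 1 ∧ 2 ∣ T'.epsExponent - T.epsExponent := by
  have HE := H.edgeComparison
  have h1 := HE.card_orEdge
  have h0 : (Set.range (Sum.inl : OrAbsEdge ι → OrAbsEdge ι ⊕ EdgeAt k))ᶜ.ncard = 6 := by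
    rw [Set.compl_range_inl, ← Set.image_univ, Set.ncard_image_of_injective _ Sum.inr_injective,
      Set.ncard_univ, Nat.card_eq_fintype_card]
    clear * -
    revert k
    decide
  rw [h0, T.card_orEdge hT.orEdge_rev, T'.card_orEdge hT'.orEdge_rev] at h1
  have h2 := T.numVertices_add_card hT
  have h3 := T'.numVertices_add_card hT'
  have h4 : Fintype.card ι' = Fintype.card ι + 2 := by
    rw [← Fintype.card_congr φ, Fintype.card_sum, Fintype.card_bool]
  obtain ⟨ω, h5, h6, h7⟩ :=
    HE.exists_orientation (T'.isOrientation_outOrientation hT'.orEdge_rev)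
  have h8 := T.four_dvd_signedDiagonals_sub h6 (T.isOrientation_outOrientation hT.orEdge_rev)
  rw [← T.diagonalSum_eq] at h8
  have h9 : T'.diagonalSum = (WeaklyBranched.signedDiagonals fun E => ω (.inl E)) +
      2 * (ω (newEdgeLabel x k 0 2 (by decide)) + ω (newEdgeLabel x k 1 3 (by decide))) := by
    rw [T'.diagonalSum_eq, WeaklyBranched.signedDiagonals, ← φ.sum_comp, Fintype.sum_sum_type,
      Fintype.sum_bool]
    simp only [← h5, orAbsEdge]
    simp only [bubbleLabel_inr]
    rw [two_mul]
    congr 1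
    exact Finset.sum_congr rfl fun i _ => by rw [bubbleLabel_inl, bubbleLabel_inl]; rfl
  have h10 := h7 (newEdgeLabel x k 0 2 (by decide))
  have h11 := h7 (newEdgeLabel x k 1 3 (by decide))
  refine ⟨by omega, ?_⟩
  unfold WeaklyBranched.epsExponent
  omega

end IsBubbleTransit

end Bubble

/-! ### State sums -/

section States

variable {N : ℕ} [NeZero N]

open scoped Classical in
theorem sum_factor {X Y : Type} [Fintype X] [DecidableEq X] [Fintype Y] [DecidableEq Y] (π : X → Y)
    (G : (X → Fin N) → ℂ) :
    ∑ σ : X → Fin N with (∀ x x', π x = π x' → σ x = σ x'), G σ =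
      ∑ υ : Y → Fin N with (∀ y, y ∉ Set.range π → υ y = 0), G fun x => υ (π x) := by
  symm
  refine Finset.sum_bij (fun υ _ x => υ (π x)) ?_ ?_ ?_ fun _ _ => rfl
  · intro υ _
    simp only [Finset.mem_filter, Finset.mem_univ, true_and]
    intro x x' h
    rw [h]
  · intro υ hυ υ' hυ' h
    simp only [Finset.mem_filter, Finset.mem_univ, true_and] at hυ hυ'
    funext y
    by_cases hy : y ∈ Set.range π
    · obtain ⟨x, rfl⟩ := hy
      exact congrFun h x
    · rw [hυ y hy, hυ' y hy]
  · intro σ hσ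
    simp only [Finset.mem_filter, Finset.mem_univ, true_and] at hσ
    refine ⟨fun y => if h : y ∈ Set.range π then σ h.choose else 0, ?_, ?_⟩
    · simp only [Finset.mem_filter, Finset.mem_univ, true_and]
      intro y hy
      exact dif_neg hy
    · funext x
      have hx : π x ∈ Set.range π := ⟨x, rfl⟩
      dsimp only
      rw [dif_pos hx]
      exact hσ _ _ hx.choose_spec

theorem WeaklyBranched.outgoing_glue {ι : Type} (T : WeaklyBranched ι) (x : ι × Fin 4) :
    T.Outgoing (T.glue x) ↔ ¬ T.Outgoing x := by
  unfold WeaklyBranched.Outgoing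
  rw [T.prebranching]
  rcases Int.units_eq_one_or (T.sign x.1 * (-1) ^ (x.2 : ℕ)) with h | h <;> rw [h] <;> decide

variable {ι : Type} [Fintype ι] [DecidableEq ι]

/-- The product of the face tensors at the faces outside `J`. -/
def RoughQH.faceProduct (T : RoughQH ι) (N : ℕ) (J : Finset (ι × Fin 4))
    (σ : ι × Fin 4 → Fin N) : ℂ :=
  ∏ x with T.Outgoing x ∧ x ∉ J, (matQ N ^ (T.rot x : ℕ)) (σ (T.glue x)) (σ x)

/-- The state sum without the normalization factor. -/
def RoughQH.rawSum (T : RoughQH ι) (N : ℕ) : ℂ :=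
  ∑ σ : ι × Fin 4 → Fin N, (∏ i, (T.dec i).tensor N (T.sign i) fun a => σ (i, a)) *
    T.faceProduct N ∅ σ

theorem RoughQH.stateSum_eq (T : RoughQH ι) (N : ℕ) : T.stateSum N = T.a N * T.rawSum N := by
  simp [stateSum, rawSum, faceProduct]

open scoped Classical in
theorem RoughQH.rawSum_eq (T : RoughQH ι) {Y : Type} [Fintype Y] [DecidableEq Y]
    (J : Finset (ι × Fin 4)) (hrot : ∀ x ∈ J, T.rot x = 0) (hglue : ∀ x ∈ J, T.glue x ∈ J)
    (π : ι × Fin 4 → Y) (hπ : ∀ x x', π x = π x' ↔ x = x' ∨ (x ∈ J ∧ x' = T.glue x)) :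
    T.rawSum N = ∑ υ : Y → Fin N with (∀ y, y ∉ Set.range π → υ y = 0),
      (∏ i, (T.dec i).tensor N (T.sign i) fun a => υ (π (i, a))) *
        T.faceProduct N J fun x => υ (π x) := by
  rw [← sum_factor π fun σ =>
    (∏ i, (T.dec i).tensor N (T.sign i) fun a => σ (i, a)) * T.faceProduct N J σ,
    Finset.sum_filter]
  refine Finset.sum_congr rfl fun σ _ => ?_
  have h1 : T.faceProduct N ∅ σ = (∏ x with T.Outgoing x ∧ x ∈ J,
      (matQ N ^ (T.rot x : ℕ)) (σ (T.glue x)) (σ x)) * T.faceProduct N J σ := by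
    unfold faceProduct
    rw [← Finset.prod_filter_mul_prod_filter_not _ (fun x => x ∈ J)]
    simp only [Finset.filter_filter, Finset.notMem_empty, not_false_eq_true, and_true]
  have h2 : (∏ x with T.Outgoing x ∧ x ∈ J, (matQ N ^ (T.rot x : ℕ)) (σ (T.glue x)) (σ x)) =
      if (∀ x x', π x = π x' → σ x = σ x') then 1 else 0 := by
    have h3 : (∀ x x', π x = π x' → σ x = σ x') ↔
        ∀ x ∈ Finset.univ.filter fun x => T.Outgoing x ∧ x ∈ J, σ (T.glue x) = σ x := by
      simp only [Finset.mem_filter, Finset.mem_univ, true_and, hπ]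
      constructor
      · intro h x hx
        exact (h x _ (Or.inr ⟨hx.2, rfl⟩)).symm
      · rintro h x x' (rfl | ⟨hx, rfl⟩)
        · rfl
        · by_cases ho : T.Outgoing x
          · exact (h x ⟨ho, hx⟩).symm
          · have := h (T.glue x) ⟨(T.outgoing_glue x).mpr ho, hglue x hx⟩
            rwa [T.glue_glue] at this
    rw [if_congr h3 rfl rfl]
    have h4 : ∀ x ∈ Finset.univ.filter fun x => T.Outgoing x ∧ x ∈ J,
        (matQ N ^ (T.rot x : ℕ)) (σ (T.glue x)) (σ x) = if σ (T.glue x) = σ x then 1 else 0 := by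
      intro x hx
      rw [Finset.mem_filter] at hx
      rw [hrot x hx.2.2]
      simp [Matrix.one_apply]
    rw [Finset.prod_congr rfl h4, Finset.prod_ite_zero]
    simp
  rw [h1, h2]
  split_ifs <;> simp

end States

/-! ### State sums in a `2 → 3` transit -/

section MPStates

variable {ι ι' κ : Type} {A B : Fin 5 → Prop} {φ : κ ⊕ {i // A i} ≃ ι} {φ' : κ ⊕ {i // B i} ≃ ι'}

/-- The labels of the faces. -/
def faceLabel (φ : κ ⊕ {i // A i} ≃ ι) (x : ι × Fin 4) : (κ × Fin 4) ⊕ Sym2 (Fin 5) :=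
  Sum.elim (fun k => .inl (k, x.2)) (fun i => .inr s(i.1, i.1.succAbove x.2)) (φ.symm x.1)

theorem faceLabel_inl (k : κ) (a : Fin 4) : faceLabel φ (φ (.inl k), a) = .inl (k, a) := by
  simp [faceLabel]

theorem faceLabel_inr (i : {i // A i}) (a : Fin 4) :
    faceLabel φ (φ (.inr i), a) = .inr s(i.1, i.1.succAbove a) := by
  simp [faceLabel]

theorem faceLabel_pos (i : {i // A i}) {j : Fin 5} (hij : i.1 ≠ j) :
    faceLabel φ (φ (.inr i), pos i j) = .inr s(i.1, j) := by
  rw [faceLabel_inr, succAbove_pos hij.symm]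

/-- The faces along which the new tetrahedra are glued to each other. -/
def IsInner (φ : κ ⊕ {i // A i} ≃ ι) (x : ι × Fin 4) : Prop :=
  ∃ i j : {i // A i}, i ≠ j ∧ x = (φ (.inr i), pos i j)

/-- The triangles on the boundary of the polyhedron. -/
def IsCrossing (A B : Fin 5 → Prop) (z : Sym2 (Fin 5)) : Prop := (∃ i ∈ z, A i) ∧ ∃ i ∈ z, B i

theorem OuterFace.faceLabel_eq {x : ι × Fin 4} {x' : ι' × Fin 4} (h : OuterFace φ φ' x x')
    (hAB : ∀ i, A i ↔ ¬ B i) : faceLabel φ x = faceLabel φ' x' := by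
  cases h with
  | common k a => rw [faceLabel_inl, faceLabel_inl]
  | boundary i j =>
    have hij : i.1 ≠ j.1 := fun h => (hAB i.1).mp i.2 (h ▸ j.2)
    rw [faceLabel_pos i hij, faceLabel_pos j hij.symm, Sym2.eq_swap]

theorem OuterFace.faceLabel_cases {x : ι × Fin 4} {x' : ι' × Fin 4} (h : OuterFace φ φ' x x')
    (hAB : ∀ i, A i ↔ ¬ B i) :
    (∃ y, faceLabel φ x = .inl y) ∨ ∃ z, IsCrossing A B z ∧ faceLabel φ x = .inr z := by
  cases h with
  | common k a => exact Or.inl ⟨_, faceLabel_inl k a⟩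
  | boundary i j =>
    have hij : i.1 ≠ j.1 := fun h => (hAB i.1).mp i.2 (h ▸ j.2)
    exact Or.inr ⟨_, ⟨⟨i, by simp, i.2⟩, ⟨j, by simp, j.2⟩⟩, faceLabel_pos i hij⟩

theorem OuterFace.not_isInner {x : ι × Fin 4} {x' : ι' × Fin 4} (h : OuterFace φ φ' x x')
    (hAB : ∀ i, A i ↔ ¬ B i) : ¬ IsInner φ x := by
  rintro ⟨i, j, hij, rfl⟩
  have hl := faceLabel_pos (φ := φ) i fun h' => hij (Subtype.ext h')
  rcases h.faceLabel_cases hAB with ⟨y, hy⟩ | ⟨z, hz, hy⟩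
  · rw [hl] at hy
    cases hy
  · rw [hl] at hy
    obtain rfl := Sum.inr_injective hy
    obtain ⟨-, l, hl, hB⟩ := hz
    rcases Sym2.mem_iff.mp hl with rfl | rfl
    · exact (hAB _).mp i.2 hB
    · exact (hAB _).mp j.2 hB

namespace Exchange

variable {T : WeaklyBranched ι} {T' : WeaklyBranched ι'}

theorem faceLabel_eq_iff (H : Exchange T T' φ φ') (x x' : ι × Fin 4) :
    faceLabel φ x = faceLabel φ x' ↔ x = x' ∨ (IsInner φ x ∧ x' = T.glue x) := by
  constructor
  · intro h
    obtain ⟨t, a⟩ := x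
    obtain ⟨t', a'⟩ := x'
    obtain ⟨t, rfl⟩ := φ.surjective t
    obtain ⟨t', rfl⟩ := φ.surjective t'
    rcases t with k | i <;> rcases t' with k' | i'
    · rw [faceLabel_inl, faceLabel_inl] at h
      simp only [Sum.inl.injEq, Prod.mk.injEq] at h
      obtain ⟨rfl, rfl⟩ := h
      exact Or.inl rfl
    · rw [faceLabel_inl, faceLabel_inr] at h
      cases h
    · rw [faceLabel_inl, faceLabel_inr] at h
      cases h
    · rw [faceLabel_inr, faceLabel_inr] at h
      rcases Sym2.eq_iff.mp (Sum.inr_injective h) with ⟨h1, h2⟩ | ⟨h1, h2⟩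
      · obtain rfl := Subtype.ext h1
        rw [Fin.succAbove_right_injective h2]
        exact Or.inl rfl
      · right
        have hi : i ≠ i' := by
          rintro rfl
          exact Fin.succAbove_ne _ _ h2
        have ha : a = pos i i' := by rw [← h2, pos_succAbove]
        have ha' : a' = pos i' i := by rw [h1, pos_succAbove]
        subst ha ha'
        exact ⟨⟨i, i', hi, rfl⟩, (H.inner i i' hi).1.symm⟩
  · rintro (rfl | ⟨⟨i, j, hij, rfl⟩, rfl⟩)
    · rfl
    · rw [(H.inner i j hij).1, faceLabel_pos i fun h => hij (Subtype.ext h),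
        faceLabel_pos j fun h => hij (Subtype.ext h.symm), Sym2.eq_swap]

theorem mem_range_faceLabel (z : Sym2 (Fin 5)) :
    .inr z ∈ Set.range (faceLabel φ) ↔ ¬ z.IsDiag ∧ ∃ i ∈ z, A i := by
  constructor
  · rintro ⟨⟨t, a⟩, h⟩
    obtain ⟨t, rfl⟩ := φ.surjective t
    rcases t with k | i
    · rw [faceLabel_inl] at h
      cases h
    · rw [faceLabel_inr] at h
      obtain rfl := Sum.inr_injective h
      exact ⟨fun h => Fin.succAbove_ne _ _ (Sym2.mk_isDiag_iff.mp h).symm, i, by simp, i.2⟩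
  · rintro ⟨hz, i, hi, hA⟩
    obtain ⟨j, rfl⟩ := Sym2.mem_iff_exists.mp hi
    rw [Sym2.mk_isDiag_iff] at hz
    exact ⟨_, faceLabel_pos ⟨i, hA⟩ hz⟩

open scoped Classical in
@[to_additive]
theorem prod_outer {M : Type} [CommMonoid M] [Fintype ι] [Fintype ι'] (H : Exchange T T' φ φ')
    (hout : ∀ x x', OuterFace φ φ' x x' → (T.Outgoing x ↔ T'.Outgoing x'))
    (f : ι × Fin 4 → M) (f' : ι' × Fin 4 → M) (hf : ∀ x x', OuterFace φ φ' x x' → f x = f' x') :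
    ∏ x with T.Outgoing x ∧ ¬ IsInner φ x, f x = ∏ x with T'.Outgoing x ∧ ¬ IsInner φ' x, f' x := by
  have hex : ∀ x ∈ Finset.univ.filter fun x => T.Outgoing x ∧ ¬ IsInner φ x,
      ∃ x', OuterFace φ φ' x x' := fun x hx =>
    (face_cases φ φ' H.compl x).resolve_left (Finset.mem_filter.mp hx).2.2
  refine Finset.prod_bij (fun x hx => (hex x hx).choose) ?_ ?_ ?_
    fun x hx => hf _ _ (hex x hx).choose_spec
  · intro x hx
    have h := (hex x hx).choose_spec
    rw [Finset.mem_filter] at hx ⊢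
    exact ⟨Finset.mem_univ _, (hout _ _ h).mp hx.2.1, h.symm.not_isInner H.symm.compl⟩
  · intro x hx y hy hxy
    have h1 := (hex x hx).choose_spec
    have h2 := (hex y hy).choose_spec
    rw [← hxy] at h2
    have h3 := (h1.faceLabel_eq H.compl).trans (h2.faceLabel_eq H.compl).symm
    refine ((H.faceLabel_eq_iff _ _).mp h3).resolve_right fun h => ?_
    exact (Finset.mem_filter.mp hx).2.2 h.1
  · intro x' hx'
    rw [Finset.mem_filter] at hx'
    obtain ⟨x, hx⟩ := (face_cases φ' φ H.symm.compl x').resolve_left hx'.2.2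
    have hx0 := hx.symm
    have hmem : x ∈ Finset.univ.filter fun x => T.Outgoing x ∧ ¬ IsInner φ x :=
      Finset.mem_filter.mpr ⟨Finset.mem_univ _, (hout _ _ hx0).mpr hx'.2.1,
        hx0.not_isInner H.compl⟩
    refine ⟨x, hmem, ?_⟩
    have h2 := (hex x hmem).choose_spec
    have h3 := (h2.faceLabel_eq H.compl).symm.trans (hx0.faceLabel_eq H.compl)
    refine ((H.symm.faceLabel_eq_iff _ _).mp h3.symm).elim Eq.symm fun h => ?_
    exact absurd h.1 hx'.2.2

end Exchange

end MPStates

section MPSum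

variable {N : ℕ} [NeZero N] {ι ι' κ : Type} {A B : Fin 5 → Prop} {φ : κ ⊕ {i // A i} ≃ ι}
  {φ' : κ ⊕ {i // B i} ≃ ι'}

open scoped Classical in
theorem sum_boundary (hAB : ∀ i, A i ↔ ¬ B i) (F : (Sym2 (Fin 5) → Fin N) → ℂ) :
    ∑ σ : Sym2 (Fin 5) → Fin N with (∀ z, ¬ (¬ z.IsDiag ∧ ∃ i ∈ z, A i) → σ z = 0), F σ =
      ∑ τ : Sym2 (Fin 5) → Fin N with (∀ z, ¬ IsCrossing A B z → τ z = 0),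
        ∑ σ : Sym2 (Fin 5) → Fin N with (∀ z, (z.IsDiag ∨ ∃ i ∈ z, B i) → σ z = τ z), F σ := by
  have hdiag : ∀ z, IsCrossing A B z → ¬ z.IsDiag := by
    rintro z ⟨⟨i, hi, hA⟩, j, hj, hB'⟩ hz
    induction z using Sym2.ind with | _ a b => ?_
    rw [Sym2.mk_isDiag_iff] at hz
    subst hz
    simp only [Sym2.mem_iff, or_self] at hi hj
    subst hi hj
    exact (hAB _).mp hA hB'
  rw [← Finset.sum_fiberwise_of_maps_to
    (g := fun (σ : Sym2 (Fin 5) → Fin N) z => if IsCrossing A B z then σ z else 0)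
    (t := Finset.univ.filter fun τ => ∀ z, ¬ IsCrossing A B z → τ z = 0)]
  · refine Finset.sum_congr rfl fun τ hτ => ?_
    rw [Finset.mem_filter] at hτ
    rw [Finset.filter_filter]
    congr 1
    ext σ
    simp only [Finset.mem_filter, Finset.mem_univ, true_and]
    constructor
    · rintro ⟨h1, rfl⟩ z hz
      by_cases hc : IsCrossing A B z
      · exact (if_pos hc).symm
      · exact (h1 z fun h => hc ⟨h.2, hz.resolve_left h.1⟩).trans (if_neg hc).symm
    · intro h
      have hc : ∀ z, ¬ (¬ z.IsDiag ∧ ∃ i ∈ z, A i) → σ z = 0 := by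
        intro z hz
        rw [h z, hτ.2 z fun h => hz ⟨hdiag z h, h.1⟩]
        by_contra hn
        rw [not_or] at hn
        refine hz ⟨hn.1, ?_⟩
        induction z using Sym2.ind with | _ a b => ?_
        exact ⟨a, by simp, (hAB a).mpr fun ha => hn.2 ⟨a, by simp, ha⟩⟩
      refine ⟨hc, funext fun z => ?_⟩
      split_ifs with hz
      · exact h z (Or.inr hz.2)
      · exact (hτ.2 z hz).symm
  · intro σ _
    simp only [Finset.mem_filter, Finset.mem_univ, true_and]
    intro z hz
    exact if_neg hz

open scoped Classical in
theorem Exchange.rawSum_eq [Fintype ι] [DecidableEq ι] [Fintype κ] {T : RoughQH ι} {T' : RoughQH ι'}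
    (H : Exchange T.toWeaklyBranched T'.toWeaklyBranched φ φ') (S : Finset (Fin 5))
    (hS : ∀ i, i ∈ S ↔ A i) (D : Fin 5 → Decoration) (ε : Fin 5 → ℤˣ)
    (hD : ∀ i : {i // A i}, T.dec (φ (.inr i)) = D i)
    (hε : ∀ i : {i // A i}, T.sign (φ (.inr i)) = ε i) :
    T.rawSum N = ∑ ρ : κ × Fin 4 → Fin N,
      ∑ τ : Sym2 (Fin 5) → Fin N with (∀ z, ¬ IsCrossing A B z → τ z = 0),
        ((∏ k, (T.dec (φ (.inl k))).tensor N (T.sign (φ (.inl k))) fun a => ρ (k, a)) *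
          T.faceProduct N (Finset.univ.filter (IsInner φ))
            fun x => Sum.elim ρ τ (faceLabel φ x)) * localContraction N D ε S τ := by
  rw [T.rawSum_eq (Finset.univ.filter (IsInner φ)) ?_ ?_ (faceLabel φ)
    fun x x' => by rw [H.faceLabel_eq_iff]; simp]
  · rw [Finset.sum_filter,
      ← (Equiv.sumArrowEquivProdArrow (κ × Fin 4) (Sym2 (Fin 5)) (Fin N)).symm.sum_comp,
      Fintype.sum_prod_type]
    refine Finset.sum_congr rfl fun ρ _ => ?_
    have hcond : ∀ σ : Sym2 (Fin 5) → Fin N,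
        (∀ y, y ∉ Set.range (faceLabel φ) → Sum.elim ρ σ y = 0) ↔
          ∀ z : Sym2 (Fin 5), ¬ (¬ z.IsDiag ∧ ∃ i ∈ z, A i) → σ z = 0 := by
      intro σ
      constructor
      · intro h z hz
        exact h (.inr z) (by rwa [mem_range_faceLabel])
      · rintro h (⟨k, a⟩ | z) hy
        · exact absurd ⟨_, faceLabel_inl k a⟩ hy
        · exact h z (by rwa [mem_range_faceLabel] at hy)
    change ∑ σ : Sym2 (Fin 5) → Fin N, (if (∀ y, y ∉ Set.range (faceLabel φ) →
      Sum.elim ρ σ y = 0) then (∏ t, (T.dec t).tensor N (T.sign t) fun a =>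
        Sum.elim ρ σ (faceLabel φ (t, a))) * T.faceProduct N (Finset.univ.filter (IsInner φ))
          (fun x => Sum.elim ρ σ (faceLabel φ x)) else 0) = _
    simp only [hcond]
    rw [← Finset.sum_filter, sum_boundary H.compl]
    refine Finset.sum_congr rfl fun τ _ => ?_
    rw [localContraction, Finset.mul_sum]
    refine Finset.sum_congr (Finset.filter_congr fun σ _ => ?_) fun σ hσ => ?_
    · simp only [hS, H.compl, not_not]
    · simp only [Finset.mem_filter, Finset.mem_univ, true_and] at hσ
      have hface : ∀ x, ¬ IsInner φ x →
          Sum.elim ρ σ (faceLabel φ x) = Sum.elim ρ τ (faceLabel φ x) := by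
        intro x hx
        obtain ⟨x', hx'⟩ := (face_cases φ φ' H.compl x).resolve_left hx
        rcases hx'.faceLabel_cases H.compl with ⟨y, hy⟩ | ⟨z, hz, hy⟩
        · rw [hy]
          rfl
        · rw [hy]
          refine hσ z (Or.inr ?_)
          obtain ⟨i, hi, hB⟩ := hz.2
          exact ⟨i, hi, fun h => (H.compl i).mp ((hS i).mp h) hB⟩
      rw [prod_exchange φ, Finset.prod_subtype S hS, mul_right_comm]
      congr 1
      · congr 1
        · refine Finset.prod_congr rfl fun k _ => ?_
          simp only [faceLabel_inl, Sum.elim_inl]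
        · refine Finset.prod_congr rfl fun x hx => ?_
          have hx2 : ¬ IsInner φ x := by
            simpa using (Finset.mem_filter.mp hx).2.2
          have hx3 : ¬ IsInner φ (T.glue x) := by
            rintro ⟨i, j, hij, h⟩
            refine hx2 ⟨j, i, hij.symm, ?_⟩
            rw [← (H.inner i j hij).1, ← h, T.glue_glue]
          dsimp only
          rw [hface _ hx2, hface _ hx3]
      · refine Finset.prod_congr rfl fun i _ => ?_
        simp only [faceLabel_inr, Sum.elim_inr, hD, hε]
  · intro x hx
    obtain ⟨i, j, hij, rfl⟩ := (Finset.mem_filter.mp hx).2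
    exact (H.inner i j hij).2
  · intro x hx
    obtain ⟨i, j, hij, rfl⟩ := (Finset.mem_filter.mp hx).2
    rw [(H.inner i j hij).1]
    exact Finset.mem_filter.mpr ⟨Finset.mem_univ _, j, i, hij.symm, rfl⟩

variable {P : Finset (Fin 5)} {s : ℤˣ} {ψ : κ ⊕ {i // i ∈ P} ≃ ι} {ψ' : κ ⊕ {i // i ∉ P} ≃ ι'}

theorem IsMPTransit.outgoing_iff {T : RoughQH ι} {T' : RoughQH ι'}
    (H : IsMPTransit T T' P s ψ ψ') {x : ι × Fin 4} {x' : ι' × Fin 4} (h : OuterFace ψ ψ' x x') :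
    T.Outgoing x ↔ T'.Outgoing x' := by
  unfold WeaklyBranched.Outgoing
  cases h with
  | common k a => simp only [H.sign_common]
  | boundary i j =>
    have hij : i.1 ≠ j.1 := fun h => j.2 (h ▸ i.2)
    have hs : ∀ i j : Fin 5, i ≠ j → (-1 : ℤˣ) ^ (i : ℕ) * (-1) ^ (pos i j : ℕ) =
        -((-1) ^ (j : ℕ) * (-1) ^ (pos j i : ℕ)) := by decide
    simp only [H.sign_left, H.sign_right, localSign, if_pos i.2, if_neg j.2]
    rw [mul_assoc, hs i j hij, neg_mul, mul_assoc, mul_neg]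

theorem eps_zpow_eq (N : ℕ) {a b : ℤ} (h : 2 ∣ a - b) : eps N ^ a = eps N ^ b := by
  obtain ⟨c, hc⟩ := h
  have h0 : eps N ≠ 0 := by
    unfold eps
    simp
  have h2 : eps N ^ (2 : ℤ) = 1 := by
    unfold eps
    norm_cast
    rw [← pow_mul, mul_comm, pow_mul]
    simp
  rw [show a = b + 2 * c by omega, zpow_add₀ h0, zpow_mul, h2, one_zpow, mul_one]

open scoped Classical in
theorem IsMPTransit.q_eq [Fintype ι] [Fintype ι'] {T : RoughQH ι} {T' : RoughQH ι'}
    (H : IsMPTransit T T' P s ψ ψ') : T.q = T'.q := by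
  have key := H.exchange.sum_outer (fun x x' h => H.outgoing_iff h)
    (fun x => if T.rot x = 2 then 1 else 0) (fun x => if T'.rot x = 2 then 1 else 0)
    (fun x x' h => by rw [(H.exchange.outer _ _ h).2])
  rw [← Finset.sum_filter, ← Finset.sum_filter, Finset.sum_const, Finset.sum_const,
    smul_eq_mul, smul_eq_mul, mul_one, mul_one, Finset.filter_filter, Finset.filter_filter] at key
  unfold WeaklyBranched.q
  convert key using 3
  · refine ⟨fun h => ⟨⟨h.1, ?_⟩, h.2⟩, fun h => ⟨h.1.1, h.2⟩⟩
    rintro ⟨i, j, hij, rfl⟩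
    have := h.2
    rw [(H.inner_left i j hij).2] at this
    exact absurd this (by decide)
  · refine ⟨fun h => ⟨⟨h.1, ?_⟩, h.2⟩, fun h => ⟨h.1.1, h.2⟩⟩
    rintro ⟨i, j, hij, rfl⟩
    have := h.2
    rw [(H.inner_right i j hij).2] at this
    exact absurd this (by decide)

theorem IsMPTransit.a_eq [Fintype ι] [Fintype ι'] (N : ℕ) {T : RoughQH ι} {T' : RoughQH ι'}
    (H : IsMPTransit T T' P s ψ ψ') (hT : T.IsTriangulation) (hT' : T'.IsTriangulation) :
    T'.a N = T.a N := by
  obtain ⟨h1, h2⟩ := H.euler hT hT'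
  have h3 := eps_zpow_eq N h2
  unfold WeaklyBranched.epsExponent at h3
  rw [RoughQH.a, RoughQH.a, h3, h1, H.q_eq]

theorem IsMPTransit.eqMod [Fintype ι] [DecidableEq ι] [Fintype ι'] [DecidableEq ι'] (hodd : Odd N)
    {T : RoughQH ι} {T' : RoughQH ι'}
    (H : IsMPTransit T T' P s ψ ψ') (hT : T.IsTriangulation) (hT' : T'.IsTriangulation) :
    EqMod N (T.stateSum N) (T'.stateSum N) := by
  classical
  have := Fintype.ofInjective (fun k => ψ (.inl k)) (ψ.injective.comp Sum.inl_injective)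
  have HL := H.dec_local
  set D : Fin 5 → Decoration := fun i =>
    if hi : i ∈ P then T.dec (ψ (.inr ⟨i, hi⟩)) else T'.dec (ψ' (.inr ⟨i, hi⟩)) with hDdef
  have hD : ∀ i : {i // i ∈ P}, T.dec (ψ (.inr i)) = D i := by
    rintro ⟨i, hi⟩
    simp [hDdef, hi]
  have hD' : ∀ i : {i // i ∉ P}, T'.dec (ψ' (.inr i)) = D i := by
    rintro ⟨i, hi⟩
    simp [hDdef, hi]
  obtain ⟨n, hn⟩ := claim_all hodd P s HL.1 D HL
  refine ⟨n, ?_⟩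
  rw [T.stateSum_eq, T'.stateSum_eq, H.a_eq N hT hT', mul_left_comm]
  congr 1
  have hx := H.exchange
  rw [hx.rawSum_eq P (fun _ => Iff.rfl) D (localSign P s) hD H.sign_left,
    hx.symm.rawSum_eq Pᶜ (fun _ => Finset.mem_compl) D (localSign P s) hD' H.sign_right,
    Finset.mul_sum]
  refine Finset.sum_congr rfl fun ρ _ => ?_
  rw [Finset.mul_sum]
  refine Finset.sum_congr (Finset.filter_congr fun τ _ => ?_) fun τ _ => ?_
  · simp only [IsCrossing, and_comm]
  · rw [hn τ, mul_left_comm]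
    congr 2
    congr 1
    · refine Finset.prod_congr rfl fun k _ => ?_
      rw [H.dec_common, H.sign_common]
    · have key := hx.prod_outer (fun x x' h => H.outgoing_iff h)
        (fun x => (matQ N ^ (T.rot x : ℕ)) (Sum.elim ρ τ (faceLabel ψ (T.glue x)))
          (Sum.elim ρ τ (faceLabel ψ x)))
        (fun x => (matQ N ^ (T'.rot x : ℕ)) (Sum.elim ρ τ (faceLabel ψ' (T'.glue x)))
          (Sum.elim ρ τ (faceLabel ψ' x)))
        (fun x x' h => by
          rw [(hx.outer _ _ h).2, h.faceLabel_eq hx.compl,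
            (hx.outer _ _ h).1.faceLabel_eq hx.compl])
      unfold RoughQH.faceProduct
      simpa using key

end MPSum

/-! ### State sums in a bubble transit -/

section BubbleSum

variable {ι ι' : Type} {x : ι × Fin 4} {k : Fin 4} {e : Fin 3} {φ : ι ⊕ Bool ≃ ι'}

open scoped Classical in
/-- The labels of the faces after a bubble transit. -/
def bubbleFace (x : ι × Fin 4) (k : Fin 4) (φ : ι ⊕ Bool ≃ ι') (z : ι' × Fin 4) :
    (ι × Fin 4) ⊕ Fin 4 :=
  Sum.elim (fun i => .inl (i, z.2))
    (fun β => if β = false ∧ z.2 = k then .inl x else .inr z.2) (φ.symm z.1)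

theorem bubbleFace_inl (i : ι) (a : Fin 4) : bubbleFace x k φ (φ (.inl i), a) = .inl (i, a) := by
  simp [bubbleFace]

theorem bubbleFace_false (a : Fin 4) : bubbleFace x k φ (φ (.inr false), a) =
    if a = k then .inl x else .inr a := by
  simp [bubbleFace]

theorem bubbleFace_true (a : Fin 4) : bubbleFace x k φ (φ (.inr true), a) = .inr a := by
  simp [bubbleFace]

theorem bubbleFace_surjective : Function.Surjective (bubbleFace x k φ) := by
  rintro (⟨i, a⟩ | a)
  · exact ⟨_, bubbleFace_inl i a⟩
  · exact ⟨_, bubbleFace_true a⟩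

open scoped Classical in
/-- The face after a bubble transit which corresponds to a given one; the face `x` corresponds to
the free face of the second new tetrahedron. -/
def outerFace (x : ι × Fin 4) (k : Fin 4) (φ : ι ⊕ Bool ≃ ι') (y : ι × Fin 4) : ι' × Fin 4 :=
  if y = x then (φ (.inr true), k) else (φ (.inl y.1), y.2)

theorem outerFace_self : outerFace x k φ x = (φ (.inr true), k) := if_pos rfl

theorem outerFace_of_ne {y : ι × Fin 4} (h : y ≠ x) :
    outerFace x k φ y = (φ (.inl y.1), y.2) := if_neg h

theorem outerFace_injective : Function.Injective (outerFace x k φ) := by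
  intro y y' h
  by_cases hy : y = x <;> by_cases hy' : y' = x
  · rw [hy, hy']
  · subst hy
    rw [outerFace_self, outerFace_of_ne hy'] at h
    simp at h
  · subst hy'
    rw [outerFace_self, outerFace_of_ne hy] at h
    simp at h
  · rw [outerFace_of_ne hy, outerFace_of_ne hy'] at h
    simp only [Prod.mk.injEq, EmbeddingLike.apply_eq_iff_eq, Sum.inl.injEq] at h
    exact Prod.ext h.1 h.2

namespace IsBubbleTransit

variable {T : RoughQH ι} {T' : RoughQH ι'}

theorem glue_outerFace (H : IsBubbleTransit T T' x k e φ) (y : ι × Fin 4) :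
    T'.glue (outerFace x k φ y) = outerFace x k φ (T.glue y) ∧
      T'.rot (outerFace x k φ y) = T.rot y := by
  by_cases hy : y = x
  · subst hy
    rw [outerFace_self, outerFace_of_ne (T.glue_ne y)]
    exact H.outer_B
  · rw [outerFace_of_ne hy]
    by_cases hy' : y = T.glue x
    · subst hy'
      rw [T.glue_glue, outerFace_self]
      exact H.outer_B_symm
    · rw [outerFace_of_ne]
      · exact H.outer y hy hy'
      · rintro rfl
        exact hy' (T.glue_glue y).symm

theorem outgoing_outerFace (H : IsBubbleTransit T T' x k e φ) (y : ι × Fin 4) :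
    T'.Outgoing (outerFace x k φ y) ↔ T.Outgoing y := by
  by_cases hy : y = x
  · subst hy
    rw [outerFace_self]
    have h := T'.prebranching (φ (.inl y.1), y.2)
    rw [H.outer_A.1] at h
    unfold WeaklyBranched.Outgoing
    dsimp only at h ⊢
    rw [H.sign_new, neg_mul, h, neg_neg, H.sign_common]
  · rw [outerFace_of_ne hy]
    unfold WeaklyBranched.Outgoing
    dsimp only
    rw [H.sign_common]

theorem rot_eq_zero (H : IsBubbleTransit T T' x k e φ) {z : ι' × Fin 4}
    (hz : z ∉ Set.range (outerFace x k φ)) : T'.rot z = 0 := by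
  obtain ⟨t, a⟩ := z
  obtain ⟨t, rfl⟩ := φ.surjective t
  rcases t with i | β
  · by_cases h : (i, a) = x
    · subst h
      exact H.outer_A.2
    · exact absurd ⟨_, outerFace_of_ne h⟩ hz
  · by_cases ha : a = k
    · subst ha
      cases β
      · exact H.outer_A_symm.2
      · exact absurd ⟨_, outerFace_self⟩ hz
    · cases β
      · exact (H.inner a ha).2
      · exact (H.inner_symm ha).2

theorem glue_notMem_range (H : IsBubbleTransit T T' x k e φ) {z : ι' × Fin 4}
    (hz : z ∉ Set.range (outerFace x k φ)) : T'.glue z ∉ Set.range (outerFace x k φ) := by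
  rintro ⟨y, hy⟩
  refine hz ⟨T.glue y, ?_⟩
  rw [← (H.glue_outerFace y).1, hy, T'.glue_glue]

theorem bubbleFace_eq_iff (H : IsBubbleTransit T T' x k e φ) (z z' : ι' × Fin 4) :
    bubbleFace x k φ z = bubbleFace x k φ z' ↔
      z = z' ∨ (z ∉ Set.range (outerFace x k φ) ∧ z' = T'.glue z) := by
  have hx : (φ (.inl x.1), x.2) ∉ Set.range (outerFace x k φ) := by
    rintro ⟨y, hy⟩
    by_cases h : y = x
    · subst h
      rw [outerFace_self] at hy
      simp at hy
    · rw [outerFace_of_ne h] at hy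
      simp only [Prod.mk.injEq, EmbeddingLike.apply_eq_iff_eq, Sum.inl.injEq] at hy
      exact h (Prod.ext hy.1 hy.2)
  have hA : ∀ a, (φ (.inr false), a) ∉ Set.range (outerFace x k φ) := by
    rintro a ⟨y, hy⟩
    by_cases h : y = x
    · subst h
      rw [outerFace_self] at hy
      simp at hy
    · rw [outerFace_of_ne h] at hy
      simp at hy
  have hB : ∀ a, a ≠ k → (φ (.inr true), a) ∉ Set.range (outerFace x k φ) := by
    intro a ha
    rw [← (H.inner a ha).1]
    exact H.glue_notMem_range (hA a)
  constructor
  · intro h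
    obtain ⟨t, a⟩ := z
    obtain ⟨t', a'⟩ := z'
    obtain ⟨t, rfl⟩ := φ.surjective t
    obtain ⟨t', rfl⟩ := φ.surjective t'
    rcases t with i | _ | _ <;> rcases t' with i' | _ | _ <;>
      simp only [bubbleFace_inl, bubbleFace_false, bubbleFace_true] at h
    · simp only [Sum.inl.injEq, Prod.mk.injEq] at h
      rw [h.1, h.2]
      exact Or.inl rfl
    · split_ifs at h with ha
      subst ha
      obtain rfl := Sum.inl_injective h
      exact Or.inr ⟨hx, H.outer_A.1.symm⟩
    · cases h
    · split_ifs at h with ha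
      subst ha
      obtain rfl := Sum.inl_injective h
      exact Or.inr ⟨hA _, H.outer_A_symm.1.symm⟩
    · left
      split_ifs at h with ha ha'
      · rw [ha, ha']
      · rw [Sum.inr_injective h]
    · split_ifs at h with ha
      rw [← Sum.inr_injective h]
      exact Or.inr ⟨hA _, (H.inner a ha).1.symm⟩
    · cases h
    · split_ifs at h with ha
      rw [Sum.inr_injective h]
      exact Or.inr ⟨hB _ ha, (H.inner_symm ha).1.symm⟩
    · rw [Sum.inr_injective h]
      exact Or.inl rfl
  · rintro (rfl | ⟨hz, rfl⟩)
    · rfl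
    · obtain ⟨t, a⟩ := z
      obtain ⟨t, rfl⟩ := φ.surjective t
      rcases t with i | β
      · by_cases h : (i, a) = x
        · subst h
          rw [H.outer_A.1, bubbleFace_inl, bubbleFace_false, if_pos rfl]
        · exact absurd ⟨_, outerFace_of_ne h⟩ hz
      · by_cases ha : a = k
        · subst ha
          cases β
          · rw [H.outer_A_symm.1, bubbleFace_inl, bubbleFace_false, if_pos rfl]
          · exact absurd ⟨_, outerFace_self⟩ hz
        · cases β
          · rw [(H.inner a ha).1, bubbleFace_true, bubbleFace_false, if_neg ha]
          · rw [(H.inner_symm ha).1, bubbleFace_true, bubbleFace_false, if_neg ha]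

open scoped Classical in
@[to_additive]
theorem prod_outer {M : Type} [CommMonoid M] [Fintype ι] [Fintype ι']
    (H : IsBubbleTransit T T' x k e φ) (f : ι' × Fin 4 → M) :
    ∏ z with T'.Outgoing z ∧ z ∈ Set.range (outerFace x k φ), f z =
      ∏ y with T.Outgoing y, f (outerFace x k φ y) := by
  symm
  refine Finset.prod_bij (fun y _ => outerFace x k φ y) ?_
    (fun _ _ _ _ h => outerFace_injective h) ?_ fun _ _ => rfl
  · intro y hy
    rw [Finset.mem_filter] at hy ⊢
    exact ⟨Finset.mem_univ _, (H.outgoing_outerFace y).mpr hy.2, y, rfl⟩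
  · intro z hz
    rw [Finset.mem_filter] at hz
    obtain ⟨-, hz, y, rfl⟩ := hz
    exact ⟨y, Finset.mem_filter.mpr ⟨Finset.mem_univ _, (H.outgoing_outerFace y).mp hz⟩, rfl⟩

open scoped Classical in
theorem q_eq [Fintype ι] [Fintype ι'] (H : IsBubbleTransit T T' x k e φ) : T'.q = T.q := by
  have key := H.sum_outer fun z => if T'.rot z = 2 then 1 else 0
  simp only [H.glue_outerFace] at key
  rw [← Finset.sum_filter, ← Finset.sum_filter, Finset.sum_const, Finset.sum_const,
    smul_eq_mul, smul_eq_mul, mul_one, mul_one, Finset.filter_filter, Finset.filter_filter] at key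
  unfold WeaklyBranched.q
  convert key using 3
  refine ⟨fun h => ⟨⟨h.1, ?_⟩, h.2⟩, fun h => ⟨h.1.1, h.2⟩⟩
  by_contra hz
  have := h.2
  rw [H.rot_eq_zero hz] at this
  exact absurd this (by decide)

theorem natCast_mul_a [Fintype ι] [Fintype ι'] (N : ℕ) [NeZero N]
    (H : IsBubbleTransit T T' x k e φ) (hT : T.IsTriangulation) (hT' : T'.IsTriangulation) :
    T'.a N * N = T.a N := by
  obtain ⟨h1, h2⟩ := H.euler hT hT'
  have h3 := eps_zpow_eq N h2
  unfold WeaklyBranched.epsExponent at h3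
  have hN : (N : ℂ) ≠ 0 := Nat.cast_ne_zero.mpr (NeZero.ne N)
  rw [RoughQH.a, RoughQH.a, h3, h1, H.q_eq]
  push_cast
  rw [neg_add, zpow_add₀ hN, zpow_neg_one]
  field_simp

theorem sum_bubble {N : ℕ} (s : ℤˣ) (k : Fin 4) (D D' : Decoration) (α β : Fin N) :
    ∑ γ : Fin 4 → Fin N with γ k = β, D.tensor N s (Function.update γ k α) * D'.tensor N (-s) γ =
      bubbleContraction N s k D D' α β := by
  unfold bubbleContraction
  refine Finset.sum_bij' (fun γ _ => Function.update γ k α) (fun σ _ => Function.update σ k β)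
    ?_ ?_ ?_ ?_ ?_
  · simp
  · simp
  · intro γ hγ
    rw [Function.update_idem, ← (Finset.mem_filter.mp hγ).2, Function.update_eq_self]
  · intro σ hσ
    rw [Function.update_idem, ← (Finset.mem_filter.mp hσ).2, Function.update_eq_self]
  · intro γ hγ
    rw [Function.update_idem, ← (Finset.mem_filter.mp hγ).2, Function.update_eq_self]

variable {N : ℕ} [NeZero N]

open scoped Classical in
theorem rawSum_eq [Fintype ι] [DecidableEq ι] [Fintype ι'] [DecidableEq ι']
    (H : IsBubbleTransit T T' x k e φ) :
    T'.rawSum N = ∑ ρ : ι × Fin 4 → Fin N, ∑ β : Fin N,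
      ((∏ i, (T.dec i).tensor N (T.sign i) fun a => ρ (i, a)) *
        T.faceProduct N ∅ (Function.update ρ x β)) *
        bubbleContraction N (T'.sign (φ (.inr false))) k (T'.dec (φ (.inr false)))
          (T'.dec (φ (.inr true))) (ρ x) β := by
  rw [T'.rawSum_eq (Finset.univ.filter fun z => z ∉ Set.range (outerFace x k φ)) ?_ ?_
    (bubbleFace x k φ) fun z z' => by rw [H.bubbleFace_eq_iff]; simp]
  · rw [Finset.filter_true_of_mem fun υ _ y hy => absurd (bubbleFace_surjective y) hy,
      ← (Equiv.sumArrowEquivProdArrow (ι × Fin 4) (Fin 4) (Fin N)).symm.sum_comp,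
      Fintype.sum_prod_type]
    refine Finset.sum_congr rfl fun ρ _ => ?_
    rw [← Finset.sum_fiberwise Finset.univ fun γ : Fin 4 → Fin N => γ k]
    refine Finset.sum_congr rfl fun β _ => ?_
    rw [← sum_bubble, Finset.mul_sum]
    refine Finset.sum_congr rfl fun γ hγ => ?_
    change (∏ t, (T'.dec t).tensor N (T'.sign t) fun a =>
      Sum.elim ρ γ (bubbleFace x k φ (t, a))) * T'.faceProduct N _
        (fun z => Sum.elim ρ γ (bubbleFace x k φ z)) = _
    have hβ : γ k = β := (Finset.mem_filter.mp hγ).2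
    have h1 : T'.faceProduct N (Finset.univ.filter fun z => z ∉ Set.range (outerFace x k φ))
        (fun z => Sum.elim ρ γ (bubbleFace x k φ z)) =
        T.faceProduct N ∅ (Function.update ρ x β) := by
      have h2 : ∀ y, Sum.elim ρ γ (bubbleFace x k φ (outerFace x k φ y)) =
          Function.update ρ x β y := by
        intro y
        by_cases hy : y = x
        · subst hy
          rw [outerFace_self, bubbleFace_true, Function.update_self, ← hβ]
          rfl
        · rw [outerFace_of_ne hy, bubbleFace_inl, Function.update_of_ne hy]
          rfl
      have key := H.prod_outer fun z => (matQ N ^ (T'.rot z : ℕ))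
        (Sum.elim ρ γ (bubbleFace x k φ (T'.glue z))) (Sum.elim ρ γ (bubbleFace x k φ z))
      simp only [H.glue_outerFace, h2] at key
      unfold RoughQH.faceProduct
      simpa using key
    rw [h1, ← φ.prod_comp, Fintype.prod_sum_type, Fintype.prod_bool]
    simp only [bubbleFace_inl, bubbleFace_true, bubbleFace_false, H.dec_common, H.sign_common,
      H.sign_new, Sum.elim_inl, Sum.elim_inr]
    have h3 : (fun a => Sum.elim ρ γ (if a = k then .inl x else .inr a)) =
        Function.update γ k (ρ x) := by
      funext a
      by_cases ha : a = k
      · subst ha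
        simp
      · simp [ha]
    rw [h3]
    ring
  · intro z hz
    exact H.rot_eq_zero (Finset.mem_filter.mp hz).2
  · intro z hz
    exact Finset.mem_filter.mpr ⟨Finset.mem_univ _, H.glue_notMem_range (Finset.mem_filter.mp hz).2⟩

theorem eqMod [Fintype ι] [DecidableEq ι] [Fintype ι'] [DecidableEq ι'] (hodd : Odd N)
    (H : IsBubbleTransit T T' x k e φ) (hT : T.IsTriangulation) (hT' : T'.IsTriangulation) :
    EqMod N (T'.stateSum N) (T.stateSum N) := by
  obtain ⟨n, hn⟩ := exists_bubbleContraction_eq hodd H.dec_local k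
  refine ⟨n, ?_⟩
  have h1 : T'.rawSum N = zeta N ^ n * N * T.rawSum N := by
    rw [H.rawSum_eq, RoughQH.rawSum, Finset.mul_sum]
    refine Finset.sum_congr rfl fun ρ _ => ?_
    rw [Finset.sum_eq_single (ρ x)]
    · rw [hn, if_pos rfl, Function.update_eq_self]
      ring
    · intro β _ hβ
      rw [hn, if_neg hβ.symm]
      simp
    · simp
  rw [T'.stateSum_eq, T.stateSum_eq, ← H.natCast_mul_a N hT hT', h1]
  ring

end IsBubbleTransit

theorem EqMod.symm {N : ℕ} [NeZero N] {a b : ℂ} (h : EqMod N a b) : EqMod N b a := by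
  obtain ⟨n, rfl⟩ := h
  obtain ⟨n', hn'⟩ := exists_inverse_zeta_pow (N := N) n
  exact ⟨n', by rw [← mul_assoc, hn', one_mul]⟩

theorem IsPositiveTransit.eqMod {N : ℕ} [NeZero N] [Fintype ι] [DecidableEq ι] [Fintype ι']
    [DecidableEq ι'] (hodd : Odd N) {T : RoughQH ι} {T' : RoughQH ι'} (H : IsPositiveTransit T T')
    (hT : T.IsTriangulation) (hT' : T'.IsTriangulation) :
    EqMod N (T.stateSum N) (T'.stateSum N) := by
  obtain ⟨κ, P, s, φ, φ', H⟩ | ⟨x, k, e, φ, H⟩ := H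
  · exact H.eqMod hodd hT hT'
  · exact (H.eqMod hodd hT hT').symm

end BubbleSum

end QH

end

theorem mainTheorem8 (N : ℕ) (hN : 3 ≤ N) (hodd : Odd N) :
    (∀ (P : Finset (Fin 5)) (s : ℤˣ) (D : Fin 5 → QH.Decoration), QH.IsLocalMP P s D →
      ∃ n : ℕ, ∀ τ : Sym2 (Fin 5) → Fin N,
        QH.localContraction N D (QH.localSign P s) P τ =
          QH.zeta N ^ n * QH.localContraction N D (QH.localSign P s) Pᶜ τ) ∧
    (∀ (s : ℤˣ) (k : Fin 4) (e : Fin 3) (D D' : QH.Decoration), QH.IsLocalBubble s e D D' →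
      ∃ n : ℕ, ∀ α β : Fin N,
        QH.bubbleContraction N s k D D' α β =
          QH.zeta N ^ n * ((N : ℂ) * if α = β then 1 else 0)) ∧
    (∀ (ι ι' : Type) [Fintype ι] [DecidableEq ι] [Fintype ι'] [DecidableEq ι']
      (T : QH.RoughQH ι) (T' : QH.RoughQH ι'),
      T.IsQHTriangulation → T'.IsQHTriangulation → QH.IsQHTransit T T' →
        QH.EqMod N (T.stateSum N) (T'.stateSum N)) := by
  have : NeZero N := ⟨by omega⟩
  refine ⟨fun P s D H => QH.claim_all hodd P s H.1 D H,
    fun s k e D D' H => QH.exists_bubbleContraction_eq hodd H k, ?_⟩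
  rintro ι ι' _ _ _ _ T T' hT hT' (H | H)
  · exact H.eqMod hodd hT.triangulation hT'.triangulation
  · exact (H.eqMod hodd hT'.triangulation hT.triangulation).symm
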